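/- **Setting.** Let $0=t_0<t_1<\cdots$ and $l\ge 1$ be such that the cells $A_j=[t_{j-1},t_j)$, $j\ge1$, satisfy $|A_{j+l}|=|A_j|$, and put $\tau=t_l$. Let $N$ be a Poisson process on $[0,\infty)$ with independent increments and $N(t)-N(s)\sim\mathrm{Poisson}\big(\int_s^t\lambda(u)\,du\big)$, where $\lambda\ge0$ is measurable, $\tau$-periodic and integrable over a period; let $\Upsilon_n$ be its $n$-th arrival time. Let $Z_n^j$ ($n\ge1$, $1\le j\le l$) be independent random variables, jointly independent of $N$, where $Z^j_n$ has law $F_j$ with $\int z^2F_j(dz)<\infty$, and let $Z_n=Z_n^j$ if $\Upsilon_n\in\bigcup_{k\ge0}A_{kl+j}$. Let $D_t=\int_0^t d(u)\,du$ be a deterministic drift with $d$ locally integrable and $D_{t+\tau}=D_t$. The simple semi-Lévy process is $S_t=D_t+\sum_{n=1}^{N(t)}Z_n$. Let $q_0\ge p_0\ge1$, $\alpha_0>0$, $\alpha_{p_0}\ne0$, $\alpha_{p_0+1}=\dots=\alpha_{q_0}=0$, $\beta_{q_0}\neq0$, $\mathbf a=(\alpha_1,\dots,\alpha_{q_0})'$,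 $\mathbf e=(0,\dots,0,1)'\in\mathbb R^{q_0}$, and let $B$ be the $q_0\times q_0$ companion matrix with ones on the superdiagonal and last row $(-\beta_{q_0},\dots,-\beta_1)$. The state process $\mathbf Y$ is the càdlàg solution of $d\mathbf Y_t=B\mathbf Y_{t-}dt+\mathbf e(\alpha_0+\mathbf a'\mathbf Y_{t-})\,d[S,S]_t$, where $\mathbf Y_0$ is independent of $S$; the volatility is $V_t=\alpha_0+\mathbf a'\mathbf Y_{t-}$ for $t>0$ and $V_0=\alpha_0+\mathbf a'\mathbf Y_0$; the SS-COGARCH$(p_0,q_0)$ process is $G_t=\int_{(0,t]}\sqrt{V_u}\,dS_u$, and $G_t^{(p)}=G_{t+p}-G_t$. For $s\le t$ let $$\mathfrak J_{s,t}=e^{B(t-\Upsilon_{N(t)})}Q_{N(t)}\cdots Q_{N(s)+2}\,(I+Z_{N(s)+1}^2\mathbf e\mathbf a')\,e^{B(\Upsilon_{N(s)+1}-s)},\qquad Q_n=(I+Z_n^2\mathbf e\mathbf a')e^{B(\Upsilon_n-\Upsilon_{n-1})},$$ with $\mathfrak J_{s,t}=e^{B(t-s)}$ if $N(t)=N(s)$;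 $\mathfrak J_{s,t-}$ is its left limit in $t$. For $j\ge1$ write $\mu_j=\int z^2F_{j_0}(dz)$, where $1\le j_0\le l$ and $j_0\equiv j\pmod l$ (the second moment of a jump occurring in $A_j$). **Proposition 4.4.** Suppose that $G$ is a zero mean SS-COGARCH process, that is, $E(S_t)=0$ for all $t\ge0$. Suppose moreover that almost surely $V_t\ge0$ for all $t\ge0$, and that $E\|\mathbf Y_0\|<\infty$. Let $t\ge0$ and $h\ge p>0$. (a) $G_t^{(p)}$ and $G_{t+h}^{(p)}$ are square integrable, $E(G_t^{(p)})=0$ and $\mathrm{cov}(G_t^{(p)},G_{t+h}^{(p)})=0$. (b) $V_s$ is integrable for every $s\ge0$, and $s\mapsto E(V_s)\lambda(s)$ is integrable over $[t,t+p]$. There exist $m,m'\in\mathbb N_0$ and $i,i'\in\{1,\dots,l\}$ with $t\in A_{ml+i}$ and $t+p\in A_{(m+m')l+i'}$. If these two cells coincide, then $E\big((G_t^{(p)})^2\big)=\mu_i\int_t^{t+p}E(V_s)\lambda(s)\,ds$; otherwise $$E\big((G_t^{(p)})^2\big)=\mu_i\int_t^{t_{ml+i}}E(V_s)\lambda(s)\,ds+\mu_{i'}\int_{t_{(m+m')l+i'-1}}^{t+p}E(V_s)\lambda(s)\,ds+\sum_{r=i}^{m'l+i'-2}\mu_{r+1}\int_{t_{ml+r}}^{t_{ml+r+1}}E(V_s)\lambda(s)\,ds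 .$$ Moreover, there exist $n,n'\in\mathbb N_0$ and $j,j'\in\{1,\dots,l\}$ with $n\ge m$, $n+n'\ge m+m'$, $t+h\in A_{nl+j}$ and $t+h+p\in A_{(n+n')l+j'}$, such that the following holds if in addition $E(S_s^4)<\infty$ for all $s\ge0$ and $E\|\mathbf Y_0\|^2<\infty$. The variables $G_t^{(p)}$ and $G_{t+h}^{(p)}$ have finite fourth moments, $\mathbf Y_{t+p}$ is square integrable, the entries of $\mathfrak J_{t+p,s-}$ are integrable for $s>t+p$, and $C(s):=\lambda(s)\,E(\mathfrak J_{t+p,s-})\,\mathrm{cov}\big((G_t^{(p)})^2,\mathbf Y_{t+p}\big)$ is integrable over $[t+h,t+h+p]$. If the cells $A_{nl+j}$ and $A_{(n+n')l+j'}$ coincide, then $\mathrm{cov}\big((G_t^{(p)})^2,(G_{t+h}^{(p)})^2\big)=\mu_j\,\mathbf a'\int_{t+h}^{t+h+p}C(s)\,ds$; otherwise $$\mathrm{cov}\big((G_t^{(p)})^2,(G_{t+h}^{(p)})^2\big)=\mu_j\,\mathbf a'\!\int_{t+h}^{t_{nl+j}}C(s)\,ds+\mu_{j'}\,\mathbf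 a'\!\int_{t_{(n+n')l+j'-1}}^{t+h+p}C(s)\,ds+\sum_{r=j}^{n'l+j'-2}\mu_{r+1}\,\mathbf a'\!\int_{t_{nl+r}}^{t_{nl+r+1}}C(s)\,ds .$$ (Sums over an empty range are zero.) -/

import Mathlib

open MeasureTheory ProbabilityTheory Filter Topology
open scoped NNReal ENNReal Matrix

namespace SSCogarch

/-- A counting process `N` with càdlàg paths and unit jumps is a Poisson process with intensity
function `rate`: its increments are independent, and the increment over `(s, t]` has the Poisson
law with mean `∫ u in s..t, rate u`. Only times `t ≥ 0` matter. -/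
structure IsPoisson {Ω : Type*} [MeasurableSpace Ω] (P : Measure Ω)
    (rate : ℝ → ℝ) (N : ℝ → Ω → ℕ) : Prop where
  measurable : ∀ t, 0 ≤ t → Measurable (N t)
  zero : ∀ ω, N 0 ω = 0
  mono : ∀ ω s t, 0 ≤ s → s ≤ t → N s ω ≤ N t ω
  right_cont : ∀ ω t, 0 ≤ t → ContinuousWithinAt (fun s => N s ω) (Set.Ici t) t
  unit_jump : ∀ ω t, 0 < t → ∃ s, 0 ≤ s ∧ s < t ∧ N t ω ≤ N s ω + 1
  indep : HasIndepIncrements (fun (t : ℝ≥0) ω => (N (t : ℝ) ω : ℝ)) P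
  law : ∀ s t, 0 ≤ s → s ≤ t →
    P.map (fun ω => N t ω - N s ω) = poissonMeasure (Real.toNNReal (∫ u in s..t, rate u))

/-- The data of a simple compound Poisson process (simple semi-Lévy process) with period
`τ = part l`. The jumps are numbered from `0`: `mark n j` is the candidate size of the `(n+1)`-st
jump, used if this jump occurs in a cell of type `j`. The types `1, …, l` of the cells are the
elements `0, …, l - 1` of `Fin l`. -/
structure SimpleSemiLevy {Ω : Type*} [MeasurableSpace Ω] (P : Measure Ω) where
  /-- number of cells in a period -/
  l : ℕ
  l_pos : 0 < l
  /-- the partition points `0 = t₀ < t₁ < ⋯` -/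
  part : ℕ → ℝ
  part_zero : part 0 = 0
  part_strictMono : StrictMono part
  /-- `|A_{j+l}| = |A_j|` -/
  part_periodic : ∀ j, part (j + l + 1) - part (j + l) = part (j + 1) - part j
  /-- the intensity `λ` -/
  rate : ℝ → ℝ
  rate_measurable : Measurable rate
  rate_nonneg : ∀ t, 0 ≤ t → 0 ≤ rate t
  rate_periodic : ∀ t, 0 ≤ t → rate (t + part l) = rate t
  rate_integrable : IntervalIntegrable rate volume 0 (part l)
  /-- the density of the deterministic drift -/
  driftDensity : ℝ → ℝ
  driftDensity_integrable : ∀ t, 0 ≤ t → IntervalIntegrable driftDensity volume 0 t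
  drift_periodic : ∀ t, 0 ≤ t →
    (∫ u in (0 : ℝ)..(t + part l), driftDensity u) = ∫ u in (0 : ℝ)..t, driftDensity u
  /-- the Poisson process -/
  N : ℝ → Ω → ℕ
  poisson : IsPoisson P rate N
  /-- the jump laws -/
  F : Fin l → Measure ℝ
  F_prob : ∀ j, IsProbabilityMeasure (F j)
  F_sq : ∀ j, Integrable (fun z : ℝ => z ^ 2) (F j)
  mark : ℕ → Fin l → Ω → ℝ
  mark_measurable : ∀ n j, Measurable (mark n j)
  mark_law : ∀ n j, P.map (mark n j) = F j
  mark_indep : iIndepFun (fun (x : ℕ × Fin l) => mark x.1 x.2) P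
  /-- the family of all marks is independent of the process `N` -/
  mark_indep_N : Indep
    (⨆ x : ℕ × Fin l, MeasurableSpace.comap (mark x.1 x.2) inferInstance)
    (⨆ t : ℝ≥0, MeasurableSpace.comap (N (t : ℝ)) inferInstance) P

namespace SimpleSemiLevy

variable {Ω : Type*} [MeasurableSpace Ω] {P : Measure Ω} (L : SimpleSemiLevy P)

/-- The cell `A_j = [t_{j-1}, t_j)`, for `j ≥ 1`. -/
def cell (j : ℕ) : Set ℝ := Set.Ico (L.part (j - 1)) (L.part j)

/-- The type of the cell `A_j`, for `j ≥ 1`: cells whose indices agree modulo `l` have the same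
type, and `A_1, …, A_l` have the types `0, …, l - 1`. -/
def cellType (j : ℕ) : Fin L.l := ⟨(j - 1) % L.l, Nat.mod_lt _ L.l_pos⟩

/-- The union of all cells of a given type. -/
def cells (j : Fin L.l) : Set ℝ := ⋃ k : ℕ, L.cell (k * L.l + (j + 1))

/-- `E(Z_j ^ 2)`, the second moment of a jump that occurs in the cell `A_j`. -/
noncomputable def jumpSq (j : ℕ) : ℝ := ∫ z, z ^ 2 ∂(L.F (L.cellType j))

/-- The drift `D_t`. -/
noncomputable def drift (t : ℝ) : ℝ := ∫ u in (0 : ℝ)..t, L.driftDensity u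

/-- The time of the `(n+1)`-st jump. It is used only for `n < N t ω` with some `t`, so that the
set is not empty. -/
noncomputable def arrival (n : ℕ) (ω : Ω) : ℝ := sInf {t : ℝ | 0 ≤ t ∧ n + 1 ≤ L.N t ω}

open Classical in
/-- The size of the `(n+1)`-st jump. -/
noncomputable def jump (n : ℕ) (ω : Ω) : ℝ :=
  ∑ j : Fin L.l, if L.arrival n ω ∈ L.cells j then L.mark n j ω else 0

/-- The simple semi-Lévy process `S_t = D_t + ∑_{n ≤ N(t)} Z_n`. -/
noncomputable def S (t : ℝ) (ω : Ω) : ℝ :=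
  L.drift t + ∑ n ∈ Finset.range (L.N t ω), L.jump n ω

/-- The pathwise integral `∫_{(0,t]} f dS`. -/
noncomputable def integralS (f : ℝ → ℝ) (t : ℝ) (ω : Ω) : ℝ :=
  (∫ u in (0 : ℝ)..t, f u * L.driftDensity u) +
    ∑ n ∈ Finset.range (L.N t ω), f (L.arrival n ω) * L.jump n ω

/-- The pathwise integral `∫_{(0,t]} f d[S,S]`. As the drift is continuous and of finite
variation, `[S,S]` is the sum of the squared jumps of `S`. -/
noncomputable def integralQV (f : ℝ → ℝ) (t : ℝ) (ω : Ω) : ℝ :=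
  ∑ n ∈ Finset.range (L.N t ω), f (L.arrival n ω) * L.jump n ω ^ 2

end SimpleSemiLevy

/-- The parameters of a COGARCH process of orders `(p, q)`, where `a k = α_{k+1}` and
`β k = β_{k+1}` for `k : Fin q`. -/
structure Params (p q : ℕ) where
  p_pos : 1 ≤ p
  p_le_q : p ≤ q
  α₀ : ℝ
  α₀_pos : 0 < α₀
  a : Fin q → ℝ
  a_ne : ∀ k : Fin q, (k : ℕ) + 1 = p → a k ≠ 0
  a_zero : ∀ k : Fin q, p < (k : ℕ) + 1 → a k = 0
  β : Fin q → ℝ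
  β_ne : ∀ k : Fin q, (k : ℕ) + 1 = q → β k ≠ 0

namespace Params

variable {p q : ℕ} (C : Params p q)

/-- The companion matrix with last row `(-β_q, …, -β_1)`. -/
def B : Matrix (Fin q) (Fin q) ℝ := fun i j =>
  if (i : ℕ) + 1 = q then -C.β (Fin.rev j) else if (j : ℕ) = (i : ℕ) + 1 then 1 else 0

/-- The last unit vector. -/
def e (_ : Params p q) : Fin q → ℝ := fun k => if (k : ℕ) + 1 = q then 1 else 0

variable {Ω : Type*} [MeasurableSpace Ω] {P : Measure Ω} (L : SimpleSemiLevy P)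

/-- `Y` is the state process driven by `L`: `Y 0` is a random vector independent of the process
`S`, and almost surely the path of `Y` on `[0, ∞)` is càdlàg and solves
`dY_t = B Y_{t-} dt + e (α₀ + a' Y_{t-}) d[S,S]_t`. -/
structure IsState (Y : ℝ → Ω → Fin q → ℝ) : Prop where
  measurable_zero : Measurable (Y 0)
  indep_zero : Indep (MeasurableSpace.comap (Y 0) inferInstance)
    (⨆ t : ℝ≥0, MeasurableSpace.comap (L.S (t : ℝ)) inferInstance) P
  right_cont : ∀ᵐ ω ∂P, ∀ t, 0 ≤ t → ContinuousWithinAt (fun s => Y s ω) (Set.Ici t) t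
  left_lim : ∀ᵐ ω ∂P, ∀ t, 0 < t → ∃ y, Tendsto (fun s => Y s ω) (𝓝[<] t) (𝓝 y)
  sde : ∀ᵐ ω ∂P, ∀ t, 0 ≤ t → ∀ k,
    Y t ω k = Y 0 ω k
      + (∫ s in (0 : ℝ)..t, (C.B *ᵥ Function.leftLim (fun u => Y u ω) s) k)
      + C.e k * L.integralQV
          (fun s => C.α₀ + C.a ⬝ᵥ Function.leftLim (fun u => Y u ω) s) t ω

/-- The volatility `V_t = α₀ + a' Y_{t-}` for `t > 0`, and `V_0 = α₀ + a' Y_0`. -/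
noncomputable def V (Y : ℝ → Ω → Fin q → ℝ) (t : ℝ) (ω : Ω) : ℝ :=
  C.α₀ + C.a ⬝ᵥ (if 0 < t then Function.leftLim (fun u => Y u ω) t else Y 0 ω)

/-- The process `G_t = ∫_{(0,t]} √V dS`. -/
noncomputable def G (Y : ℝ → Ω → Fin q → ℝ) (t : ℝ) (ω : Ω) : ℝ :=
  L.integralS (fun u => Real.sqrt (C.V Y u ω)) t ω

/-- The increment of `G` over `(t, t + r]`. -/
noncomputable def incr (Y : ℝ → Ω → Fin q → ℝ) (r t : ℝ) (ω : Ω) : ℝ :=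
  C.G L Y (t + r) ω - C.G L Y t ω

/-- Starting from time `s`: the time `s` itself for `k = 0`, and the time of the `k`-th jump
after time `s` for `k ≥ 1`. -/
noncomputable def jumpTime (s : ℝ) (ω : Ω) : ℕ → ℝ
  | 0 => s
  | k + 1 => L.arrival (L.N s ω + k) ω

/-- The random matrix that propagates the linear part of the state equation from time `s` through
the first `k` jumps after `s`. -/
noncomputable def jumpFlow (s : ℝ) (ω : Ω) : ℕ → Matrix (Fin q) (Fin q) ℝ
  | 0 => 1
  | k + 1 => (1 + L.jump (L.N s ω + k) ω ^ 2 • Matrix.vecMulVec C.e C.a) *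
      NormedSpace.exp ((jumpTime L s ω (k + 1) - jumpTime L s ω k) • C.B) * jumpFlow s ω k

/-- The random matrix `J_{s,t}` in `Y_t = J_{s,t} Y_s + K_{s,t}`, namely
`e^{B (t - Υ_{N(t)})} Q_{N(t)} ⋯ Q_{N(s)+2} (I + Z_{N(s)+1}^2 e a') e^{B (Υ_{N(s)+1} - s)}` with
`Q_n = (I + Z_n^2 e a') e^{B (Υ_n - Υ_{n-1})}`, which is `e^{B (t - s)}` if there is no jump in
`(s, t]`. -/
noncomputable def J (s t : ℝ) (ω : Ω) : Matrix (Fin q) (Fin q) ℝ :=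
  NormedSpace.exp ((t - jumpTime L s ω (L.N t ω - L.N s ω)) • C.B) *
    C.jumpFlow L s ω (L.N t ω - L.N s ω)

/-- The left limit `J_{s,t-}`. -/
noncomputable def Jminus (s t : ℝ) (ω : Ω) : Matrix (Fin q) (Fin q) ℝ :=
  Function.leftLim (fun u => C.J L s u ω) t

/-- The expectation `E(J_{s,t-})`, entry by entry. -/
noncomputable def meanJ (s t : ℝ) : Matrix (Fin q) (Fin q) ℝ :=
  fun i k => ∫ ω, C.Jminus L s t ω i k ∂P

/-- The vector `cov((G_t^{(r)})^2, Y_{t+r})`. -/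
noncomputable def covGY (Y : ℝ → Ω → Fin q → ℝ) (r t : ℝ) : Fin q → ℝ :=
  fun k => cov[fun ω => C.incr L Y r t ω ^ 2, fun ω => Y (t + r) ω k; P]

/-- The vector `λ(s) E(J_{t+r,s-}) cov((G_t^{(r)})^2, Y_{t+r})`. -/
noncomputable def covIntegrand (Y : ℝ → Ω → Fin q → ℝ) (r t s : ℝ) : Fin q → ℝ :=
  L.rate s • (C.meanJ L (t + r) s *ᵥ C.covGY L Y r t)

/-- The vector `∫_x^y λ(s) E(J_{t+r,s-}) cov((G_t^{(r)})^2, Y_{t+r}) ds`. -/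
noncomputable def covIntegral (Y : ℝ → Ω → Fin q → ℝ) (r t x y : ℝ) : Fin q → ℝ :=
  fun k => ∫ s in x..y, C.covIntegrand L Y r t s k

end Params

end SSCogarch

set_option linter.unusedSectionVars false

namespace SSCogarch

/-! ### Counting paths -/

/-! The drift is deterministic, so all randomness of S sits in the jump process X = S − D. The proof
rests on three facts about X, followed by a weighted Itô isometry.

Independence. Inside one cell the increment of X is a sum of a Poisson number of fresh marks of a
single type, independent of everything before (`measure_inter_cell`). Chaining cells shows that the
history up to s is independent of all later increments (`indep_history_future`). Since S is centred,
the drift over a cell cancels the mean of the jumps, and E(S_t − S_s)² is the integral of λ times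
the second moment of a jump (`integral_S_sub_sq`).

Measurability. A solution of the state equation is the limit of Euler schemes that see only
increments of X (`IsSolution.tendsto_eulerEnd`). Hence Y_u is a function of Y_0 and of X on [0, u].
The scheme is affine in its starting value, so Y_u = J_{s,u} Y_s + K with J and K functions of the
increments after s. As Y_0 is only assumed independent of S, all information is phrased through X
and not through N and the marks (`IsState.indep_past_future`).

Domination. The product R of the factors 1 + ρ|Z_n| controls every path: (‖Y_0‖ + 1) R² bounds, up
to constants, the state, the volatility and the squared increments of G. Its moments are finite
because the marks are independent of N and a Poisson variable has all exponential moments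
(`lintegral_prod_jumps_lt_top`).

Riemann sums of √V against S converge to the increments of G. For a weight X measurable with respect
to the past of s, each summand is a past variable times a centred independent increment. In the
limit E[X (G_t − G_s)] = 0 (`integral_mul_G_sub`), and E[X (G_t − G_s)²] is the integral over [s, t]
of λ(u) E[X V_u] times the second moment of a jump at u (`integral_mul_G_sub_sq`). The weight 1
gives the mean and the second moment of an increment. An earlier increment as weight gives the
vanishing covariance. A squared earlier increment as weight, after subtracting the product of the
means, leaves cov(X, V_u), which the decomposition of Y_u turns into a' E(J_{s,u−}) cov(X, Y_s)
(`integral_mul_V_sub`). The second moment of a jump is constant on cells, so cutting the integral at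
the partition points gives the stated formulas (`integral_sqAt_mul_eq`). -/

/-- A deterministic càdlàg counting path with unit jumps, started at `0`. -/
structure IsCountingPath (c : ℝ → ℕ) : Prop where
  zero : c 0 = 0
  mono : ∀ s t, 0 ≤ s → s ≤ t → c s ≤ c t
  right_cont : ∀ t, 0 ≤ t → ContinuousWithinAt c (Set.Ici t) t
  unit_jump : ∀ t, 0 < t → ∃ s, 0 ≤ s ∧ s < t ∧ c t ≤ c s + 1

/-- The time of the `(n+1)`-st jump of a counting path. -/
noncomputable def arr (c : ℝ → ℕ) (n : ℕ) : ℝ := sInf {t : ℝ | 0 ≤ t ∧ n + 1 ≤ c t}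

namespace IsCountingPath

variable {c : ℝ → ℕ} (hc : IsCountingPath c)
include hc

lemma exists_right_const {u : ℝ} (hu : 0 ≤ u) : ∃ v, u < v ∧ ∀ r, u ≤ r → r < v → c r = c u := by
  have h := hc.right_cont u hu
  have h1 : ∀ᶠ r in 𝓝[Set.Ici u] u, c r = c u := by
    have := h.eventually (show ∀ᶠ k in 𝓝 (c u), k = c u by simp)
    exact this
  obtain ⟨v, hv, hsub⟩ := (mem_nhdsGE_iff_exists_Ico_subset).1 h1
  exact ⟨v, hv, fun r h1 h2 => hsub ⟨h1, h2⟩⟩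

/-- After a time s with `c u ≤ c s + 1`, a monotone integer path has only two possible values before
u. Either it reaches `c u` before u and stays there, or it is stuck at `c s` until u. -/
lemma exists_left_const {u : ℝ} (hu : 0 < u) :
    ∃ r, 0 ≤ r ∧ r < u ∧ (∀ r', r ≤ r' → r' < u → c r' = c r) ∧ c u ≤ c r + 1 := by
  obtain ⟨s, hs0, hsu, hs⟩ := hc.unit_jump u hu
  by_cases h : ∃ r, s ≤ r ∧ r < u ∧ c r = c u
  · obtain ⟨r, h1, h2, h3⟩ := h
    refine ⟨r, hs0.trans h1, h2, fun r' h4 h5 => le_antisymm ?_ ?_, by omega⟩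
    · rw [h3]; exact hc.mono _ _ (by linarith) h5.le
    · exact hc.mono _ _ (by linarith) h4
  · push Not at h
    refine ⟨s, hs0, hsu, fun r' h4 h5 => ?_, hs⟩
    have h6 := h r' h4 h5
    have h7 := hc.mono r' u (by linarith) h5.le
    have h8 := hc.mono s r' hs0 h4
    omega

/-- The infimum is attained because the path is constant to the right of it. -/
lemma arr_spec {n : ℕ} {t : ℝ} (ht : 0 ≤ t) (h : n < c t) :
    0 ≤ arr c n ∧ arr c n ≤ t ∧ n < c (arr c n) := by
  have hne : {t : ℝ | 0 ≤ t ∧ n + 1 ≤ c t}.Nonempty := ⟨t, ht, h⟩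
  have hbd : BddBelow {t : ℝ | 0 ≤ t ∧ n + 1 ≤ c t} := ⟨0, fun x hx => hx.1⟩
  have h0 : 0 ≤ arr c n := le_csInf hne fun x hx => hx.1
  refine ⟨h0, csInf_le hbd ⟨ht, h⟩, ?_⟩
  obtain ⟨v, hv, hcv⟩ := hc.exists_right_const h0
  obtain ⟨x, hx, hxv⟩ := exists_lt_of_csInf_lt hne hv
  have := hcv x (csInf_le hbd hx) hxv
  have := hx.2
  omega

/-- The time `T` certifies that the jump occurs at all; otherwise the set is empty and its `sInf` is
the default value 0. -/
lemma arr_le_iff {n : ℕ} {t T : ℝ} (ht : 0 ≤ t) (hT : 0 ≤ T) (h : n < c T) :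
    arr c n ≤ t ↔ n < c t := by
  obtain ⟨h1, h2, h3⟩ := hc.arr_spec hT h
  exact ⟨fun h4 => h3.trans_le (hc.mono _ _ h1 h4), fun h4 => (hc.arr_spec ht h4).2.1⟩

lemma lt_arr_iff {n : ℕ} {t T : ℝ} (ht : 0 ≤ t) (hT : 0 ≤ T) (h : n < c T) :
    t < arr c n ↔ c t ≤ n := by
  rw [← not_le, hc.arr_le_iff ht hT h, not_lt]

lemma arr_pos {n : ℕ} {T : ℝ} (hT : 0 ≤ T) (h : n < c T) : 0 < arr c n := by
  rw [hc.lt_arr_iff le_rfl hT h, hc.zero]; exact Nat.zero_le _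

/-- Unit jumps exclude two arrivals at the same time: the count is at most n before the arrival,
hence at most n + 1 at it. -/
lemma count_arr {n : ℕ} {T : ℝ} (hT : 0 ≤ T) (h : n < c T) : c (arr c n) = n + 1 := by
  obtain ⟨h1, h2, h3⟩ := hc.arr_spec hT h
  obtain ⟨s, hs0, hs, hs1⟩ := hc.unit_jump _ (hc.arr_pos hT h)
  have := (hc.lt_arr_iff hs0 hT h).1 hs
  omega

lemma arr_lt_arr_succ {n : ℕ} {T : ℝ} (hT : 0 ≤ T) (h : n + 1 < c T) :
    arr c n < arr c (n + 1) := by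
  have h' : n < c T := by omega
  rw [hc.lt_arr_iff (hc.arr_pos hT h').le hT h, hc.count_arr hT h']

lemma mem_Ioc_of_mem_Ico {n : ℕ} {s t : ℝ} (hs : 0 ≤ s) (ht : 0 ≤ t)
    (hn : n ∈ Finset.Ico (c s) (c t)) : arr c n ∈ Set.Ioc s t := by
  rw [Finset.mem_Ico] at hn
  exact ⟨(hc.lt_arr_iff hs ht hn.2).2 hn.1, (hc.arr_spec ht hn.2).2.1⟩

lemma exists_arr_of_lt {u r : ℝ} (hr : 0 ≤ r) (hru : r < u)
    (hconst : ∀ r', r ≤ r' → r' < u → c r' = c r) (hlt : c r < c u) : arr c (c r) = u := by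
  have hu : 0 ≤ u := hr.trans hru.le
  refine le_antisymm (hc.arr_spec hu hlt).2.1 ?_
  by_contra h
  push Not at h
  have h1 := (hc.lt_arr_iff hr hu hlt).2 le_rfl
  have h2 := hc.count_arr hu hlt
  rw [hconst _ h1.le h] at h2
  omega

end IsCountingPath

/-! ### Uniform grids -/

/-- The `i`-th point of the partition of `[s, t]` into `m + 1` intervals of equal length. -/
noncomputable def grid (s t : ℝ) (m i : ℕ) : ℝ := s + i * ((t - s) / (m + 1))

/-- The mesh of `grid s t m`. -/
noncomputable def mesh (s t : ℝ) (m : ℕ) : ℝ := (t - s) / (m + 1)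

/-- The largest point of the grid strictly below `u`. -/
noncomputable def gridFloor (s t : ℝ) (m : ℕ) (u : ℝ) : ℝ :=
  s + (⌈(u - s) / mesh s t m⌉ - 1) * mesh s t m

lemma grid_zero (s t : ℝ) (m : ℕ) : grid s t m 0 = s := by simp [grid]

lemma grid_last (s t : ℝ) (m : ℕ) : grid s t m (m + 1) = t := by
  simp only [grid]; push_cast; field_simp; ring

lemma grid_succ (s t : ℝ) (m i : ℕ) : grid s t m (i + 1) = grid s t m i + mesh s t m := by
  simp only [grid, mesh]; push_cast; ring

lemma mesh_nonneg {s t : ℝ} (hst : s ≤ t) (m : ℕ) : 0 ≤ mesh s t m := by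
  have := sub_nonneg.2 hst
  unfold mesh; positivity

lemma mesh_pos {s t : ℝ} (hst : s < t) (m : ℕ) : 0 < mesh s t m := by
  have := sub_pos.2 hst
  unfold mesh; positivity

lemma mesh_mul (s t : ℝ) (m : ℕ) : (m + 1 : ℕ) * mesh s t m = t - s := by
  unfold mesh; push_cast; field_simp

lemma tendsto_mesh (s t : ℝ) : Tendsto (mesh s t) atTop (𝓝 0) := by
  have := (tendsto_one_div_add_atTop_nhds_zero_nat (𝕜 := ℝ)).const_mul (t - s)
  rw [mul_zero] at this
  refine this.congr fun m => ?_
  simp [mesh, div_eq_mul_inv]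

lemma grid_monotone {s t : ℝ} (hst : s ≤ t) (m : ℕ) : Monotone (grid s t m) := by
  refine monotone_nat_of_le_succ fun i => ?_
  rw [grid_succ]
  linarith [mesh_nonneg hst m]

lemma le_grid {s t : ℝ} (hst : s ≤ t) (m i : ℕ) : s ≤ grid s t m i := by
  have := grid_monotone hst m (Nat.zero_le i)
  rwa [grid_zero] at this

lemma grid_le {s t : ℝ} (hst : s ≤ t) {m i : ℕ} (hi : i ≤ m + 1) : grid s t m i ≤ t := by
  have := grid_monotone hst m hi
  rwa [grid_last] at this

lemma gridFloor_eq {s t u : ℝ} (hst : s < t) {m i : ℕ}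
    (hu : u ∈ Set.Ioc (grid s t m i) (grid s t m (i + 1))) : gridFloor s t m u = grid s t m i := by
  have hm := mesh_pos hst m
  have h1 : grid s t m i = s + i * mesh s t m := rfl
  have : ⌈(u - s) / mesh s t m⌉ = (i : ℤ) + 1 := by
    rw [Int.ceil_eq_iff]
    obtain ⟨ha, hb⟩ := hu
    rw [grid_succ] at hb
    rw [h1] at ha hb
    constructor
    · rw [lt_div_iff₀ hm]; push_cast; linarith
    · rw [div_le_iff₀ hm]; push_cast; linarith
  simp only [gridFloor, this, h1]; push_cast; ring

lemma gridFloor_lt {s t u : ℝ} (hst : s < t) (m : ℕ) : gridFloor s t m u < u := by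
  have hm := mesh_pos hst m
  have h := Int.ceil_lt_add_one ((u - s) / mesh s t m)
  have h2 : (u - s) / mesh s t m * mesh s t m = u - s := div_mul_cancel₀ _ hm.ne'
  simp only [gridFloor]
  nlinarith

lemma sub_mesh_le_gridFloor {s t u : ℝ} (hst : s < t) (m : ℕ) :
    u - mesh s t m ≤ gridFloor s t m u := by
  have hm := mesh_pos hst m
  have h := Int.le_ceil ((u - s) / mesh s t m)
  have h2 : (u - s) / mesh s t m * mesh s t m = u - s := div_mul_cancel₀ _ hm.ne'
  simp only [gridFloor]
  nlinarith

lemma le_gridFloor {s t u : ℝ} (hst : s < t) (hu : s < u) (m : ℕ) : s ≤ gridFloor s t m u := by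
  have hm := mesh_pos hst m
  have h : 0 < ⌈(u - s) / mesh s t m⌉ := Int.ceil_pos.2 (div_pos (sub_pos.2 hu) hm)
  have h' : (1 : ℝ) ≤ ⌈(u - s) / mesh s t m⌉ := by exact_mod_cast h
  simp only [gridFloor]
  nlinarith

/-- The grid point lies strictly below u, so the convergence takes place in `𝓝[<] u`. This is why
step functions on the grids produce left limits, as the state equation and the definition of V
require. -/
lemma tendsto_gridFloor {s t : ℝ} (hst : s < t) (u : ℝ) :
    Tendsto (fun m => gridFloor s t m u) atTop (𝓝[<] u) := by
  refine tendsto_nhdsWithin_iff.2 ⟨?_, Eventually.of_forall fun m => gridFloor_lt hst m⟩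
  refine tendsto_of_tendsto_of_tendsto_of_le_of_le (g := fun m => u - mesh s t m) (h := fun _ => u)
    ?_ tendsto_const_nhds (fun m => sub_mesh_le_gridFloor hst m) fun m => (gridFloor_lt hst m).le
  simpa using (tendsto_mesh s t).const_sub u

/-! ### Riemann sums -/

lemma sum_range_sum_Ico {M : Type*} [AddCommMonoid M] (F : ℕ → M) {a : ℕ → ℕ} (ha : Monotone a)
    (k : ℕ) : ∑ i ∈ Finset.range k, ∑ n ∈ Finset.Ico (a i) (a (i + 1)), F n
      = ∑ n ∈ Finset.Ico (a 0) (a k), F n := by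
  induction k with
  | zero => simp
  | succ k ih =>
    rw [Finset.sum_range_succ, ih, Finset.sum_Ico_consecutive _ (ha (Nat.zero_le k))
      (ha (Nat.le_succ k))]

lemma prod_range_prod_Ico {M : Type*} [CommMonoid M] (F : ℕ → M) {a : ℕ → ℕ} (ha : Monotone a)
    (k : ℕ) : ∏ i ∈ Finset.range k, ∏ n ∈ Finset.Ico (a i) (a (i + 1)), F n
      = ∏ n ∈ Finset.Ico (a 0) (a k), F n := by
  induction k with
  | zero => simp
  | succ k ih =>
    rw [Finset.prod_range_succ, ih, Finset.prod_Ico_consecutive _ (ha (Nat.zero_le k))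
      (ha (Nat.le_succ k))]

lemma sum_range_sub_sum_range (z : ℕ → ℝ) {a b : ℕ} (hab : a ≤ b) :
    ∑ n ∈ Finset.range b, z n - ∑ n ∈ Finset.range a, z n = ∑ n ∈ Finset.Ico a b, z n :=
  (Finset.sum_Ico_eq_sub z hab).symm

namespace IsCountingPath

variable {c : ℝ → ℕ} (hc : IsCountingPath c)
include hc

lemma monotone_grid {s t : ℝ} (hs : 0 ≤ s) (hst : s ≤ t) (m : ℕ) :
    Monotone fun i => c (grid s t m i) := fun _ _ h =>
  hc.mono _ _ (hs.trans (le_grid hst _ _)) (grid_monotone hst m h)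

/-- The jumps are regrouped by grid interval; the left end of the interval that contains an arrival
is its `gridFloor`. -/
lemma sum_grid {M : Type*} [AddCommMonoid M] {s t : ℝ} (hs : 0 ≤ s) (hst : s < t)
    (F : ℝ → ℕ → M) (m : ℕ) :
    ∑ i ∈ Finset.range (m + 1), ∑ n ∈ Finset.Ico (c (grid s t m i)) (c (grid s t m (i + 1))),
      F (grid s t m i) n
      = ∑ n ∈ Finset.Ico (c s) (c t), F (gridFloor s t m (arr c n)) n := by
  have h := sum_range_sum_Ico (fun n => F (gridFloor s t m (arr c n)) n)
    (hc.monotone_grid hs hst.le m) (m + 1)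
  rw [grid_zero, grid_last] at h
  rw [← h]
  refine Finset.sum_congr rfl fun i _ => Finset.sum_congr rfl fun n hn => ?_
  rw [gridFloor_eq hst (hc.mem_Ioc_of_mem_Ico (hs.trans (le_grid hst.le _ _))
    (hs.trans (le_grid hst.le _ _)) hn)]

/-- Finitely many jumps occur up to t, at distinct times, so the mesh eventually falls below every
gap between consecutive arrivals. -/
lemma eventually_le_one_jump {s t : ℝ} (hs : 0 ≤ s) (hst : s < t) :
    ∀ᶠ m in atTop, ∀ i < m + 1, c (grid s t m (i + 1)) ≤ c (grid s t m i) + 1 := by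
  have ht : 0 ≤ t := hs.trans hst.le
  have h1 : ∀ᶠ m in atTop, ∀ n ∈ Finset.range (c t - 1), mesh s t m < arr c (n + 1) - arr c n := by
    rw [eventually_all_finset]
    intro n hn
    rw [Finset.mem_range] at hn
    exact (tendsto_mesh s t).eventually
      (gt_mem_nhds (sub_pos.2 (hc.arr_lt_arr_succ ht (by omega))))
  filter_upwards [h1] with m hm i hi
  by_contra h
  push Not at h
  have ha : 0 ≤ grid s t m i := hs.trans (le_grid hst.le _ _)
  have hb : 0 ≤ grid s t m (i + 1) := hs.trans (le_grid hst.le _ _)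
  have h2 : c (grid s t m (i + 1)) ≤ c t := hc.mono _ _ hb (grid_le hst.le hi)
  have h3 := hm (c (grid s t m i)) (by rw [Finset.mem_range]; omega)
  have h4 := hc.mem_Ioc_of_mem_Ico (n := c (grid s t m i)) ha hb
    (by rw [Finset.mem_Ico]; omega)
  have h5 := hc.mem_Ioc_of_mem_Ico (n := c (grid s t m i) + 1) ha hb
    (by rw [Finset.mem_Ico]; omega)
  have h6 := h5.2
  have h7 := h4.1
  rw [grid_succ] at h6
  linarith

end IsCountingPath

/-- A function that maps `0` to `1` turns the sum over at most one jump into a product. -/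
lemma map_sum_Ico_of_le_one {M : Type*} [CommMonoid M] (f : ℝ → M) (hf : f 0 = 1) (z : ℕ → ℝ)
    {a b : ℕ} (hab : a ≤ b) (hb : b ≤ a + 1) :
    f (∑ n ∈ Finset.Ico a b, z n) = ∏ n ∈ Finset.Ico a b, f (z n) := by
  rcases hab.eq_or_lt with rfl | h
  · simp [hf]
  · obtain rfl : b = a + 1 := by omega
    simp

lemma sq_sum_Ico_of_le_one (z : ℕ → ℝ) {a b : ℕ} (hab : a ≤ b) (hb : b ≤ a + 1) :
    (∑ n ∈ Finset.Ico a b, z n) ^ 2 = ∑ n ∈ Finset.Ico a b, z n ^ 2 := by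
  rcases hab.eq_or_lt with rfl | h
  · simp
  · obtain rfl : b = a + 1 := by omega
    simp

/-- The step functions on the grids, integrated against a density. -/
lemma sum_grid_integral {E : Type*} [NormedAddCommGroup E] [NormedSpace ℝ E] {s t : ℝ}
    (hst : s < t) (F : ℝ → ℝ → E) (m : ℕ)
    (hF : ∀ i < m + 1, IntervalIntegrable (F (grid s t m i)) volume (grid s t m i)
      (grid s t m (i + 1))) :
    ∑ i ∈ Finset.range (m + 1), ∫ u in (grid s t m i)..(grid s t m (i + 1)), F (grid s t m i) u
      = ∫ u in s..t, F (gridFloor s t m u) u := by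
  have hcongr : ∀ i, ∀ u ∈ Set.uIoc (grid s t m i) (grid s t m (i + 1)),
      F (gridFloor s t m u) u = F (grid s t m i) u := by
    intro i u hu
    rw [Set.uIoc_of_le (grid_monotone hst.le m i.le_succ)] at hu
    rw [gridFloor_eq hst hu]
  have h := intervalIntegral.sum_integral_adjacent_intervals (μ := volume) (a := grid s t m)
    (n := m + 1) (f := fun u => F (gridFloor s t m u) u) (fun k hk =>
      (intervalIntegrable_congr fun u hu => hcongr k u hu).2 (hF k hk))
  rw [grid_zero, grid_last] at h
  rw [← h]
  refine Finset.sum_congr rfl fun i _ => ?_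
  exact intervalIntegral.integral_congr_ae (Eventually.of_forall fun u hu => (hcongr i u hu).symm)

/-! ### Convergence of step functions with left limits -/

section StepFunctions

variable {E : Type*} [NormedAddCommGroup E]

/-- The step function factors through an integer-valued ceiling, so nothing is required of `y`.
Measurability of left-limit functions is obtained from this. -/
lemma stronglyMeasurable_comp_gridFloor (y : ℝ → E) (s t : ℝ) (m : ℕ) :
    StronglyMeasurable fun u => y (gridFloor s t m u) := by
  have h : StronglyMeasurable fun k : ℤ => y (s + ((k : ℝ) - 1) * mesh s t m) :=
    StronglyMeasurable.of_discrete
  exact h.comp_measurable (g := fun u => ⌈(u - s) / mesh s t m⌉)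
    (Int.measurable_ceil.comp ((measurable_id.sub_const s).div_const _))

variable {s t : ℝ} {y yl : ℝ → E}

lemma tendsto_comp_gridFloor (hst : s < t)
    (hl : ∀ u ∈ Set.Ioc s t, Tendsto y (𝓝[<] u) (𝓝 (yl u))) {u : ℝ} (hu : u ∈ Set.Ioc s t) :
    Tendsto (fun m => y (gridFloor s t m u)) atTop (𝓝 (yl u)) :=
  (hl u hu).comp (tendsto_gridFloor hst u)

lemma gridFloor_mem {u : ℝ} (hst : s < t) (hu : u ∈ Set.Ioc s t) (m : ℕ) :
    gridFloor s t m u ∈ Set.Icc s t :=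
  ⟨le_gridFloor hst hu.1 m, (gridFloor_lt hst m).le.trans hu.2⟩

lemma aestronglyMeasurable_leftLim (hst : s ≤ t)
    (hl : ∀ u ∈ Set.Ioc s t, Tendsto y (𝓝[<] u) (𝓝 (yl u))) :
    AEStronglyMeasurable yl (volume.restrict (Set.uIoc s t)) := by
  rcases hst.eq_or_lt with rfl | hst
  · simp
  refine aestronglyMeasurable_of_tendsto_ae atTop
    (fun m => (stronglyMeasurable_comp_gridFloor y s t m).aestronglyMeasurable) ?_
  rw [Set.uIoc_of_le hst.le]
  exact (ae_restrict_iff' measurableSet_Ioc).2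
    (Eventually.of_forall fun u hu => tendsto_comp_gridFloor hst hl hu)

lemma norm_leftLim_le {K : ℝ} (hst : s < t)
    (hl : ∀ u ∈ Set.Ioc s t, Tendsto y (𝓝[<] u) (𝓝 (yl u)))
    (hK : ∀ u ∈ Set.Icc s t, ‖y u‖ ≤ K) {u : ℝ} (hu : u ∈ Set.Ioc s t) : ‖yl u‖ ≤ K :=
  le_of_tendsto (tendsto_comp_gridFloor hst hl hu).norm
    (Eventually.of_forall fun m => hK _ (gridFloor_mem hst hu m))

lemma intervalIntegrable_leftLim {K : ℝ} (hst : s ≤ t)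
    (hl : ∀ u ∈ Set.Ioc s t, Tendsto y (𝓝[<] u) (𝓝 (yl u)))
    (hK : ∀ u ∈ Set.Icc s t, ‖y u‖ ≤ K) : IntervalIntegrable yl volume s t := by
  rcases hst.eq_or_lt with rfl | hst
  · simp
  refine (intervalIntegrable_const (c := K)).mono_fun (aestronglyMeasurable_leftLim hst.le hl) ?_
  rw [Set.uIoc_of_le hst.le]
  refine (ae_restrict_iff' measurableSet_Ioc).2 (Eventually.of_forall fun u hu => ?_)
  exact (norm_leftLim_le hst hl hK hu).trans (le_abs_self K)

variable [NormedSpace ℝ E]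

lemma tendsto_integral_gridFloor {K : ℝ} (hst : s < t)
    (hl : ∀ u ∈ Set.Ioc s t, Tendsto y (𝓝[<] u) (𝓝 (yl u)))
    (hK : ∀ u ∈ Set.Icc s t, ‖y u‖ ≤ K) {d : ℝ → ℝ} (hd : IntervalIntegrable d volume s t) :
    Tendsto (fun m => ∫ u in s..t, d u • y (gridFloor s t m u)) atTop
      (𝓝 (∫ u in s..t, d u • yl u)) := by
  refine intervalIntegral.tendsto_integral_filter_of_dominated_convergence (fun u => ‖d u‖ * K)
    (Eventually.of_forall fun m => ?_) (Eventually.of_forall fun m => ?_) ?_ ?_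
  · rw [Set.uIoc_of_le hst.le]
    exact hd.1.aestronglyMeasurable.smul
      (stronglyMeasurable_comp_gridFloor y s t m).aestronglyMeasurable
  · refine Eventually.of_forall fun u hu => ?_
    rw [Set.uIoc_of_le hst.le] at hu
    rw [norm_smul]
    exact mul_le_mul_of_nonneg_left (hK _ (gridFloor_mem hst hu m)) (norm_nonneg _)
  · exact hd.norm.mul_const K
  · refine Eventually.of_forall fun u hu => ?_
    rw [Set.uIoc_of_le hst.le] at hu
    exact (tendsto_comp_gridFloor hst hl hu).const_smul (d u)

end StepFunctions

/-! ### The Euler scheme of the state equation -/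

/-- A discrete Gronwall inequality. -/
lemma discrete_gronwall {x q η : ℕ → ℝ} (h0 : x 0 ≤ 0) (hq : ∀ i, 0 ≤ q i) (hη : ∀ i, 0 ≤ η i)
    {k : ℕ} (h : ∀ i < k, x (i + 1) ≤ (1 + q i) * x i + η i) :
    x k ≤ (∏ i ∈ Finset.range k, (1 + q i)) * ∑ i ∈ Finset.range k, η i := by
  induction k with
  | zero => simpa using h0
  | succ k ih =>
    have h1 := ih fun i hi => h i (by omega)
    have h2 := h k (by omega)
    have hP : 1 ≤ ∏ i ∈ Finset.range (k + 1), (1 + q i) :=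
      Finset.one_le_prod fun i _ => by linarith [hq i]
    rw [Finset.sum_range_succ, mul_add]
    have h3 := mul_le_mul_of_nonneg_left h1 (by linarith [hq k] : 0 ≤ 1 + q k)
    have h4 : η k ≤ (∏ i ∈ Finset.range (k + 1), (1 + q i)) * η k := by
      nlinarith [hη k]
    rw [Finset.prod_range_succ] at h4 ⊢
    nlinarith

section Euler

variable {E : Type*} [NormedAddCommGroup E] [NormedSpace ℝ E]

/-- The Euler scheme of `dy = B y dt + e (α + a y) d[X,X]` with step `δ` and increments `D` of the
driving process. -/
noncomputable def euler (B : E →L[ℝ] E) (al : E →L[ℝ] ℝ) (e : E) (α δ : ℝ) (D : ℕ → ℝ) (v : E) :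
    ℕ → E
  | 0 => v
  | i + 1 => euler B al e α δ D v i + δ • B (euler B al e α δ D v i)
      + (D i ^ 2 * (α + al (euler B al e α δ D v i))) • e

variable {B : E →L[ℝ] E} {al : E →L[ℝ] ℝ} {e : E} {α : ℝ}

/-- Adding 1 to the norm absorbs the constant α, since |α + a y| is at most (|α| + ‖a‖)(‖y‖ + 1).
Growth then becomes purely multiplicative and can be iterated. -/
lemma norm_euler_add_one_le {δ : ℝ} (hδ : 0 ≤ δ) (D : ℕ → ℝ) (v : E) (k : ℕ) :
    ‖euler B al e α δ D v k‖ + 1 ≤ (‖v‖ + 1) *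
      (Real.exp (‖B‖ * (k * δ)) *
        ∏ i ∈ Finset.range k, (1 + (|α| + ‖al‖) * ‖e‖ * D i ^ 2)) := by
  induction k with
  | zero => simp [euler]
  | succ k ih =>
    set y := euler B al e α δ D v k
    set κ := (|α| + ‖al‖) * ‖e‖
    have hκ : 0 ≤ κ := by positivity
    have h1 : ‖euler B al e α δ D v (k + 1)‖ ≤ ‖y‖ + δ * (‖B‖ * ‖y‖)
        + D k ^ 2 * (|α| + ‖al‖ * ‖y‖) * ‖e‖ := by
      refine (norm_add₃_le).trans ?_
      gcongr
      · rw [norm_smul, Real.norm_of_nonneg hδ]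
        gcongr
        exact B.le_opNorm y
      · rw [norm_smul, norm_mul, Real.norm_of_nonneg (sq_nonneg _)]
        gcongr
        exact (norm_add_le _ _).trans (add_le_add le_rfl (al.le_opNorm y))
    have h2 : ‖euler B al e α δ D v (k + 1)‖ + 1
        ≤ (‖y‖ + 1) * ((1 + ‖B‖ * δ) * (1 + κ * D k ^ 2)) := by
      refine (add_le_add_left h1 1).trans ?_
      have := norm_nonneg y
      have := norm_nonneg B
      have h3 : D k ^ 2 * (|α| + ‖al‖ * ‖y‖) * ‖e‖ ≤ (‖y‖ + 1) * (κ * D k ^ 2) := by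
        have : 0 ≤ D k ^ 2 * ‖e‖ * (|α| * ‖y‖ + ‖al‖) := by positivity
        simp only [κ]; nlinarith
      have h4 : 0 ≤ (‖y‖ + 1) * (‖B‖ * δ * (κ * D k ^ 2)) := by positivity
      have h5 : 0 ≤ δ * ‖B‖ := by positivity
      nlinarith
    refine h2.trans ?_
    have h6 : 1 + ‖B‖ * δ ≤ Real.exp (‖B‖ * δ) := by
      rw [add_comm]; exact Real.add_one_le_exp _
    have h7 : 0 ≤ 1 + κ * D k ^ 2 := by positivity
    calc (‖y‖ + 1) * ((1 + ‖B‖ * δ) * (1 + κ * D k ^ 2))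
        ≤ ((‖v‖ + 1) * (Real.exp (‖B‖ * (k * δ)) *
          ∏ i ∈ Finset.range k, (1 + κ * D i ^ 2))) *
          (Real.exp (‖B‖ * δ) * (1 + κ * D k ^ 2)) := by gcongr
      _ = _ := by
        rw [Finset.prod_range_succ]
        have : Real.exp (‖B‖ * (((k + 1 : ℕ) : ℝ) * δ))
            = Real.exp (‖B‖ * (k * δ)) * Real.exp (‖B‖ * δ) := by
          rw [← Real.exp_add]; congr 1; push_cast; ring
        rw [this]; ring

/-- One step is affine in the current value. This is the discrete form of Y_t = J_{s,t} Y_s +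
K_{s,t}: the second summand does not see the starting value. -/
lemma euler_eq_add (δ : ℝ) (D : ℕ → ℝ) (v : E) (k : ℕ) :
    euler B al e α δ D v k = euler B al e 0 δ D v k + euler B al e α δ D 0 k := by
  induction k with
  | zero => simp [euler]
  | succ k ih =>
    simp only [euler]
    rw [ih]
    simp only [map_add]
    module

lemma measurable_euler [MeasurableSpace E] [BorelSpace E] [SecondCountableTopology E]
    {Ω : Type*} {mΩ : MeasurableSpace Ω} {δ : ℝ} {D : ℕ → Ω → ℝ} {v : Ω → E}
    (hv : Measurable v) {k : ℕ} (hD : ∀ i < k, Measurable (D i)) :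
    Measurable fun ω => euler B al e α δ (fun i => D i ω) (v ω) k := by
  induction k with
  | zero => simpa [euler] using hv
  | succ k ih =>
    have h := ih fun i hi => hD i (by omega)
    simp only [euler]
    exact (h.add ((B.measurable.comp h).const_smul δ)).add
      ((((hD k (by omega)).pow_const 2).mul ((al.measurable.comp h).const_add α)).smul_const e)

/-- The path `y` with left limits `yl` solves the state equation on `[s, t]`, for the jump times of
the counting path `c` and the jump sizes `z`. -/
structure IsSolution (B : E →L[ℝ] E) (al : E →L[ℝ] ℝ) (e : E) (α : ℝ) (c : ℝ → ℕ) (z : ℕ → ℝ)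
    (s t : ℝ) (y yl : ℝ → E) : Prop where
  left_lim : ∀ u ∈ Set.Ioc s t, Tendsto y (𝓝[<] u) (𝓝 (yl u))
  bdd : ∃ K, ∀ u ∈ Set.Icc s t, ‖y u‖ ≤ K
  eq : ∀ u ∈ Set.Icc s t, y u = y s + (∫ r in s..u, B (yl r))
    + (∑ n ∈ Finset.Ico (c s) (c u), z n ^ 2 * (α + al (yl (arr c n)))) • e

lemma IsSolution.mono {c : ℝ → ℕ} {z : ℕ → ℝ} {s t r t' : ℝ} {y yl : ℝ → E}
    (hc : IsCountingPath c) (h : IsSolution B al e α c z s t y yl) (hs : 0 ≤ s) (hr : s ≤ r)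
    (hrt : r ≤ t') (ht : t' ≤ t) : IsSolution B al e α c z r t' y yl := by
  obtain ⟨K, hK⟩ := h.bdd
  refine ⟨fun u hu => h.left_lim u ⟨hr.trans_lt hu.1, hu.2.trans ht⟩,
    ⟨K, fun u hu => hK u ⟨hr.trans hu.1, hu.2.trans ht⟩⟩, fun u hu => ?_⟩
  have hsu : s ≤ u := hr.trans hu.1
  have hi : IntervalIntegrable yl volume s t :=
    intervalIntegrable_leftLim (hr.trans (hrt.trans ht)) h.left_lim hK
  have hB : IntervalIntegrable (fun r => B (yl r)) volume s t :=
    ⟨B.integrable_comp hi.1, B.integrable_comp hi.2⟩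
  rw [h.eq u ⟨hsu, hu.2.trans ht⟩, h.eq r ⟨hr, hrt.trans ht⟩,
    ← intervalIntegral.integral_add_adjacent_intervals (b := r) (a := s) (c := u),
    ← Finset.sum_Ico_consecutive _ (hc.mono s r hs hr) (hc.mono r u (hs.trans hr) hu.1), add_smul]
  · abel
  · refine hB.mono_set ?_
    rw [Set.uIcc_of_le hr, Set.uIcc_of_le (hr.trans (hrt.trans ht))]
    exact Set.Icc_subset_Icc le_rfl (hrt.trans ht)
  · refine hB.mono_set ?_
    rw [Set.uIcc_of_le hu.1, Set.uIcc_of_le (hr.trans (hrt.trans ht))]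
    exact Set.Icc_subset_Icc hr (hu.2.trans ht)

/-- The Euler scheme on `grid s t m`, driven by the path `X`, after all its steps. -/
noncomputable def eulerEnd (B : E →L[ℝ] E) (al : E →L[ℝ] ℝ) (e : E) (α : ℝ) (s t : ℝ) (X : ℝ → ℝ)
    (v : E) (m : ℕ) : E :=
  euler B al e α (mesh s t m) (fun i => X (grid s t m (i + 1)) - X (grid s t m i)) v (m + 1)

variable {c : ℝ → ℕ} {z : ℕ → ℝ} {X : ℝ → ℝ}

lemma IsCountingPath.sub_grid (hc : IsCountingPath c)
    (hX : ∀ u, 0 ≤ u → X u = ∑ n ∈ Finset.range (c u), z n) {s t : ℝ} (hs : 0 ≤ s) (hst : s ≤ t)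
    (m i : ℕ) : X (grid s t m (i + 1)) - X (grid s t m i)
      = ∑ n ∈ Finset.Ico (c (grid s t m i)) (c (grid s t m (i + 1))), z n := by
  rw [hX _ (hs.trans (le_grid hst _ _)), hX _ (hs.trans (le_grid hst _ _)),
    sum_range_sub_sum_range _ (hc.monotone_grid hs hst m i.le_succ)]

/-- With at most one jump per grid interval, an interval contributes `f` of its only jump, or `f 0 =
1`. -/
lemma IsCountingPath.eventually_prod_grid (hc : IsCountingPath c)
    (hX : ∀ u, 0 ≤ u → X u = ∑ n ∈ Finset.range (c u), z n) {s t : ℝ} (hs : 0 ≤ s) (hst : s < t)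
    (f : ℝ → ℝ) (hf : f 0 = 1) :
    ∀ᶠ m in atTop, ∏ i ∈ Finset.range (m + 1), f (X (grid s t m (i + 1)) - X (grid s t m i))
      = ∏ n ∈ Finset.Ico (c s) (c t), f (z n) := by
  filter_upwards [hc.eventually_le_one_jump hs hst] with m hm
  have h := prod_range_prod_Ico (fun n => f (z n)) (hc.monotone_grid hs hst.le m) (m + 1)
  rw [grid_zero, grid_last] at h
  rw [← h]
  refine Finset.prod_congr rfl fun i hi => ?_
  rw [Finset.mem_range] at hi
  rw [hc.sub_grid hX hs hst.le, map_sum_Ico_of_le_one f hf z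
    (hc.monotone_grid hs hst.le m i.le_succ) (hm i hi)]

variable [CompleteSpace E]

/-- The local error of a step comes from replacing the left limits of y by its value at the left
grid point. The sum of these errors tends to 0 by dominated convergence. The Gronwall factor stays
bounded, because the steps add up to t − s and the squared increments of X add up to the squared
jumps once no grid interval holds two of them. -/
lemma IsSolution.tendsto_eulerEnd (hc : IsCountingPath c)
    (hX : ∀ u, 0 ≤ u → X u = ∑ n ∈ Finset.range (c u), z n) {s t : ℝ} (hs : 0 ≤ s) (hst : s < t)
    {y yl : ℝ → E} (h : IsSolution B al e α c z s t y yl) :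
    Tendsto (eulerEnd B al e α s t X (y s)) atTop (𝓝 (y t)) := by
  obtain ⟨K, hK⟩ := h.bdd
  have ht : 0 ≤ t := hs.trans hst.le
  have hyl : IntervalIntegrable yl volume s t := intervalIntegrable_leftLim hst.le h.left_lim hK
  set b := ‖B‖
  set κ := ‖al‖ * ‖e‖
  have hκ : 0 ≤ κ := by positivity
  -- the total local error
  set tot : ℕ → ℝ := fun m => (∫ u in s..t, b * ‖yl u - y (gridFloor s t m u)‖)
    + ∑ n ∈ Finset.Ico (c s) (c t),
      z n ^ 2 * (κ * ‖yl (arr c n) - y (gridFloor s t m (arr c n))‖) with htot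
  have htot0 : Tendsto tot atTop (𝓝 0) := by
    have h1 : Tendsto (fun m => ∫ u in s..t, b * ‖yl u - y (gridFloor s t m u)‖) atTop
        (𝓝 (∫ u in s..t, (0 : ℝ))) := by
      refine intervalIntegral.tendsto_integral_filter_of_dominated_convergence
        (fun _ => b * (K + K)) (Eventually.of_forall fun m => ?_)
        (Eventually.of_forall fun m => ?_) (by simp) ?_
      · exact (((aestronglyMeasurable_leftLim hst.le h.left_lim).sub
          (stronglyMeasurable_comp_gridFloor y s t m).aestronglyMeasurable).norm).const_mul b
      · refine Eventually.of_forall fun u hu => ?_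
        rw [Set.uIoc_of_le hst.le] at hu
        rw [Real.norm_of_nonneg (by positivity)]
        gcongr
        exact (norm_sub_le _ _).trans (add_le_add (norm_leftLim_le hst h.left_lim hK hu)
          (hK _ (gridFloor_mem hst hu m)))
      · refine Eventually.of_forall fun u hu => ?_
        rw [Set.uIoc_of_le hst.le] at hu
        simpa using ((tendsto_const_nhds (x := yl u)).sub
          (tendsto_comp_gridFloor hst h.left_lim hu)).norm.const_mul b
    have h2 : Tendsto (fun m => ∑ n ∈ Finset.Ico (c s) (c t),
        z n ^ 2 * (κ * ‖yl (arr c n) - y (gridFloor s t m (arr c n))‖)) atTop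
        (𝓝 (∑ n ∈ Finset.Ico (c s) (c t), (0 : ℝ))) := by
      refine tendsto_finsetSum _ fun n hn => ?_
      have := ((tendsto_const_nhds (x := yl (arr c n))).sub (tendsto_comp_gridFloor hst h.left_lim
        (hc.mem_Ioc_of_mem_Ico hs ht hn))).norm.const_mul κ |>.const_mul (z n ^ 2)
      simpa using this
    have h3 := h1.add h2
    simp only [intervalIntegral.integral_zero, Finset.sum_const_zero, add_zero] at h3
    exact h3
  have hbound : ∀ᶠ m in atTop, ‖y t - eulerEnd B al e α s t X (y s) m‖
      ≤ Real.exp (b * (t - s) + κ * ∑ n ∈ Finset.Ico (c s) (c t), z n ^ 2) * tot m := by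
    filter_upwards [hc.eventually_le_one_jump hs hst] with m hm
    set g := grid s t m
    set D : ℕ → ℝ := fun i => X (g (i + 1)) - X (g i)
    set eu := euler B al e α (mesh s t m) D (y s)
    set η : ℕ → ℝ := fun i => (∫ u in (g i)..(g (i + 1)), b * ‖yl u - y (g i)‖)
      + ∑ n ∈ Finset.Ico (c (g i)) (c (g (i + 1))), z n ^ 2 * (κ * ‖yl (arr c n) - y (g i)‖)
    have hgi : ∀ i, s ≤ g i := fun i => le_grid hst.le m i
    have hgm : ∀ i, g i ≤ g (i + 1) := fun i => grid_monotone hst.le m i.le_succ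
    have hD : ∀ i < m + 1, D i ^ 2 = ∑ n ∈ Finset.Ico (c (g i)) (c (g (i + 1))), z n ^ 2 := by
      intro i hi
      rw [← sq_sum_Ico_of_le_one z (hc.monotone_grid hs hst.le m i.le_succ) (hm i hi),
        ← hc.sub_grid hX hs hst.le]
    have hcell : ∀ i < m + 1, IntervalIntegrable yl volume (g i) (g (i + 1)) := by
      intro i hi
      refine hyl.mono_set ?_
      rw [Set.uIcc_of_le (hgm i), Set.uIcc_of_le hst.le]
      exact Set.Icc_subset_Icc (hgi i) (grid_le hst.le hi)
    have hη : ∀ i, 0 ≤ η i := fun i => add_nonneg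
      (intervalIntegral.integral_nonneg (hgm i) fun u _ => by positivity)
      (Finset.sum_nonneg fun n _ => by positivity)
    have hηsum : ∑ i ∈ Finset.range (m + 1), η i = tot m := by
      rw [Finset.sum_add_distrib,
        sum_grid_integral hst (fun v u => b * ‖yl u - y v‖) m
          (fun i hi => (((hcell i hi).sub intervalIntegrable_const).norm).const_mul b),
        hc.sum_grid hs hst (fun v n => z n ^ 2 * (κ * ‖yl (arr c n) - y v‖))]
    have hstep : ∀ i < m + 1, ‖y (g (i + 1)) - eu (i + 1)‖
        ≤ (1 + (b * mesh s t m + κ * D i ^ 2)) * ‖y (g i) - eu i‖ + η i := by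
      intro i hi
      have hgt : g (i + 1) ≤ t := grid_le hst.le hi
      have heq := (h.mono hc hs (hgi i) (hgm i) hgt).eq (g (i + 1)) ⟨hgm i, le_rfl⟩
      have hBint : (∫ r in (g i)..(g (i + 1)), B (yl r))
          = mesh s t m • B (y (g i)) + ∫ r in (g i)..(g (i + 1)), B (yl r - y (g i)) := by
        have h1 : IntervalIntegrable (fun r => B (yl r)) volume (g i) (g (i + 1)) :=
          ⟨B.integrable_comp (hcell i hi).1, B.integrable_comp (hcell i hi).2⟩
        simp only [map_sub]
        rw [intervalIntegral.integral_sub h1 intervalIntegrable_const,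
          intervalIntegral.integral_const]
        have : g (i + 1) - g i = mesh s t m := by simp only [g, grid_succ]; ring
        rw [this]; abel
      have hsum : (∑ n ∈ Finset.Ico (c (g i)) (c (g (i + 1))), z n ^ 2 * (α + al (yl (arr c n))))
          = D i ^ 2 * (α + al (y (g i)))
            + ∑ n ∈ Finset.Ico (c (g i)) (c (g (i + 1))),
              z n ^ 2 * al (yl (arr c n) - y (g i)) := by
        rw [hD i hi, Finset.sum_mul, ← Finset.sum_add_distrib]
        refine Finset.sum_congr rfl fun n _ => ?_
        rw [map_sub]; ring
      -- The first three terms are the linear recursion applied to the current error; the last two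
      -- are the local error bounded by `η i`.
      have hdiff : y (g (i + 1)) - eu (i + 1) = (y (g i) - eu i)
          + mesh s t m • B (y (g i) - eu i) + (D i ^ 2 * al (y (g i) - eu i)) • e
          + (∫ r in (g i)..(g (i + 1)), B (yl r - y (g i)))
          + (∑ n ∈ Finset.Ico (c (g i)) (c (g (i + 1))),
              z n ^ 2 * al (yl (arr c n) - y (g i))) • e := by
        rw [heq, hBint, hsum]
        simp only [eu, euler, map_sub]
        module
      rw [hdiff]
      have hm0 := mesh_nonneg hst.le m
      have n1 : ‖mesh s t m • B (y (g i) - eu i)‖ ≤ b * mesh s t m * ‖y (g i) - eu i‖ := by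
        rw [norm_smul, Real.norm_of_nonneg hm0, mul_comm b, mul_assoc]
        exact mul_le_mul_of_nonneg_left (B.le_opNorm _) hm0
      have n2 : ‖(D i ^ 2 * al (y (g i) - eu i)) • e‖ ≤ κ * D i ^ 2 * ‖y (g i) - eu i‖ := by
        rw [norm_smul, norm_mul, Real.norm_of_nonneg (sq_nonneg _)]
        have := mul_le_mul_of_nonneg_left (al.le_opNorm (y (g i) - eu i))
          (mul_nonneg (sq_nonneg (D i)) (norm_nonneg e))
        simp only [κ]; linarith
      have n3 : ‖∫ r in (g i)..(g (i + 1)), B (yl r - y (g i))‖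
          ≤ ∫ u in (g i)..(g (i + 1)), b * ‖yl u - y (g i)‖ :=
        intervalIntegral.norm_integral_le_of_norm_le (hgm i)
          (Eventually.of_forall fun r _ => B.le_opNorm _)
          (((hcell i hi).sub intervalIntegrable_const).norm.const_mul b)
      have n4 : ‖(∑ n ∈ Finset.Ico (c (g i)) (c (g (i + 1))),
              z n ^ 2 * al (yl (arr c n) - y (g i))) • e‖
          ≤ ∑ n ∈ Finset.Ico (c (g i)) (c (g (i + 1))),
              z n ^ 2 * (κ * ‖yl (arr c n) - y (g i)‖) := by
        rw [Finset.sum_smul]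
        refine (norm_sum_le _ _).trans (Finset.sum_le_sum fun n _ => ?_)
        rw [norm_smul, norm_mul, Real.norm_of_nonneg (sq_nonneg _)]
        have := mul_le_mul_of_nonneg_left (al.le_opNorm (yl (arr c n) - y (g i)))
          (mul_nonneg (sq_nonneg (z n)) (norm_nonneg e))
        simp only [κ]; linarith
      have n5 := norm_add_le ((y (g i) - eu i) + mesh s t m • B (y (g i) - eu i)
        + (D i ^ 2 * al (y (g i) - eu i)) • e + ∫ r in (g i)..(g (i + 1)), B (yl r - y (g i)))
        ((∑ n ∈ Finset.Ico (c (g i)) (c (g (i + 1))), z n ^ 2 * al (yl (arr c n) - y (g i))) • e)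
      have n6 := norm_add_le ((y (g i) - eu i) + mesh s t m • B (y (g i) - eu i)
        + (D i ^ 2 * al (y (g i) - eu i)) • e) (∫ r in (g i)..(g (i + 1)), B (yl r - y (g i)))
      have n7 := norm_add₃_le (a := y (g i) - eu i) (b := mesh s t m • B (y (g i) - eu i))
        (c := (D i ^ 2 * al (y (g i) - eu i)) • e)
      simp only [η]
      linarith
    have hgr := discrete_gronwall (x := fun i => ‖y (g i) - eu i‖)
      (q := fun i => b * mesh s t m + κ * D i ^ 2) (η := η) (k := m + 1)
      (by simp [eu, euler, g, grid_zero])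
      (fun i => add_nonneg (mul_nonneg (norm_nonneg _) (mesh_nonneg hst.le m)) (by positivity))
      hη hstep
    have hlast : g (m + 1) = t := grid_last s t m
    simp only [hlast, hηsum] at hgr
    refine hgr.trans (mul_le_mul_of_nonneg_right ?_
      (hηsum ▸ Finset.sum_nonneg fun i _ => hη i))
    -- Passing to exponentials turns the Gronwall product into a quantity that no longer depends on
    -- m.
    have hprod : ∏ i ∈ Finset.range (m + 1), (1 + (b * mesh s t m + κ * D i ^ 2))
        ≤ ∏ i ∈ Finset.range (m + 1), Real.exp (b * mesh s t m + κ * D i ^ 2) := by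
      refine Finset.prod_le_prod (fun i _ => ?_) fun i _ => ?_
      · have := mul_nonneg (norm_nonneg B) (mesh_nonneg hst.le m)
        positivity
      · rw [add_comm]; exact Real.add_one_le_exp _
    refine hprod.trans (le_of_eq ?_)
    rw [← Real.exp_sum, Finset.sum_add_distrib, Finset.sum_const,
      Finset.card_range, nsmul_eq_mul, ← mesh_mul s t m]
    have : ∑ i ∈ Finset.range (m + 1), D i ^ 2 = ∑ n ∈ Finset.Ico (c s) (c t), z n ^ 2 := by
      rw [Finset.sum_congr rfl fun i hi => hD i (Finset.mem_range.1 hi),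
        hc.sum_grid hs hst fun _ n => z n ^ 2]
    rw [← Finset.mul_sum, this]
    congr 1; ring
  rw [tendsto_iff_norm_sub_tendsto_zero]
  have h0 := htot0.const_mul
    (Real.exp (b * (t - s) + κ * ∑ n ∈ Finset.Ico (c s) (c t), z n ^ 2))
  rw [mul_zero] at h0
  refine squeeze_zero' (Eventually.of_forall fun m => norm_nonneg _) ?_ h0
  filter_upwards [hbound] with m hm
  rwa [norm_sub_rev]

/-- The multiplicative bound for the Euler scheme survives the limit; its product over grid
intervals becomes a product over jumps. -/
lemma IsSolution.norm_add_one_le (hc : IsCountingPath c)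
    (hX : ∀ u, 0 ≤ u → X u = ∑ n ∈ Finset.range (c u), z n) {s t : ℝ} (hs : 0 ≤ s) (hst : s ≤ t)
    {y yl : ℝ → E} (h : IsSolution B al e α c z s t y yl) :
    ‖y t‖ + 1 ≤ (‖y s‖ + 1) * (Real.exp (‖B‖ * (t - s)) *
      ∏ n ∈ Finset.Ico (c s) (c t), (1 + (|α| + ‖al‖) * ‖e‖ * z n ^ 2)) := by
  rcases hst.eq_or_lt with rfl | hst
  · simp
  refine le_of_tendsto ((h.tendsto_eulerEnd hc hX hs hst).norm.add_const 1) ?_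
  filter_upwards [hc.eventually_prod_grid hX hs hst
    (fun x => 1 + (|α| + ‖al‖) * ‖e‖ * x ^ 2) (by simp)] with m hm
  have := norm_euler_add_one_le (B := B) (al := al) (e := e) (α := α) (mesh_nonneg hst.le m)
    (fun i => X (grid s t m (i + 1)) - X (grid s t m i)) (y s) (m + 1)
  rwa [mesh_mul, hm] at this

end Euler

/-! ### Independence of joins of σ-algebras -/

section Indep

variable {Ω : Type*} {mΩ : MeasurableSpace Ω} {P : Measure Ω} [IsProbabilityMeasure P]

lemma generateFrom_inter_eq_sup (m₁ m₂ : MeasurableSpace Ω) :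
    m₁ ⊔ m₂ = MeasurableSpace.generateFrom
      {s | ∃ a b, MeasurableSet[m₁] a ∧ MeasurableSet[m₂] b ∧ s = a ∩ b} := by
  refine le_antisymm (sup_le ?_ ?_) ?_
  · intro a ha
    exact MeasurableSpace.measurableSet_generateFrom
      ⟨a, Set.univ, ha, @MeasurableSet.univ _ m₂, (Set.inter_univ a).symm⟩
  · intro b hb
    exact MeasurableSpace.measurableSet_generateFrom
      ⟨Set.univ, b, @MeasurableSet.univ _ m₁, hb, (Set.univ_inter b).symm⟩
  · refine MeasurableSpace.generateFrom_le ?_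
    rintro s ⟨a, b, ha, hb, rfl⟩
    exact @MeasurableSet.inter _ (m₁ ⊔ m₂) _ _ ((le_sup_left : m₁ ≤ m₁ ⊔ m₂) a ha)
      ((le_sup_right : m₂ ≤ m₁ ⊔ m₂) b hb)

/-- On the π-system of sets b ∩ c one has P(a ∩ b ∩ c) = P(a ∩ b) P(c) = P(a) P(b) P(c). This is the
rule by which independence is chained over successive time intervals. -/
lemma indep_sup_right_of_indep {A B C : MeasurableSpace Ω} (hA : A ≤ mΩ) (hB : B ≤ mΩ)
    (hC : C ≤ mΩ) (h₁ : Indep A B P) (h₂ : Indep (A ⊔ B) C P) : Indep A (B ⊔ C) P := by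
  refine IndepSets.indep hA (sup_le hB hC) (p1 := {s | MeasurableSet[A] s})
    (@MeasurableSpace.isPiSystem_measurableSet _ A) ?_
    (@MeasurableSpace.generateFrom_measurableSet _ A).symm (generateFrom_inter_eq_sup B C) ?_
  · rintro _ ⟨a, b, ha, hb, rfl⟩ _ ⟨a', b', ha', hb', rfl⟩ _
    exact ⟨a ∩ a', b ∩ b', @MeasurableSet.inter _ B _ _ ha ha', @MeasurableSet.inter _ C _ _ hb hb',
      Set.inter_inter_inter_comm _ _ _ _⟩
  · rw [IndepSets_iff]
    rintro a _ ha ⟨b, c, hb, hc, rfl⟩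
    rw [Indep_iff] at h₁ h₂
    have hbc : P (b ∩ c) = P b * P c := h₂ b c ((le_sup_right : B ≤ A ⊔ B) b hb) hc
    rw [← Set.inter_assoc, h₂ (a ∩ b) c (@MeasurableSet.inter _ (A ⊔ B) _ _
      ((le_sup_left : A ≤ A ⊔ B) a ha) ((le_sup_right : B ≤ A ⊔ B) b hb)) hc, h₁ a b ha hb, hbc,
      mul_assoc]

/-- To be read with A, A' the past and future of the counts and B, B' the past and future of the
marks. -/
lemma indep_sup_sup {A A' B B' : MeasurableSpace Ω} (hA : A ≤ mΩ) (hA' : A' ≤ mΩ) (hB : B ≤ mΩ)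
    (hB' : B' ≤ mΩ) (h₁ : Indep A A' P) (h₂ : Indep B B' P) (h : Indep (A ⊔ A') (B ⊔ B') P) :
    Indep (A ⊔ B) (A' ⊔ B') P := by
  have e1 : Indep B' (B ⊔ (A ⊔ A')) P := indep_sup_right_of_indep hB' hB (sup_le hA hA') h₂.symm
    (by rw [sup_comm]; exact h.symm)
  have e2 : Indep A' (A ⊔ B) P := indep_sup_right_of_indep hA' hA hB h₁.symm
    (by rw [sup_comm]; exact indep_of_indep_of_le_right h le_sup_left)
  refine indep_sup_right_of_indep (sup_le hA hB) hA' hB' e2.symm ?_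
  have : A ⊔ B ⊔ A' = B ⊔ (A ⊔ A') := by rw [sup_right_comm, sup_comm]
  rw [this]
  exact e1.symm

lemma measure_eq_tsum_inter_fiber (P : Measure Ω) {B : Set Ω} (hB : MeasurableSet B) {f : Ω → ℕ}
    (hf : Measurable f) : P B = ∑' n, P (B ∩ f ⁻¹' {n}) := by
  rw [← measure_iUnion]
  · congr 1; ext ω; simp
  · intro i j hij
    refine Set.disjoint_left.2 fun ω h1 h2 => hij ?_
    exact (h1.2 : f ω = i).symm.trans h2.2
  · exact fun n => hB.inter (hf (measurableSet_singleton n))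

lemma comap_le_of_measurable {β : Type*} {mβ : MeasurableSpace β} {m : MeasurableSpace Ω}
    {f : Ω → β} (h : Measurable[m] f) : MeasurableSpace.comap f mβ ≤ m :=
  measurable_iff_comap_le.1 h

/-- A process with independent increments: its past is independent of a later increment. -/
lemma HasIndepIncrements.indep_past {X : ℝ≥0 → Ω → ℝ} (hX : HasIndepIncrements X P)
    (hm : ∀ t, Measurable (X t)) (h0 : ∀ ω, X 0 ω = 0) {s t : ℝ≥0} (hst : s ≤ t) :
    Indep (⨆ r : Set.Iic s, MeasurableSpace.comap (X r) inferInstance)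
      (MeasurableSpace.comap (fun ω => X t ω - X s ω) inferInstance) P := by
  classical
  rw [iSup_eq_iSup_finset]
  refine indep_iSup_of_directed_le (fun I => ?_)
    (fun I => iSup₂_le fun r _ => (hm r).comap_le) ((hm t).sub (hm s)).comap_le
    (Monotone.directed_le fun I I' h => biSup_mono fun r hr => (show I ⊆ I' from h) hr)
  -- The point 0 makes every value a sum of increments, as X starts at 0; the point s makes the last
  -- increment start exactly at s.
  set J : Finset ℝ≥0 := insert 0 (insert s (I.image (fun r : Set.Iic s => (r : ℝ≥0)))) with hJ
  have hJs : ∀ r ∈ J, r ≤ s := by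
    intro r hr
    simp only [hJ, Finset.mem_insert, Finset.mem_image] at hr
    rcases hr with rfl | rfl | ⟨x, -, rfl⟩
    · exact zero_le
    · exact le_rfl
    · exact x.2
  set k := J.card
  have hk : 0 < k := Finset.card_pos.2 ⟨0, by simp [hJ]⟩
  -- The points of `J` in increasing order, then t forever: the increments below index k − 1 carry
  -- the past, and the one with index k − 1 is the increment from s to t.
  set τ : ℕ → ℝ≥0 := fun i => if h : i < k then J.orderEmbOfFin rfl ⟨i, h⟩ else t
  have hτ : Monotone τ := by
    refine monotone_nat_of_le_succ fun i => ?_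
    by_cases h : i + 1 < k
    · simp only [τ, h, show i < k by omega, dif_pos]
      exact (J.orderEmbOfFin rfl).monotone (by simp)
    · by_cases h' : i < k
      · simp only [τ, h, h', dif_pos, dif_neg, not_false_eq_true]
        exact (hJs _ (J.orderEmbOfFin_mem rfl _)).trans hst
      · simp [τ, h, h']
  have hmem : ∀ r ∈ J, ∃ i < k, τ i = r := by
    intro r hr
    have : r ∈ Set.range (J.orderEmbOfFin (k := k) rfl) := by
      rw [Finset.range_orderEmbOfFin]; exact hr
    obtain ⟨i, hi⟩ := this
    exact ⟨i, i.2, by simp [τ, hi]⟩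
  have hτk : τ k = t := by simp [τ]
  have hτle : ∀ i < k, τ i ≤ s := fun i hi => by
    simp only [τ, hi, dif_pos]; exact hJs _ (J.orderEmbOfFin_mem rfl _)
  have hτ0 : τ 0 = 0 := by
    obtain ⟨i, _, hi⟩ := hmem 0 (by simp [hJ])
    exact le_antisymm (hi ▸ hτ (Nat.zero_le i)) (zero_le)
  have hτs : τ (k - 1) = s := by
    obtain ⟨i, hik, hi⟩ := hmem s (by simp [hJ])
    exact le_antisymm (hτle _ (by omega)) (hi ▸ hτ (by omega))
  have hind := hX.nat hτ
  rw [iIndepFun_iff_iIndep] at hind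
  have hinc : ∀ i, Measurable fun ω => X (τ (i + 1)) ω - X (τ i) ω := fun i => (hm _).sub (hm _)
  have h := indep_iSup_of_disjoint (fun i => (hinc i).comap_le) hind
    (S := {i | i < k - 1}) (T := {k - 1}) (by simp)
  refine indep_of_indep_of_le h (iSup₂_le fun r hr => ?_) ?_
  · obtain ⟨i, hik, hi⟩ := hmem r (by
      simp only [hJ, Finset.mem_insert, Finset.mem_image]; exact Or.inr (Or.inr ⟨r, hr, rfl⟩))
    refine comap_le_of_measurable ?_
    have : X r = fun ω => ∑ x ∈ Finset.range i, (X (τ (x + 1)) ω - X (τ x) ω) := by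
      funext ω
      rw [Finset.sum_range_sub (fun x => X (τ x) ω), hτ0, hi, h0, sub_zero]
    rw [this]
    refine Finset.measurable_sum _ fun x hx => ?_
    rw [Finset.mem_range] at hx
    exact measurable_iff_comap_le.2 (le_iSup₂_of_le x (by show x < k - 1; omega) le_rfl)
  · have : (fun ω => X t ω - X s ω) = fun ω => X (τ (k - 1 + 1)) ω - X (τ (k - 1)) ω := by
      rw [Nat.sub_add_cancel hk, hτk, hτs]
    rw [this]
    exact le_iSup₂_of_le (k - 1) rfl le_rfl

end Indep

/-! ### Moments of the Poisson distribution -/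

/-- Shifting the index by one cancels the factor n against the factorial and leaves r times the
total mass. -/
lemma hasSum_poisson_id (r : ℝ≥0) :
    HasSum (fun n : ℕ => Real.exp (-r) * r ^ n / n.factorial * (n : ℝ)) r := by
  rw [← hasSum_nat_add_iff' 1]
  have h := (hasSum_one_poissonMeasure r).mul_left (r : ℝ)
  simp only [Finset.sum_range_one, Nat.cast_zero, mul_zero, sub_zero]
  rw [mul_one] at h
  refine h.congr_fun fun n => ?_
  rw [Nat.factorial_succ, pow_succ]
  have : (n.factorial : ℝ) ≠ 0 := by positivity
  push_cast
  field_simp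

lemma hasSum_poisson_sq (r : ℝ≥0) :
    HasSum (fun n : ℕ => Real.exp (-r) * r ^ n / n.factorial * (n : ℝ) ^ 2) (r + r ^ 2) := by
  rw [← hasSum_nat_add_iff' 1]
  have h := ((hasSum_poisson_id r).add (hasSum_one_poissonMeasure r)).mul_left (r : ℝ)
  have e : (r : ℝ) * (r + 1) = r + r ^ 2 := by ring
  rw [e] at h
  simp only [Finset.sum_range_one, Nat.cast_zero, ne_eq, OfNat.ofNat_ne_zero, not_false_eq_true,
    zero_pow, mul_zero, sub_zero]
  refine h.congr_fun fun n => ?_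
  rw [Nat.factorial_succ, pow_succ]
  have : (n.factorial : ℝ) ≠ 0 := by positivity
  push_cast
  field_simp

lemma integrable_sq_poissonMeasure (r : ℝ≥0) :
    Integrable (fun n : ℕ => (n : ℝ) ^ 2) (poissonMeasure r) := by
  rw [integrable_poissonMeasure_iff]
  simpa using (hasSum_poisson_sq r).summable

lemma integrable_id_poissonMeasure (r : ℝ≥0) :
    Integrable (fun n : ℕ => (n : ℝ)) (poissonMeasure r) := by
  rw [integrable_poissonMeasure_iff]
  simpa using (hasSum_poisson_id r).summable

lemma integral_id_poissonMeasure (r : ℝ≥0) : ∫ n : ℕ, (n : ℝ) ∂poissonMeasure r = r :=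
  (hasSum_integral_poissonMeasure (integrable_id_poissonMeasure r)).unique (hasSum_poisson_id r)

lemma integral_sq_poissonMeasure (r : ℝ≥0) :
    ∫ n : ℕ, (n : ℝ) ^ 2 ∂poissonMeasure r = r + r ^ 2 :=
  (hasSum_integral_poissonMeasure (integrable_sq_poissonMeasure r)).unique (hasSum_poisson_sq r)

lemma lintegral_pow_poissonMeasure_lt_top (r : ℝ≥0) {K : ℝ≥0∞} (hK : K ≠ ∞) :
    ∫⁻ n, K ^ n ∂poissonMeasure r < ∞ := by
  lift K to ℝ≥0 using hK
  have h : Integrable (fun n : ℕ => (K : ℝ) ^ n) (poissonMeasure r) := by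
    rw [integrable_poissonMeasure_iff]
    have := ((Real.summable_pow_div_factorial (r * K : ℝ)).mul_left (Real.exp (-r)))
    refine this.congr fun n => ?_
    rw [Real.norm_of_nonneg (by positivity), mul_pow]; ring
  have h2 := h.2
  rw [hasFiniteIntegral_iff_enorm] at h2
  refine lt_of_le_of_lt (lintegral_mono fun n => ?_) h2
  rw [Real.enorm_eq_ofReal (by positivity), ENNReal.ofReal_pow (by positivity)]
  simp

namespace SimpleSemiLevy

variable {Ω : Type*} [mΩ : MeasurableSpace Ω] {P : Measure Ω} (L : SimpleSemiLevy P)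

lemma isCountingPath (ω : Ω) : IsCountingPath fun t => L.N t ω :=
  ⟨L.poisson.zero ω, L.poisson.mono ω, L.poisson.right_cont ω, L.poisson.unit_jump ω⟩

/-! ### The partition -/

lemma part_nonneg (k : ℕ) : 0 ≤ L.part k := by
  rw [← L.part_zero]; exact L.part_strictMono.monotone (Nat.zero_le k)

lemma part_add_l (k : ℕ) : L.part (k + L.l) = L.part k + L.part L.l := by
  induction k with
  | zero => simp [L.part_zero]
  | succ k ih =>
    have h := L.part_periodic k
    have e : k + 1 + L.l = k + L.l + 1 := by ring
    rw [e]; linarith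

lemma period_pos : 0 < L.part L.l := by
  have := L.part_strictMono L.l_pos
  rwa [L.part_zero] at this

lemma part_mul_l (k : ℕ) : L.part (k * L.l) = k * L.part L.l := by
  induction k with
  | zero => simp [L.part_zero]
  | succ k ih => rw [Nat.succ_mul, L.part_add_l, ih]; push_cast; ring

lemma exists_lt_part (t : ℝ) : ∃ k, t < L.part k := by
  obtain ⟨n, hn⟩ := exists_nat_gt (t / L.part L.l)
  rw [div_lt_iff₀ L.period_pos] at hn
  exact ⟨n * L.l, by rwa [L.part_mul_l]⟩

/-- The number `k` such that `t ∈ A_{k+1}`. -/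
noncomputable def cellIdx (t : ℝ) : ℕ := by
  classical
  exact Nat.find (L.exists_lt_part t) - 1

lemma mem_cellIdx {t : ℝ} (ht : 0 ≤ t) :
    t ∈ Set.Ico (L.part (L.cellIdx t)) (L.part (L.cellIdx t + 1)) := by
  classical
  have hpos : 0 < Nat.find (L.exists_lt_part t) := by
    rw [Nat.find_pos, L.part_zero, not_lt]; exact ht
  have e : L.cellIdx t = Nat.find (L.exists_lt_part t) - 1 := by
    unfold cellIdx; congr
  rw [e, Nat.sub_add_cancel hpos]
  exact ⟨not_lt.1 (Nat.find_min (L.exists_lt_part t) (by omega)),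
    Nat.find_spec (L.exists_lt_part t)⟩

lemma idx_le_of_lt {j k : ℕ} {s t : ℝ} (hs : L.part j ≤ s) (hst : s ≤ t)
    (ht : t < L.part (k + 1)) : j ≤ k :=
  Nat.lt_succ_iff.1 (L.part_strictMono.lt_iff_lt.1 (hs.trans_lt (hst.trans_lt ht)))

lemma idx_unique {j k : ℕ} {t : ℝ} (hj : t ∈ Set.Ico (L.part j) (L.part (j + 1)))
    (hk : t ∈ Set.Ico (L.part k) (L.part (k + 1))) : j = k :=
  le_antisymm (L.idx_le_of_lt hj.1 le_rfl hk.2) (L.idx_le_of_lt hk.1 le_rfl hj.2)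

lemma cellIdx_eq {k : ℕ} {t : ℝ} (hk : t ∈ Set.Ico (L.part k) (L.part (k + 1))) :
    L.cellIdx t = k :=
  L.idx_unique (L.mem_cellIdx ((L.part_nonneg k).trans hk.1)) hk

lemma mem_cells_iff {k : ℕ} {t : ℝ} (hk : t ∈ Set.Ico (L.part k) (L.part (k + 1)))
    (j : Fin L.l) : t ∈ L.cells j ↔ j = L.cellType (k + 1) := by
  have h1 : ∀ i : ℕ, L.cell (i * L.l + (j + 1))
      = Set.Ico (L.part (i * L.l + j)) (L.part (i * L.l + j + 1)) := fun i => rfl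
  simp only [cells, Set.mem_iUnion, h1]
  constructor
  · rintro ⟨i, hi⟩
    have := L.idx_unique hi hk
    ext
    simp only [cellType, Nat.add_sub_cancel, ← this, Nat.mul_add_mod_self_right,
      Nat.mod_eq_of_lt j.2]
  · rintro rfl
    refine ⟨k / L.l, ?_⟩
    have : k / L.l * L.l + k % L.l = k := Nat.div_add_mod' k L.l
    simp only [cellType, Nat.add_sub_cancel, this]
    exact hk

lemma jump_eq {n k : ℕ} {ω : Ω} (h : L.arrival n ω ∈ Set.Ico (L.part k) (L.part (k + 1))) :
    L.jump n ω = L.mark n (L.cellType (k + 1)) ω := by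
  classical
  simp only [jump, L.mem_cells_iff h]
  simp

lemma measurableSet_cells (j : Fin L.l) : MeasurableSet (L.cells j) :=
  MeasurableSet.iUnion fun _ => measurableSet_Ico

/-! ### The intensity -/

lemma rate_intervalIntegrable_zero (k : ℕ) :
    IntervalIntegrable L.rate volume 0 (k * L.part L.l) := by
  induction k with
  | zero => simp
  | succ k ih =>
    have hk : (0 : ℝ) ≤ k * L.part L.l := mul_nonneg (Nat.cast_nonneg k) L.period_pos.le
    have h1 : IntervalIntegrable L.rate volume (L.part L.l) ((k + 1 : ℕ) * L.part L.l) := by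
      have h2 := ih.comp_sub_right (L.part L.l)
      rw [zero_add] at h2
      have e : k * L.part L.l + L.part L.l = (k + 1 : ℕ) * L.part L.l := by push_cast; ring
      rw [e] at h2
      refine h2.congr fun u hu => ?_
      rw [Set.uIoc_of_le (by rw [← e]; linarith)] at hu
      have := L.rate_periodic (u - L.part L.l) (by linarith [hu.1])
      rw [sub_add_cancel] at this
      exact this.symm
    exact L.rate_integrable.trans h1

lemma rate_intervalIntegrable {s t : ℝ} (hs : 0 ≤ s) (ht : 0 ≤ t) :
    IntervalIntegrable L.rate volume s t := by
  obtain ⟨n, hn⟩ := exists_nat_gt (max s t / L.part L.l)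
  rw [div_lt_iff₀ L.period_pos, max_lt_iff] at hn
  refine (L.rate_intervalIntegrable_zero n).mono_set ?_
  rw [Set.uIcc_of_le (hs.trans hn.1.le)]
  exact Set.uIcc_subset_Icc ⟨hs, hn.1.le⟩ ⟨ht, hn.2.le⟩

/-- The mean of the number of jumps in `(s, t]`. -/
noncomputable def Λ (s t : ℝ) : ℝ≥0 := Real.toNNReal (∫ u in s..t, L.rate u)

lemma coe_Λ {s t : ℝ} (hs : 0 ≤ s) (hst : s ≤ t) : (L.Λ s t : ℝ) = ∫ u in s..t, L.rate u :=
  Real.coe_toNNReal _ (intervalIntegral.integral_nonneg hst fun u hu =>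
    L.rate_nonneg u (hs.trans hu.1))

/-! ### σ-algebras of the Poisson process and of the marks -/

lemma measurable_count (L : SimpleSemiLevy P) {s t : ℝ} (hs : 0 ≤ s) (ht : 0 ≤ t) :
    Measurable fun ω => L.N t ω - L.N s ω :=
  (L.poisson.measurable t ht).sub (L.poisson.measurable s hs)

/-- The information in the counting process up to time `s`. -/
@[reducible] def countPast (s : ℝ) : MeasurableSpace Ω :=
  ⨆ r : Set.Icc (0 : ℝ) s, MeasurableSpace.comap (L.N r) inferInstance

/-- The information in the first `n` marks of each type. -/
@[reducible] def markPast (n : ℕ) : MeasurableSpace Ω :=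
  ⨆ x ∈ {x : ℕ × Fin L.l | x.1 < n}, MeasurableSpace.comap (L.mark x.1 x.2) inferInstance

/-- The information in the marks from the `(n+1)`-st on. -/
@[reducible] def markFuture (n : ℕ) : MeasurableSpace Ω :=
  ⨆ x ∈ {x : ℕ × Fin L.l | n ≤ x.1}, MeasurableSpace.comap (L.mark x.1 x.2) inferInstance

lemma countPast_le (s : ℝ) : L.countPast s ≤ mΩ :=
  iSup_le fun r => (L.poisson.measurable r r.2.1).comap_le

lemma markPast_le (n : ℕ) : L.markPast n ≤ mΩ :=
  iSup₂_le fun x _ => (L.mark_measurable x.1 x.2).comap_le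

lemma markFuture_le (n : ℕ) : L.markFuture n ≤ mΩ :=
  iSup₂_le fun x _ => (L.mark_measurable x.1 x.2).comap_le

lemma measurable_countPast {r s : ℝ} (hr : 0 ≤ r) (hrs : r ≤ s) :
    Measurable[L.countPast s] (L.N r) :=
  measurable_iff_comap_le.2 (le_iSup (fun r : Set.Icc (0 : ℝ) s =>
    MeasurableSpace.comap (L.N r) inferInstance) ⟨r, hr, hrs⟩)

lemma countPast_mono {s t : ℝ} (hst : s ≤ t) : L.countPast s ≤ L.countPast t :=
  iSup_le fun r => comap_le_of_measurable (L.measurable_countPast r.2.1 (r.2.2.trans hst))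

lemma measurable_markPast {i n : ℕ} (h : i < n) (j : Fin L.l) :
    Measurable[L.markPast n] (L.mark i j) :=
  measurable_iff_comap_le.2 (le_iSup₂_of_le (i, j) h le_rfl)

lemma measurable_markFuture {i n : ℕ} (h : n ≤ i) (j : Fin L.l) :
    Measurable[L.markFuture n] (L.mark i j) :=
  measurable_iff_comap_le.2 (le_iSup₂_of_le (i, j) h le_rfl)

/-- The information available at time `s`: the jump times and the jump sizes up to time `s`. -/
@[reducible] def history (s : ℝ) : MeasurableSpace Ω where
  -- The number of marks revealed by time s is the random N(s). An event is therefore tested on each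
  -- slice {N(s) = n}, where only the first n marks may be used. The maximum with 0 makes the
  -- definition meaningful for every real s.
  MeasurableSet' A := ∀ n, MeasurableSet[L.countPast (max s 0) ⊔ L.markPast n]
    (A ∩ L.N (max s 0) ⁻¹' {n})
  measurableSet_empty n := by
    rw [Set.empty_inter]; exact @MeasurableSet.empty _ (_)
  measurableSet_compl A hA n := by
    have h : Aᶜ ∩ L.N (max s 0) ⁻¹' {n}
        = (L.N (max s 0) ⁻¹' {n}) \ (A ∩ L.N (max s 0) ⁻¹' {n}) := by
      ext ω; simp only [Set.mem_inter_iff, Set.mem_compl_iff, Set.mem_sdiff]; tauto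
    rw [h]
    refine @MeasurableSet.diff _ (_) _ _ ?_ (hA n)
    exact (le_sup_left : L.countPast (max s 0) ≤ _) _
      (L.measurable_countPast (le_max_right s 0) le_rfl (measurableSet_singleton n))
  measurableSet_iUnion f hf n := by
    rw [Set.iUnion_inter]
    exact @MeasurableSet.iUnion _ _ (_) _ _ fun i => hf i n

lemma measurableSet_history {s : ℝ} (hs : 0 ≤ s) {A : Set Ω} :
    MeasurableSet[L.history s] A ↔
      ∀ n, MeasurableSet[L.countPast s ⊔ L.markPast n] (A ∩ L.N s ⁻¹' {n}) := by
  change (∀ n, MeasurableSet[L.countPast (max s 0) ⊔ L.markPast n] (A ∩ L.N (max s 0) ⁻¹' {n})) ↔ _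
  rw [max_eq_left hs]

lemma history_le {s : ℝ} (hs : 0 ≤ s) : L.history s ≤ mΩ := by
  intro A hA
  rw [L.measurableSet_history hs] at hA
  have : A = ⋃ n, A ∩ L.N s ⁻¹' {n} := by ext ω; simp
  rw [this]
  exact MeasurableSet.iUnion fun n => (sup_le (L.countPast_le s) (L.markPast_le n)) _ (hA n)

/-- The jump process `∑_{n ≤ N(t)} Z_n`. -/
noncomputable def X (t : ℝ) (ω : Ω) : ℝ := ∑ n ∈ Finset.range (L.N t ω), L.jump n ω

lemma S_eq (t : ℝ) (ω : Ω) : L.S t ω = L.drift t + L.X t ω := rfl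

/-- The default 0 hides arrivals after s. For a ≥ 0 the value is at most a exactly if the jump has
not happened by s or has happened by min(a, s). -/
lemma measurable_cut_arrival {s : ℝ} (hs : 0 ≤ s) (i : ℕ) :
    Measurable[L.countPast s] fun ω => if i < L.N s ω then L.arrival i ω else 0 := by
  have hset : ∀ {r : ℝ}, 0 ≤ r → r ≤ s → MeasurableSet[L.countPast s] {ω | i < L.N r ω} :=
    fun hr hrs => L.measurable_countPast hr hrs (measurableSet_Ioi (a := i))
  refine measurable_of_Iic fun a => ?_
  rcases lt_or_ge a 0 with ha | ha
  · convert @MeasurableSet.empty _ (L.countPast s)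
    ext ω
    simp only [Set.mem_preimage, Set.mem_Iic, Set.mem_empty_iff_false, iff_false, not_le]
    split_ifs with h
    · exact ha.trans_le ((L.isCountingPath ω).arr_spec hs h).1
    · exact ha
  · have : (fun ω => if i < L.N s ω then L.arrival i ω else 0) ⁻¹' Set.Iic a
        = {ω | i < L.N s ω}ᶜ ∪ {ω | i < L.N (min a s) ω} := by
      ext ω
      simp only [Set.mem_preimage, Set.mem_Iic, Set.mem_union, Set.mem_compl_iff, Set.mem_ofPred_eq]
      split_ifs with h
      · simp only [h, not_true_eq_false, false_or]
        rw [← (L.isCountingPath ω).arr_le_iff (le_min ha hs) hs h]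
        exact ⟨fun h' => le_min h' ((L.isCountingPath ω).arr_spec hs h).2.1,
          fun h' => h'.trans (min_le_left _ _)⟩
      · simp [h, ha]
    rw [this]
    exact @MeasurableSet.union _ (L.countPast s) _ _
      (@MeasurableSet.compl _ _ (L.countPast s) (hset hs le_rfl))
      (hset (le_min ha hs) (min_le_right _ _))

open Classical in
lemma measurable_sum_ite_sum {Ω' : Type*} {m : MeasurableSpace Ω'} (n : ℕ) {l : ℕ} {c : Ω' → ℕ}
    {τ : ℕ → Ω' → ℝ} {K : Fin l → Set ℝ} {z : ℕ → Fin l → Ω' → ℝ} (hc : Measurable c)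
    (hτ : ∀ i < n, Measurable (τ i)) (hK : ∀ j, MeasurableSet (K j))
    (hz : ∀ i < n, ∀ j, Measurable (z i j)) :
    Measurable fun ω => ∑ i ∈ Finset.range n, if i < c ω then
      (∑ j : Fin l, if τ i ω ∈ K j then z i j ω else 0) else 0 := by
  refine Finset.measurable_sum _ fun i hi => ?_
  rw [Finset.mem_range] at hi
  refine Measurable.ite (hc measurableSet_Ioi) ?_ measurable_const
  exact Finset.measurable_sum _ fun j _ =>
    Measurable.ite (hτ i hi (hK j)) (hz i hi j) measurable_const

/-- On the slice {N(s) = n}, the variable X_r agrees with a finite expression `W` in the first n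
marks, the truncated arrivals and N(r). -/
lemma measurable_X_history {r s : ℝ} (hr : 0 ≤ r) (hrs : r ≤ s) :
    Measurable[L.history s] (L.X r) := by
  classical
  intro U hU
  have hs := hr.trans hrs
  rw [L.measurableSet_history hs]
  intro n
  set τ : ℕ → Ω → ℝ := fun i ω => if i < L.N s ω then L.arrival i ω else 0
  set W : Ω → ℝ := fun ω => ∑ i ∈ Finset.range n, if i < L.N r ω then
    (∑ j : Fin L.l, if τ i ω ∈ L.cells j then L.mark i j ω else 0) else 0
  have hW : Measurable[L.countPast s ⊔ L.markPast n] W :=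
    measurable_sum_ite_sum n
      ((L.measurable_countPast hr hrs).mono le_sup_left le_rfl)
      (fun i _ => (L.measurable_cut_arrival hs i).mono le_sup_left le_rfl) L.measurableSet_cells
      (fun i hi j => (L.measurable_markPast hi j).mono le_sup_right le_rfl)
  have : L.X r ⁻¹' U ∩ L.N s ⁻¹' {n} = W ⁻¹' U ∩ L.N s ⁻¹' {n} := by
    ext ω
    simp only [Set.mem_inter_iff, Set.mem_preimage, Set.mem_singleton_iff, and_congr_left_iff]
    intro hn
    have hle : L.N r ω ≤ n := hn ▸ L.poisson.mono ω r s hr hrs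
    have : W ω = L.X r ω := by
      simp only [W, X]
      rw [← Finset.sum_filter]
      have : Finset.filter (fun i => i < L.N r ω) (Finset.range n) = Finset.range (L.N r ω) := by
        ext i; simp only [Finset.mem_filter, Finset.mem_range]; omega
      rw [this]
      refine Finset.sum_congr rfl fun i hi => ?_
      rw [Finset.mem_range] at hi
      have h : i < L.N s ω := by omega
      simp only [τ, h, if_true, jump]
    rw [this]
  rw [this]
  exact @MeasurableSet.inter _ (_) _ _ (hW hU)
    ((le_sup_left : L.countPast s ≤ L.countPast s ⊔ L.markPast n) _ (L.measurable_countPast hs le_rfl (measurableSet_singleton n)))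

lemma measurable_X {t : ℝ} (ht : 0 ≤ t) : Measurable (L.X t) :=
  (L.measurable_X_history ht le_rfl).mono (L.history_le ht) le_rfl

/-- A slice of N(t) = n splits into the finitely many slices N(s) = k with k ≤ n, and each of these
uses at most n marks. -/
lemma history_mono {s t : ℝ} (hs : 0 ≤ s) (hst : s ≤ t) : L.history s ≤ L.history t := by
  intro A hA
  rw [L.measurableSet_history hs] at hA
  rw [L.measurableSet_history (hs.trans hst)]
  intro n
  have : A ∩ L.N t ⁻¹' {n}
      = (⋃ k ∈ Finset.range (n + 1), A ∩ L.N s ⁻¹' {k}) ∩ L.N t ⁻¹' {n} := by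
    ext ω
    simp only [Set.mem_inter_iff, Set.mem_preimage, Set.mem_singleton_iff, Finset.mem_range,
      Set.mem_iUnion, exists_prop, exists_eq_right_right', and_congr_left_iff]
    intro h
    have := L.poisson.mono ω s t hs hst
    exact ⟨fun h1 => ⟨by omega, h1⟩, fun h1 => h1.2⟩
  rw [this]
  refine @MeasurableSet.inter _ (_) _ _ (@Finset.measurableSet_biUnion _ _ (_) _ _ fun k hk => ?_)
    ((le_sup_left : L.countPast t ≤ L.countPast t ⊔ L.markPast n) _
      (L.measurable_countPast (hs.trans hst) le_rfl (measurableSet_singleton n)))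
  refine (sup_le_sup (L.countPast_mono hst) ?_) _ (hA k)
  rw [Finset.mem_range] at hk
  exact iSup₂_le fun x hx => comap_le_of_measurable
    (L.measurable_markPast (show x.1 < n from lt_of_lt_of_le hx (by omega)) x.2)

end SimpleSemiLevy

lemma comap_sub_le {Ω' E : Type*} {m : MeasurableSpace Ω'} [MeasurableSpace E] [Sub E]
    [MeasurableSub₂ E] {f g : Ω' → E} (hf : Measurable f) (hg : Measurable g) :
    MeasurableSpace.comap (fun ω => f ω - g ω) inferInstance ≤ m :=
  measurable_iff_comap_le.1 (hf.sub hg)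

namespace SimpleSemiLevy

variable {Ω : Type*} [mΩ : MeasurableSpace Ω] {P : Measure Ω} [IsProbabilityMeasure P]
  (L : SimpleSemiLevy P)

/-! ### Independence of the counting process and of the marks -/

lemma indep_countPast {s t : ℝ} (hs : 0 ≤ s) (hst : s ≤ t) :
    Indep (L.countPast s)
      (MeasurableSpace.comap (fun ω => L.N t ω - L.N s ω) inferInstance) P := by
  have ht := hs.trans hst
  have h := HasIndepIncrements.indep_past (s := ⟨s, hs⟩) (t := ⟨t, ht⟩) L.poisson.indep
    (fun t => measurable_from_nat.comp (L.poisson.measurable t t.2))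
    (fun ω => by simp [L.poisson.zero]) hst
  refine indep_of_indep_of_le h (iSup_le fun r => ?_) (comap_le_of_measurable ?_)
  · refine le_iSup_of_le (⟨⟨r, r.2.1⟩, r.2.2⟩ : Set.Iic (⟨s, hs⟩ : ℝ≥0)) ?_
    refine comap_le_of_measurable ?_
    -- Independence of increments is assumed for the real-valued cast of N; the floor recovers the
    -- integer count measurably.
    have : L.N r = fun ω => ⌊((L.N r ω : ℕ) : ℝ)⌋₊ := by funext ω; simp
    rw [this]
    exact Nat.measurable_floor.comp (comap_measurable _)
  · have : (fun ω => L.N t ω - L.N s ω) = fun ω => ⌊((L.N t ω : ℕ) : ℝ) - (L.N s ω : ℕ)⌋₊ := by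
      funext ω
      rw [← Nat.cast_sub (L.poisson.mono ω s t hs hst), Nat.floor_natCast]
    rw [this]
    exact Nat.measurable_floor.comp (comap_measurable
      (fun ω => ((L.N t ω : ℕ) : ℝ) - (L.N s ω : ℕ)))

lemma indep_mark (n : ℕ) : Indep (L.markPast n) (L.markFuture n) P :=
  indep_iSup_of_disjoint
    (m := fun x : ℕ × Fin L.l => MeasurableSpace.comap (L.mark x.1 x.2) inferInstance)
    (S := {x | x.1 < n}) (T := {x | n ≤ x.1})
    (fun x => (L.mark_measurable x.1 x.2).comap_le) L.mark_indep.iIndep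
    (Set.disjoint_left.2 fun x (h1 : x.1 < n) (h2 : n ≤ x.1) => absurd h1 (not_lt.2 h2))

/-- Here n is deterministic; the random index N(s) is brought in afterwards by slicing. -/
lemma indep_pastAt {s t : ℝ} (hs : 0 ≤ s) (hst : s ≤ t) (n : ℕ) :
    Indep (L.countPast s ⊔ L.markPast n)
      (MeasurableSpace.comap (fun ω => L.N t ω - L.N s ω) inferInstance ⊔ L.markFuture n) P := by
  refine indep_sup_sup (L.countPast_le s) (L.measurable_count hs (hs.trans hst)).comap_le
    (L.markPast_le n) (L.markFuture_le n) (L.indep_countPast hs hst) (L.indep_mark n) ?_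
  refine indep_of_indep_of_le L.mark_indep_N.symm (sup_le (iSup_le fun r => ?_) ?_)
    (sup_le (iSup₂_le fun x _ => ?_) (iSup₂_le fun x _ => ?_))
  · exact le_iSup_of_le (⟨r, r.2.1⟩ : ℝ≥0) le_rfl
  · refine comap_sub_le (measurable_iff_comap_le.2 ?_) (measurable_iff_comap_le.2 ?_)
    · exact le_iSup_of_le (⟨t, hs.trans hst⟩ : ℝ≥0) le_rfl
    · exact le_iSup_of_le (⟨s, hs⟩ : ℝ≥0) le_rfl
  · exact le_iSup_of_le x le_rfl
  · exact le_iSup_of_le x le_rfl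

lemma measure_count_eq {s t : ℝ} (hs : 0 ≤ s) (hst : s ≤ t) (k : ℕ) :
    P ((fun ω => L.N t ω - L.N s ω) ⁻¹' {k}) = poissonMeasure (L.Λ s t) {k} := by
  rw [Λ, ← L.poisson.law s t hs hst,
    Measure.map_apply (L.measurable_count hs (hs.trans hst)) (measurableSet_singleton k)]

/-! ### Sums of marks -/

/-- The sum of `k` consecutive marks of type `j`. -/
noncomputable def markSum (j : Fin L.l) (n k : ℕ) (ω : Ω) : ℝ :=
  ∑ i ∈ Finset.range k, L.mark (n + i) j ω

lemma measurable_markSum (j : Fin L.l) (n k : ℕ) : Measurable[L.markFuture n] (L.markSum j n k) :=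
  Finset.measurable_sum _ fun i _ => L.measurable_markFuture (Nat.le_add_right n i) j

lemma measurable_markSum' (j : Fin L.l) (n k : ℕ) : Measurable (L.markSum j n k) :=
  (L.measurable_markSum j n k).mono (L.markFuture_le n) le_rfl

/-- The right-hand side is free of n: a block of k marks has the same law wherever it starts, so the
law of an increment does not remember the number of earlier jumps. -/
lemma map_markSum (j : Fin L.l) (n k : ℕ) :
    P.map (L.markSum j n k) = (Measure.pi fun _ : Fin k => L.F j).map fun x => ∑ i, x i := by
  have hind : iIndepFun (fun (i : Fin k) => L.mark (n + i) j) P :=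
    L.mark_indep.precomp (g := fun i : Fin k => (n + i, j)) fun a b hab => by
      simp only [Prod.mk.injEq, add_right_inj, and_true] at hab
      exact Fin.ext hab
  have h := hind.map_fun_eq_pi_map fun i => (L.mark_measurable _ _).aemeasurable
  simp only [L.mark_law] at h
  rw [← h, Measure.map_map (by fun_prop)
    (measurable_pi_lambda _ fun i => L.mark_measurable _ _)]
  congr 1
  funext ω
  simp only [markSum, Function.comp, Finset.sum_range]

lemma measure_markSum (j : Fin L.l) (n k : ℕ) {U : Set ℝ} (hU : MeasurableSet U) :
    P (L.markSum j n k ⁻¹' U) = P (L.markSum j 0 k ⁻¹' U) := by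
  rw [← Measure.map_apply (L.measurable_markSum' j n k) hU,
    ← Measure.map_apply (L.measurable_markSum' j 0 k) hU, map_markSum, map_markSum]

/-! ### No jump at a fixed time -/

/-- A jump at t forces a jump in every (r, t], an event of probability 1 − exp(−∫ λ) over that
interval, which vanishes as r increases to t. -/
lemma ae_count_eq {t : ℝ} (ht : 0 < t) : ∀ᵐ ω ∂P, ∃ r, 0 ≤ r ∧ r < t ∧ L.N r ω = L.N t ω := by
  set r : ℕ → ℝ := fun n => t - t / (n + 2)
  have hr : ∀ n, 0 ≤ r n ∧ r n < t := by
    intro n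
    have h2 : (0 : ℝ) < n + 2 := by positivity
    constructor
    · simp only [r, sub_nonneg]; exact div_le_self ht.le (by linarith [(Nat.cast_nonneg n : (0:ℝ) ≤ n)])
    · simp only [r]; linarith [div_pos ht h2]
  have hbound : ∀ n, P {ω | ¬ ∃ r, 0 ≤ r ∧ r < t ∧ L.N r ω = L.N t ω}
      ≤ ENNReal.ofReal (1 - Real.exp (-(∫ u in (r n)..t, L.rate u))) := by
    intro n
    have hm := L.measurable_count (hr n).1 ht.le
    have h1 : P ((fun ω => L.N t ω - L.N (r n) ω) ⁻¹' {0})ᶜ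
        = ENNReal.ofReal (1 - Real.exp (-(∫ u in (r n)..t, L.rate u))) := by
      rw [prob_compl_eq_one_sub (hm (measurableSet_singleton 0)),
        L.measure_count_eq (hr n).1 (hr n).2.le, poissonMeasure_singleton,
        ENNReal.ofReal_sub _ (Real.exp_pos _).le, L.coe_Λ (hr n).1 (hr n).2.le]
      simp
    rw [← h1]
    refine measure_mono fun ω hω h0 => hω ⟨r n, (hr n).1, (hr n).2, ?_⟩
    have h3 : L.N t ω - L.N (r n) ω = 0 := h0
    have := L.poisson.mono ω _ _ (hr n).1 (hr n).2.le
    omega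
  have hlim : Tendsto (fun n => ENNReal.ofReal (1 - Real.exp (-(∫ u in (r n)..t, L.rate u)))) atTop
      (𝓝 (ENNReal.ofReal 0)) := by
    have hrt : Tendsto r atTop (𝓝 t) := by
      have h := (tendsto_const_div_atTop_nhds_zero_nat t).comp (tendsto_add_atTop_nat 2)
      simpa [r, Function.comp_def] using h.const_sub t
    have hI := L.rate_intervalIntegrable le_rfl ht.le
    have hcont := intervalIntegral.continuousOn_primitive_interval'
      (L.rate_intervalIntegrable ht.le le_rfl) (a := t) (by simp)
    have h2 : Tendsto (fun n => ∫ u in t..(r n), L.rate u) atTop (𝓝 (∫ u in t..t, L.rate u)) := by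
      refine (hcont t (by simp)).tendsto.comp (tendsto_nhdsWithin_iff.2 ⟨hrt, ?_⟩)
      refine Eventually.of_forall fun n => ?_
      rw [Set.uIcc_of_ge ht.le]
      exact ⟨(hr n).1, (hr n).2.le⟩
    rw [intervalIntegral.integral_same] at h2
    refine ENNReal.tendsto_ofReal ?_
    have h3 : Tendsto (fun n => 1 - Real.exp (∫ u in t..(r n), L.rate u)) atTop (𝓝 (1 - 1)) := by
      have := ((Real.continuous_exp.tendsto 0).comp h2).const_sub 1
      rwa [Real.exp_zero] at this
    rw [sub_self] at h3
    refine h3.congr fun n => ?_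
    rw [intervalIntegral.integral_symm]
  rw [ENNReal.ofReal_zero] at hlim
  exact le_antisymm (ge_of_tendsto' hlim hbound) zero_le

lemma ae_arrival_ne {t : ℝ} (ht : 0 < t) :
    ∀ᵐ ω ∂P, ∀ n T, 0 ≤ T → n < L.N T ω → L.arrival n ω ≠ t := by
  filter_upwards [L.ae_count_eq ht] with ω ⟨r, hr0, hrt, hr⟩ n T hT hn heq
  have hc := L.isCountingPath ω
  have h1 : L.N r ω ≤ n := (hc.lt_arr_iff hr0 hT hn).1 (by
    change r < L.arrival n ω; rwa [heq])
  have h2 : L.N t ω = n + 1 := by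
    rw [← heq]; exact hc.count_arr hT hn
  omega

/-! ### Increments over a part of a cell -/

lemma measurable_X_sub {s t : ℝ} (hs : 0 ≤ s) (ht : 0 ≤ t) :
    Measurable fun ω => L.X t ω - L.X s ω :=
  (L.measurable_X ht).sub (L.measurable_X hs)

lemma X_sub_X {s t : ℝ} (hs : 0 ≤ s) (hst : s ≤ t) (ω : Ω) :
    L.X t ω - L.X s ω = ∑ n ∈ Finset.Ico (L.N s ω) (L.N t ω), L.jump n ω :=
  sum_range_sub_sum_range _ (L.poisson.mono ω s t hs hst)

/-- Counts live on (s, t] while cells are closed on the left and open on the right. The conventions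
clash only at `part (k + 1)`, which almost surely is not an arrival time, so all jumps involved have
the type of the cell. -/
lemma ae_X_sub_eq {k : ℕ} {s t : ℝ} (hs : L.part k ≤ s) (hst : s ≤ t) (ht : t ≤ L.part (k + 1)) :
    ∀ᵐ ω ∂P, L.X t ω - L.X s ω
      = L.markSum (L.cellType (k + 1)) (L.N s ω) (L.N t ω - L.N s ω) ω := by
  have hs0 := (L.part_nonneg k).trans hs
  have ht0 := hs0.trans hst
  have hpos : 0 < L.part (k + 1) := (L.part_nonneg k).trans_lt (L.part_strictMono k.lt_succ_self)
  filter_upwards [L.ae_arrival_ne hpos] with ω hω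
  rw [L.X_sub_X hs0 hst, markSum, Finset.sum_Ico_eq_sum_range]
  refine Finset.sum_congr rfl fun i hi => L.jump_eq ?_
  rw [Finset.mem_range] at hi
  have hlt : L.N s ω + i < L.N t ω := by omega
  have h1 := (L.isCountingPath ω).mem_Ioc_of_mem_Ico hs0 ht0 (n := L.N s ω + i)
    (Finset.mem_Ico.2 ⟨by omega, hlt⟩)
  exact ⟨hs.trans h1.1.le, lt_of_le_of_ne (h1.2.trans ht) (hω _ t ht0 hlt)⟩

/-- Slice by N(s) = n and by the number c of new jumps. On a slice the increment of X is the sum of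
the marks n, …, n + c − 1, which are independent of the history slice and of the count. The law of
this sum does not depend on n, so summing over n restores P(A). -/
lemma measure_inter_cell {k : ℕ} {s t : ℝ} (hs : L.part k ≤ s) (hst : s ≤ t)
    (ht : t ≤ L.part (k + 1)) {A : Set Ω} (hA : MeasurableSet[L.history s] A) {U : Set ℝ}
    (hU : MeasurableSet U) :
    P (A ∩ (fun ω => L.X t ω - L.X s ω) ⁻¹' U)
      = P A * ∑' c, poissonMeasure (L.Λ s t) {c}
        * P (L.markSum (L.cellType (k + 1)) 0 c ⁻¹' U) := by
  have hs0 := (L.part_nonneg k).trans hs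
  have ht0 := hs0.trans hst
  set j := L.cellType (k + 1)
  have hA' := L.history_le hs0 A hA
  rw [L.measurableSet_history hs0] at hA
  have hB : MeasurableSet (A ∩ (fun ω => L.X t ω - L.X s ω) ⁻¹' U) :=
    hA'.inter (((L.measurable_X ht0).sub (L.measurable_X hs0)) hU)
  have hcount := L.measurable_count hs0 ht0
  rw [measure_eq_tsum_inter_fiber P hB (L.poisson.measurable s hs0),
    measure_eq_tsum_inter_fiber P hA' (L.poisson.measurable s hs0), ← ENNReal.tsum_mul_right]
  refine tsum_congr fun n => ?_
  rw [measure_eq_tsum_inter_fiber P (hB.inter (L.poisson.measurable s hs0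
    (measurableSet_singleton n))) hcount, ← ENNReal.tsum_mul_left]
  refine tsum_congr fun c => ?_
  have hae : (A ∩ (fun ω => L.X t ω - L.X s ω) ⁻¹' U ∩ L.N s ⁻¹' {n}
        ∩ (fun ω => L.N t ω - L.N s ω) ⁻¹' {c} : Set Ω)
      =ᵐ[P] ((A ∩ L.N s ⁻¹' {n}) ∩ ((fun ω => L.N t ω - L.N s ω) ⁻¹' {c}
        ∩ L.markSum j n c ⁻¹' U) : Set Ω) := by
    filter_upwards [L.ae_X_sub_eq hs hst ht] with ω hω
    refine propext ?_
    change ((ω ∈ A ∧ L.X t ω - L.X s ω ∈ U) ∧ L.N s ω = n) ∧ L.N t ω - L.N s ω = c ↔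
      (ω ∈ A ∧ L.N s ω = n) ∧ (L.N t ω - L.N s ω = c ∧ L.markSum j n c ω ∈ U)
    rw [hω]
    constructor
    · rintro ⟨⟨⟨h1, h2⟩, h3⟩, h4⟩
      rw [h3] at h2 h4
      rw [h4] at h2
      exact ⟨⟨h1, h3⟩, by rw [h3, h4], h2⟩
    · rintro ⟨⟨h1, h3⟩, h4, h2⟩
      refine ⟨⟨⟨h1, ?_⟩, h3⟩, h4⟩
      rw [h4, h3]; exact h2
  have hE : MeasurableSet[MeasurableSpace.comap (fun ω => L.N t ω - L.N s ω) inferInstance]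
      ((fun ω => L.N t ω - L.N s ω) ⁻¹' {c}) := ⟨{c}, measurableSet_singleton c, rfl⟩
  have hM : MeasurableSet[L.markFuture n] (L.markSum j n c ⁻¹' U) := L.measurable_markSum j n c hU
  have hNM : Indep (MeasurableSpace.comap (fun ω => L.N t ω - L.N s ω) inferInstance)
      (L.markFuture n) P := by
    refine indep_of_indep_of_le L.mark_indep_N.symm ?_ (iSup₂_le fun x _ => ?_)
    · refine comap_sub_le (measurable_iff_comap_le.2 ?_) (measurable_iff_comap_le.2 ?_)
      · exact le_iSup_of_le (⟨t, ht0⟩ : ℝ≥0) le_rfl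
      · exact le_iSup_of_le (⟨s, hs0⟩ : ℝ≥0) le_rfl
    · exact le_iSup_of_le x le_rfl
  rw [measure_congr hae, (Indep_iff _ _ _).1 (L.indep_pastAt hs0 hst n) _ _ (hA n)
    (@MeasurableSet.inter _ (_) _ _ ((le_sup_left : _ ≤ _ ⊔ L.markFuture n) _ hE)
      ((le_sup_right : L.markFuture n ≤ _ ⊔ L.markFuture n) _ hM)),
    (Indep_iff _ _ _).1 hNM _ _ hE hM, L.measure_count_eq hs0 hst, L.measure_markSum j n c hU]

lemma measure_X_sub_cell {k : ℕ} {s t : ℝ} (hs : L.part k ≤ s) (hst : s ≤ t)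
    (ht : t ≤ L.part (k + 1)) {U : Set ℝ} (hU : MeasurableSet U) :
    P ((fun ω => L.X t ω - L.X s ω) ⁻¹' U)
      = ∑' c, poissonMeasure (L.Λ s t) {c}
        * P (L.markSum (L.cellType (k + 1)) 0 c ⁻¹' U) := by
  have := L.measure_inter_cell hs hst ht (A := Set.univ) (@MeasurableSet.univ _ (_)) hU
  rwa [Set.univ_inter, measure_univ, one_mul] at this

/-- Realising the compound Poisson law on a product space reduces its moments to Fubini and the
moments of a Poisson variable. -/
lemma map_X_sub_cell {k : ℕ} {s t : ℝ} (hs : L.part k ≤ s) (hst : s ≤ t)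
    (ht : t ≤ L.part (k + 1)) :
    P.map (fun ω => L.X t ω - L.X s ω) = ((poissonMeasure (L.Λ s t)).prod P).map
      fun x => L.markSum (L.cellType (k + 1)) 0 x.1 x.2 := by
  have hs0 := (L.part_nonneg k).trans hs
  have hm : Measurable fun x : ℕ × Ω => L.markSum (L.cellType (k + 1)) 0 x.1 x.2 :=
    measurable_from_prod_countable_right fun c => L.measurable_markSum' _ 0 c
  ext U hU
  rw [Measure.map_apply (L.measurable_X_sub hs0 (hs0.trans hst)) hU,
    Measure.map_apply hm hU, L.measure_X_sub_cell hs hst ht hU, Measure.prod_apply (hm hU),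
    lintegral_countable']
  exact tsum_congr fun c => mul_comm _ _

/-! ### Interval induction over the cells -/

/-- Cells are peeled off from the left; only finitely many partition points lie below t because the
partition is unbounded. -/
lemma interval_induction {Q : ℝ → ℝ → Prop}
    (hcell : ∀ k s t, L.part k ≤ s → s ≤ t → t ≤ L.part (k + 1) → Q s t)
    (htrans : ∀ s u t, 0 ≤ s → s ≤ u → u ≤ t → Q s u → Q u t → Q s t) {s t : ℝ} (hs : 0 ≤ s)
    (hst : s ≤ t) : Q s t := by
  have key : ∀ d : ℕ, ∀ s, 0 ≤ s → s ≤ t → t ≤ L.part (L.cellIdx s + 1 + d) → Q s t := by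
    intro d
    induction d with
    | zero =>
      intro s hs hst h
      exact hcell _ s t (L.mem_cellIdx hs).1 hst h
    | succ d ih =>
      intro s hs hst h
      by_cases h' : t ≤ L.part (L.cellIdx s + 1)
      · exact hcell _ s t (L.mem_cellIdx hs).1 hst h'
      · push Not at h'
        have hlt := (L.mem_cellIdx hs).2
        have e : L.cellIdx (L.part (L.cellIdx s + 1)) = L.cellIdx s + 1 :=
          L.cellIdx_eq ⟨le_rfl, L.part_strictMono (Nat.lt_succ_self _)⟩
        refine htrans s (L.part (L.cellIdx s + 1)) t hs hlt.le h'.le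
          (hcell _ _ _ (L.mem_cellIdx hs).1 hlt.le le_rfl)
          (ih _ (L.part_nonneg _) h'.le ?_)
        rw [e]
        convert h using 2
        ring
  obtain ⟨n, hn⟩ := L.exists_lt_part t
  exact key n s hs hst (hn.le.trans (L.part_strictMono.monotone (by omega)))

/-- Within a cell this is the product formula of `measure_inter_cell`. For s ≤ u ≤ t the first
increment belongs to the history at u, so the two independences chain. -/
lemma indep_history {s t : ℝ} (hs : 0 ≤ s) (hst : s ≤ t) :
    Indep (L.history s)
      (MeasurableSpace.comap (fun ω => L.X t ω - L.X s ω) inferInstance) P := by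
  have hm : ∀ {s t : ℝ}, 0 ≤ s → s ≤ t → Measurable fun ω => L.X t ω - L.X s ω :=
    fun hs hst => (L.measurable_X (hs.trans hst)).sub (L.measurable_X hs)
  refine L.interval_induction (Q := fun s t => 0 ≤ s → Indep (L.history s)
    (MeasurableSpace.comap (fun ω => L.X t ω - L.X s ω) inferInstance) P) ?_ ?_ hs hst hs
  · intro k s t hs hst ht _
    rw [Indep_iff]
    rintro A _ hA ⟨U, hU, rfl⟩
    rw [L.measure_inter_cell hs hst ht hA hU, L.measure_X_sub_cell hs hst ht hU]
  · intro s u t hs hsu hut h1 h2 _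
    have hu := hs.trans hsu
    have h := indep_sup_right_of_indep (L.history_le hs) (hm hs hsu).comap_le
      (hm hu hut).comap_le (h1 hs) (indep_of_indep_of_le_left (h2 hu)
        (sup_le (L.history_mono hs hsu) (comap_le_of_measurable
          ((L.measurable_X_history hu le_rfl).sub (L.measurable_X_history hs hsu)))))
    refine indep_of_indep_of_le_right h (comap_le_of_measurable ?_)
    have : (fun ω => L.X t ω - L.X s ω)
        = fun ω => (L.X u ω - L.X s ω) + (L.X t ω - L.X u ω) := by funext ω; ring
    rw [this]
    exact ((comap_measurable (fun ω => L.X u ω - L.X s ω)).mono le_sup_left le_rfl).add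
      ((comap_measurable (fun ω => L.X t ω - L.X u ω)).mono le_sup_right le_rfl)

/-- The information in the increments of the jump process after time `s`. -/
@[reducible] noncomputable def future (s : ℝ) : MeasurableSpace Ω :=
  ⨆ u : Set.Ici s, MeasurableSpace.comap (fun ω => L.X u ω - L.X s ω) inferInstance

lemma future_le {s : ℝ} (hs : 0 ≤ s) : L.future s ≤ mΩ :=
  iSup_le fun u => ((L.measurable_X (hs.trans u.2)).sub (L.measurable_X hs)).comap_le

lemma measurable_future {s u v : ℝ} (hu : s ≤ u) (hv : s ≤ v) :
    Measurable[L.future s] fun ω => L.X v ω - L.X u ω := by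
  have h : ∀ {u}, s ≤ u → Measurable[L.future s] fun ω => L.X u ω - L.X s ω := fun {u} hu =>
    measurable_iff_comap_le.2 (le_iSup (fun u : Set.Ici s =>
      MeasurableSpace.comap (fun ω => L.X u ω - L.X s ω) inferInstance) ⟨u, hu⟩)
  have : (fun ω => L.X v ω - L.X u ω)
      = fun ω => (L.X v ω - L.X s ω) - (L.X u ω - L.X s ω) := by funext ω; ring
  rw [this]
  exact (h hv).sub (h hu)

/-- The information in finitely many increments of the jump process after time `s`. -/
@[reducible] noncomputable def finFuture (s : ℝ) (I : Finset (Set.Ici s)) : MeasurableSpace Ω :=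
  ⨆ r ∈ I, MeasurableSpace.comap (fun ω => L.X r ω - L.X s ω) inferInstance

/-- Finite sets of times suffice, since they form a directed family. Adding times in increasing
order means that each new increment starts after all those already treated, where `indep_history`
applies. -/
lemma indep_history_future {s : ℝ} (hs : 0 ≤ s) : Indep (L.history s) (L.future s) P := by
  have hm : ∀ u : Set.Ici s, Measurable fun ω => L.X u ω - L.X s ω :=
    fun u => (L.measurable_X (hs.trans u.2)).sub (L.measurable_X hs)
  rw [future, iSup_eq_iSup_finset]
  refine (indep_iSup_of_directed_le (fun I => Indep.symm ?_)
    (fun I => iSup₂_le fun r _ => (hm r).comap_le) (L.history_le hs)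
    (Monotone.directed_le fun I I' h => biSup_mono fun r hr => (show I ⊆ I' from h) hr)).symm
  classical
  induction I using Finset.induction_on_max with
  | empty => simpa using indep_bot_right (L.history s)
  | insert u I hI ih =>
    change Indep (L.history s) (L.finFuture s I) P at ih
    -- the last time before `u`
    obtain ⟨v, hsv, hvu, hvI, hvm⟩ : ∃ v : ℝ, s ≤ v ∧ v ≤ u ∧ (∀ r ∈ I, (r : ℝ) ≤ v) ∧
        Measurable[L.finFuture s I] fun ω => L.X v ω - L.X s ω := by
      rcases I.eq_empty_or_nonempty with rfl | hne
      · refine ⟨s, le_rfl, u.2, by simp, ?_⟩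
        simp only [sub_self]; exact measurable_const
      · refine ⟨I.max' hne, (I.max' hne).2, (hI _ (I.max'_mem hne)).le,
          fun r hr => I.le_max' r hr, ?_⟩
        exact measurable_iff_comap_le.2 (le_iSup₂_of_le _ (I.max'_mem hne) le_rfl)
    have hv := hs.trans hsv
    have hmI : L.finFuture s I ≤ mΩ := iSup₂_le fun r _ => (hm r).comap_le
    have h2 : Indep (L.history s ⊔ L.finFuture s I)
        (MeasurableSpace.comap (fun ω => L.X u ω - L.X v ω) inferInstance) P := by
      refine indep_of_indep_of_le_left (L.indep_history hv hvu)
        (sup_le (L.history_mono hs hsv) (iSup₂_le fun r hr => comap_le_of_measurable ?_))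
      exact (L.measurable_X_history (hs.trans r.2) (hvI r hr)).sub (L.measurable_X_history hs hsv)
    have h3 := indep_sup_right_of_indep (L.history_le hs) hmI
      ((L.measurable_X (hv.trans hvu)).sub (L.measurable_X hv)).comap_le ih h2
    refine indep_of_indep_of_le_right h3 (iSup₂_le fun r hr => ?_)
    rcases Finset.mem_insert.1 hr with rfl | hr
    · refine comap_le_of_measurable ?_
      have : (fun ω => L.X r ω - L.X s ω)
          = fun ω => (L.X v ω - L.X s ω) + (L.X r ω - L.X v ω) := by funext ω; ring
      rw [this]
      exact (hvm.mono le_sup_left le_rfl).add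
        ((comap_measurable (fun ω => L.X r ω - L.X v ω)).mono le_sup_right le_rfl)
    · exact (le_iSup₂_of_le (f := fun r (_ : r ∈ I) =>
        MeasurableSpace.comap (fun ω => L.X r ω - L.X s ω) (inferInstance : MeasurableSpace ℝ))
        r hr le_rfl).trans le_sup_left

end SimpleSemiLevy

namespace SimpleSemiLevy

variable {Ω : Type*} [mΩ : MeasurableSpace Ω] {P : Measure Ω} [IsProbabilityMeasure P]
  (L : SimpleSemiLevy P)

/-! ### Moments of the increments -/

/-- The second moment of a jump that occurs at time `u`. -/
noncomputable def sqAt (u : ℝ) : ℝ := L.jumpSq (L.cellIdx u + 1)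

lemma memLp_mark (n : ℕ) (j : Fin L.l) : MemLp (L.mark n j) 2 P := by
  have hm := L.mark_measurable n j
  rw [memLp_two_iff_integrable_sq hm.aestronglyMeasurable]
  have h := L.F_sq j
  rw [← L.mark_law n j, integrable_map_measure (by fun_prop) hm.aemeasurable] at h
  exact h

lemma integral_mark (n : ℕ) (j : Fin L.l) : ∫ ω, L.mark n j ω ∂P = ∫ z, z ∂(L.F j) := by
  rw [← L.mark_law n j, integral_map (L.mark_measurable n j).aemeasurable (by fun_prop)]

lemma integral_mark_sq (n : ℕ) (j : Fin L.l) :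
    ∫ ω, L.mark n j ω ^ 2 ∂P = ∫ z, z ^ 2 ∂(L.F j) := by
  rw [← L.mark_law n j, integral_map (L.mark_measurable n j).aemeasurable (by fun_prop)]

lemma memLp_markSum (j : Fin L.l) (n k : ℕ) : MemLp (L.markSum j n k) 2 P := by
  unfold markSum
  exact memLp_finsetSum _ fun i _ => L.memLp_mark _ _

lemma integral_markSum (j : Fin L.l) (n k : ℕ) :
    ∫ ω, L.markSum j n k ω ∂P = k * ∫ z, z ∂(L.F j) := by
  simp only [markSum]
  rw [integral_finsetSum _ fun i _ => (L.memLp_mark _ _).integrable one_le_two]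
  simp [L.integral_mark]

lemma integral_markSum_sq (j : Fin L.l) (n k : ℕ) :
    ∫ ω, L.markSum j n k ω ^ 2 ∂P = k * ((∫ z, z ^ 2 ∂(L.F j)) - (∫ z, z ∂(L.F j)) ^ 2)
      + k ^ 2 * (∫ z, z ∂(L.F j)) ^ 2 := by
  have h1 := variance_eq_sub (L.memLp_markSum j n k)
  have h2 : Var[L.markSum j n k; P]
      = k * ((∫ z, z ^ 2 ∂(L.F j)) - (∫ z, z ∂(L.F j)) ^ 2) := by
    have e : L.markSum j n k = ∑ i ∈ Finset.range k, L.mark (n + i) j := by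
      funext ω; simp [markSum]
    rw [e, IndepFun.variance_sum (fun i _ => L.memLp_mark _ _)]
    · have : ∀ i, Var[L.mark (n + i) j; P]
          = (∫ z, z ^ 2 ∂(L.F j)) - (∫ z, z ∂(L.F j)) ^ 2 := by
        intro i
        rw [variance_eq_sub (L.memLp_mark _ _), L.integral_mark]
        simp only [Pi.pow_apply]
        rw [L.integral_mark_sq]
      simp only [this, Finset.sum_const, Finset.card_range, nsmul_eq_mul]
    · intro a _ b _ hab
      exact L.mark_indep.indepFun (i := (n + a, j)) (j := (n + b, j)) (by simpa using hab)
  rw [h2, L.integral_markSum] at h1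
  simp only [Pi.pow_apply] at h1
  rw [mul_pow] at h1
  linarith

lemma measurable_markSum_uncurry (j : Fin L.l) :
    Measurable fun x : ℕ × Ω => L.markSum j 0 x.1 x.2 :=
  measurable_from_prod_countable_right fun c => L.measurable_markSum' _ 0 c

lemma integrable_markSum_sq_prod (j : Fin L.l) (r : ℝ≥0) :
    Integrable (fun x : ℕ × Ω => L.markSum j 0 x.1 x.2 ^ 2) ((poissonMeasure r).prod P) := by
  rw [integrable_prod_iff ((L.measurable_markSum_uncurry j).pow_const 2).aestronglyMeasurable]
  refine ⟨Eventually.of_forall fun c => (L.memLp_markSum j 0 c).integrable_sq, ?_⟩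
  have : (fun c : ℕ => ∫ ω, ‖L.markSum j 0 c ω ^ 2‖ ∂P) = fun c : ℕ =>
      (c : ℝ) * ((∫ z, z ^ 2 ∂(L.F j)) - (∫ z, z ∂(L.F j)) ^ 2)
      + (c : ℝ) ^ 2 * (∫ z, z ∂(L.F j)) ^ 2 := by
    funext c
    rw [← L.integral_markSum_sq j 0 c]
    refine integral_congr_ae (Eventually.of_forall fun ω => ?_)
    exact Real.norm_of_nonneg (sq_nonneg _)
  simp only [this]
  exact ((integrable_id_poissonMeasure r).mul_const _).add
    ((integrable_sq_poissonMeasure r).mul_const _)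

section Cell

variable {k : ℕ} {s t : ℝ} (hs : L.part k ≤ s) (hst : s ≤ t) (ht : t ≤ L.part (k + 1))
include hs hst ht

lemma memLp_X_sub_cell : MemLp (fun ω => L.X t ω - L.X s ω) 2 P := by
  have hs0 := (L.part_nonneg k).trans hs
  have hm := L.measurable_X_sub hs0 (hs0.trans hst)
  rw [memLp_two_iff_integrable_sq hm.aestronglyMeasurable]
  have h := L.integrable_markSum_sq_prod (L.cellType (k + 1)) (L.Λ s t)
  have h' : Integrable (fun x : ℝ => x ^ 2) (P.map fun ω => L.X t ω - L.X s ω) := by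
    rw [L.map_X_sub_cell hs hst ht, integrable_map_measure (by fun_prop)
      (L.measurable_markSum_uncurry _).aemeasurable]
    exact h
  rwa [integrable_map_measure (by fun_prop) hm.aemeasurable] at h'

lemma integral_X_sub_cell :
    ∫ ω, (L.X t ω - L.X s ω) ∂P = L.Λ s t * ∫ z, z ∂(L.F (L.cellType (k + 1))) := by
  have hs0 := (L.part_nonneg k).trans hs
  have hm := L.measurable_X_sub hs0 (hs0.trans hst)
  have hmu := L.measurable_markSum_uncurry (L.cellType (k + 1))
  have hint : Integrable (fun x : ℕ × Ω => L.markSum (L.cellType (k + 1)) 0 x.1 x.2)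
      ((poissonMeasure (L.Λ s t)).prod P) :=
    ((memLp_two_iff_integrable_sq hmu.aestronglyMeasurable).2
      (L.integrable_markSum_sq_prod _ _)).integrable one_le_two
  have e1 : ∫ ω, (L.X t ω - L.X s ω) ∂P = ∫ x, x ∂(P.map fun ω => L.X t ω - L.X s ω) := by
    rw [integral_map hm.aemeasurable (by fun_prop)]
  rw [e1, L.map_X_sub_cell hs hst ht, integral_map hmu.aemeasurable (by fun_prop),
    integral_prod _ hint]
  simp only [L.integral_markSum]
  rw [integral_mul_const, integral_id_poissonMeasure]

lemma integral_X_sub_sq_cell :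
    ∫ ω, (L.X t ω - L.X s ω) ^ 2 ∂P = L.Λ s t * L.jumpSq (k + 1)
      + (L.Λ s t * ∫ z, z ∂(L.F (L.cellType (k + 1)))) ^ 2 := by
  have hs0 := (L.part_nonneg k).trans hs
  have hm := L.measurable_X_sub hs0 (hs0.trans hst)
  have hmu := L.measurable_markSum_uncurry (L.cellType (k + 1))
  have e1 : ∫ ω, (L.X t ω - L.X s ω) ^ 2 ∂P
      = ∫ x, x ^ 2 ∂(P.map fun ω => L.X t ω - L.X s ω) := by
    rw [integral_map hm.aemeasurable (by fun_prop)]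
  rw [e1, L.map_X_sub_cell hs hst ht, integral_map hmu.aemeasurable (by fun_prop),
    integral_prod _ (L.integrable_markSum_sq_prod _ _)]
  simp only [L.integral_markSum_sq]
  rw [integral_add ((integrable_id_poissonMeasure _).mul_const _)
    ((integrable_sq_poissonMeasure _).mul_const _), integral_mul_const, integral_mul_const,
    integral_id_poissonMeasure, integral_sq_poissonMeasure, jumpSq]
  ring

/-- The mixture over the number of jumps is spelled out so that the term with a single jump can be
isolated later. -/
lemma lintegral_X_sub_cell {g : ℝ → ℝ≥0∞} (hg : Measurable g) :
    ∫⁻ ω, g (L.X t ω - L.X s ω) ∂P = ∑' c, (∫⁻ ω, g (L.markSum (L.cellType (k + 1)) 0 c ω) ∂P)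
      * poissonMeasure (L.Λ s t) {c} := by
  have hs0 := (L.part_nonneg k).trans hs
  have hm := L.measurable_X_sub hs0 (hs0.trans hst)
  have hmu := L.measurable_markSum_uncurry (L.cellType (k + 1))
  have e1 : ∫⁻ ω, g (L.X t ω - L.X s ω) ∂P = ∫⁻ x, g x ∂(P.map fun ω => L.X t ω - L.X s ω) := by
    rw [lintegral_map hg hm]
  have hg' : AEMeasurable (fun x : ℕ × Ω => g (L.markSum (L.cellType (k + 1)) 0 x.1 x.2))
      ((poissonMeasure (L.Λ s t)).prod P) := (hg.comp hmu).aemeasurable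
  rw [e1, L.map_X_sub_cell hs hst ht, lintegral_map hg hmu, lintegral_prod _ hg',
    lintegral_countable']

/-- Only the open interval is available: t may be the end of the cell, which already belongs to the
next one. -/
lemma sqAt_eqOn : Set.EqOn (fun u => L.sqAt u * L.rate u)
    (fun u => L.jumpSq (k + 1) * L.rate u) (Set.uIoo s t) := by
  intro u hu
  rw [Set.uIoo_of_le hst] at hu
  simp only [sqAt, L.cellIdx_eq ⟨hs.trans hu.1.le, hu.2.trans_le ht⟩]

end Cell

lemma memLp_X_sub {s t : ℝ} (hs : 0 ≤ s) (hst : s ≤ t) :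
    MemLp (fun ω => L.X t ω - L.X s ω) 2 P := by
  refine L.interval_induction (Q := fun s t => MemLp (fun ω => L.X t ω - L.X s ω) 2 P)
    (fun k s t h1 h2 h3 => L.memLp_X_sub_cell h1 h2 h3) (fun s u t _ _ _ h1 h2 => ?_) hs hst
  have := h1.add h2
  refine this.ae_eq (Eventually.of_forall fun ω => ?_)
  simp only [Pi.add_apply]; ring

lemma X_zero (ω : Ω) : L.X 0 ω = 0 := by simp [X, L.poisson.zero]

lemma memLp_X {t : ℝ} (ht : 0 ≤ t) : MemLp (L.X t) 2 P := by
  have := L.memLp_X_sub le_rfl ht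
  simpa [L.X_zero] using this

lemma sqAt_rate_intervalIntegrable {s t : ℝ} (hs : 0 ≤ s) (hst : s ≤ t) :
    IntervalIntegrable (fun u => L.sqAt u * L.rate u) volume s t := by
  refine L.interval_induction
    (Q := fun s t => IntervalIntegrable (fun u => L.sqAt u * L.rate u) volume s t)
    (fun k s t h1 h2 h3 => ?_) (fun s u t _ _ _ h1 h2 => h1.trans h2) hs hst
  have hs0 := (L.part_nonneg k).trans h1
  exact ((L.rate_intervalIntegrable hs0 (hs0.trans h2)).const_mul _).congr_uIoo
    (L.sqAt_eqOn h1 h2 h3).symm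

lemma measurable_S {t : ℝ} (ht : 0 ≤ t) : Measurable (L.S t) :=
  (L.measurable_X ht).const_add (L.drift t)

lemma S_sub_S (s t : ℝ) (ω : Ω) :
    L.S t ω - L.S s ω = (L.drift t - L.drift s) + (L.X t ω - L.X s ω) := by
  rw [S_eq, S_eq]; ring

lemma memLp_S {t : ℝ} (ht : 0 ≤ t) : MemLp (L.S t) 2 P :=
  (memLp_const (L.drift t)).add (L.memLp_X ht)

lemma memLp_S_sub {s t : ℝ} (hs : 0 ≤ s) (hst : s ≤ t) :
    MemLp (fun ω => L.S t ω - L.S s ω) 2 P :=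
  (L.memLp_S (hs.trans hst)).sub (L.memLp_S hs)

lemma indepFun_S_sub {s t : ℝ} (hs : 0 ≤ s) (hst : s ≤ t) {f : Ω → ℝ}
    (hf : Measurable[L.history s] f) : IndepFun f (fun ω => L.S t ω - L.S s ω) P := by
  rw [IndepFun_iff_Indep]
  refine indep_of_indep_of_le (L.indep_history hs hst) (measurable_iff_comap_le.1 hf)
    (comap_le_of_measurable ?_)
  simp only [S_sub_S]
  exact (comap_measurable (fun ω => L.X t ω - L.X s ω)).const_add _

section Centred

variable (hmean : ∀ t, 0 ≤ t → ∫ ω, L.S t ω ∂P = 0)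
include hmean

lemma integral_S_sub {s t : ℝ} (hs : 0 ≤ s) (hst : s ≤ t) :
    ∫ ω, (L.S t ω - L.S s ω) ∂P = 0 := by
  rw [integral_sub ((L.memLp_S (hs.trans hst)).integrable one_le_two)
    ((L.memLp_S hs).integrable one_le_two), hmean t (hs.trans hst), hmean s hs, sub_zero]

/-- Within a cell, centring says that the drift increment is minus the mean of the jump sum. The
square is thus the variance of a compound Poisson variable, its mean number of jumps times E Z².
Across cells the mixed term vanishes by independence and centring. -/
lemma integral_S_sub_sq {s t : ℝ} (hs : 0 ≤ s) (hst : s ≤ t) :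
    ∫ ω, (L.S t ω - L.S s ω) ^ 2 ∂P = ∫ u in s..t, L.sqAt u * L.rate u := by
  refine L.interval_induction (Q := fun s t =>
    ∫ ω, (L.S t ω - L.S s ω) ^ 2 ∂P = ∫ u in s..t, L.sqAt u * L.rate u)
    (fun k s t h1 h2 h3 => ?_) (fun s u t hs hsu hut h1 h2 => ?_) hs hst
  · have hs0 := (L.part_nonneg k).trans h1
    have hL2 := L.memLp_X_sub_cell h1 h2 h3
    have hi := hL2.integrable one_le_two
    have hm := L.integral_S_sub hmean hs0 h2
    simp only [S_sub_S] at hm ⊢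
    set δ := L.drift t - L.drift s
    rw [integral_add (integrable_const _) hi, integral_const, L.integral_X_sub_cell h1 h2 h3] at hm
    simp only [probReal_univ, one_smul] at hm
    have e : ∀ ω, (δ + (L.X t ω - L.X s ω)) ^ 2
        = δ ^ 2 + (2 * δ * (L.X t ω - L.X s ω) + (L.X t ω - L.X s ω) ^ 2) := fun ω => by ring
    simp only [e]
    have hi2 : Integrable (fun ω => 2 * δ * (L.X t ω - L.X s ω) + (L.X t ω - L.X s ω) ^ 2) P :=
      (hi.const_mul _).add hL2.integrable_sq
    rw [integral_add (integrable_const _) hi2,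
      integral_add (hi.const_mul _) hL2.integrable_sq, integral_const, integral_const_mul,
      L.integral_X_sub_cell h1 h2 h3, L.integral_X_sub_sq_cell h1 h2 h3,
      intervalIntegral.integral_congr_uIoo (L.sqAt_eqOn h1 h2 h3),
      intervalIntegral.integral_const_mul, ← L.coe_Λ hs0 h2]
    simp only [probReal_univ, one_smul]
    have e2 : (L.Λ s t : ℝ) * ∫ z, z ∂(L.F (L.cellType (k + 1))) = -δ := by linarith
    rw [e2]; ring
  · have hu := hs.trans hsu
    have hA := L.memLp_S_sub hs hsu
    have hB := L.memLp_S_sub hu hut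
    have hind := L.indepFun_S_sub hu hut (f := fun ω => L.S u ω - L.S s ω) (by
      simp only [S_sub_S]
      exact ((L.measurable_X_history hu le_rfl).sub (L.measurable_X_history hs hsu)).const_add _)
    have e : ∀ ω, (L.S t ω - L.S s ω) ^ 2 = (L.S u ω - L.S s ω) ^ 2
        + (2 * ((L.S u ω - L.S s ω) * (L.S t ω - L.S u ω)) + (L.S t ω - L.S u ω) ^ 2) :=
      fun ω => by ring
    have hAB : Integrable (fun ω => (L.S u ω - L.S s ω) * (L.S t ω - L.S u ω)) P :=
      hA.integrable_mul hB
    have hAB2 : Integrable (fun ω => 2 * ((L.S u ω - L.S s ω) * (L.S t ω - L.S u ω))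
        + (L.S t ω - L.S u ω) ^ 2) P := (hAB.const_mul 2).add hB.integrable_sq
    simp only [e]
    rw [integral_add hA.integrable_sq hAB2,
      integral_add (hAB.const_mul 2) hB.integrable_sq, integral_const_mul,
      hind.integral_fun_mul_eq_mul_integral hA.aestronglyMeasurable hB.aestronglyMeasurable,
      L.integral_S_sub hmean hs hsu, h1, h2, ← intervalIntegral.integral_add_adjacent_intervals
        (L.sqAt_rate_intervalIntegrable hs hsu) (L.sqAt_rate_intervalIntegrable hu hut)]
    ring

end Centred

/-! ### Products over the jumps -/

/-- Almost surely, up to time `t` jumps occur only in cells of the types in `K`. -/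
def Charges (K : Finset (Fin L.l)) : Prop :=
  ∀ᵐ ω ∂P, ∀ n t, 0 ≤ t → n < L.N t ω → ∃ j ∈ K, L.jump n ω = L.mark n j ω

lemma exists_jump_eq_mark {n : ℕ} {t : ℝ} (ht : 0 ≤ t) {ω : Ω} (h : n < L.N t ω) :
    L.jump n ω = L.mark n (L.cellType (L.cellIdx (L.arrival n ω) + 1)) ω :=
  L.jump_eq (L.mem_cellIdx ((L.isCountingPath ω).arr_spec ht h).1)

lemma charges_univ : L.Charges Finset.univ :=
  Eventually.of_forall fun _ _ _ ht h =>
    ⟨_, Finset.mem_univ _, L.exists_jump_eq_mark ht h⟩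

lemma measurable_indicator_one {Ω' : Type*} {m : MeasurableSpace Ω'} {A : Set Ω'}
    (hA : MeasurableSet A) : Measurable (A.indicator (1 : Ω' → ℝ≥0∞)) :=
  measurable_one.indicator hA

lemma measurable_sum_comp {Ω' : Type*} {m : MeasurableSpace Ω'} {f : ℝ → ℝ≥0∞} (hf : Measurable f)
    {l : ℕ} (K : Finset (Fin l)) {g : Fin l → Ω' → ℝ} (hg : ∀ j, Measurable (g j)) :
    Measurable fun ω => ∑ j ∈ K, f (g j ω) :=
  Finset.measurable_sum _ fun j _ => hf.comp (hg j)

lemma lintegral_prod_marks {f : ℝ → ℝ≥0∞} (hf : Measurable f) (K : Finset (Fin L.l)) (n : ℕ) :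
    ∫⁻ ω, ∏ i ∈ Finset.range n, ∑ j ∈ K, f (L.mark i j ω) ∂P
      = (∑ j ∈ K, ∫⁻ z, f z ∂(L.F j)) ^ n := by
  induction n with
  | zero => simp
  | succ n ih =>
    simp only [Finset.prod_range_succ]
    have e := lintegral_mul_eq_lintegral_mul_lintegral_of_independent_measurableSpace
      (L.markPast_le n) (L.markFuture_le n) (L.indep_mark n)
      (f := fun ω => ∏ i ∈ Finset.range n, ∑ j ∈ K, f (L.mark i j ω))
      (g := fun ω => ∑ j ∈ K, f (L.mark n j ω))
      (Finset.measurable_prod _ fun i hi => measurable_sum_comp hf K fun j =>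
        L.measurable_markPast (Finset.mem_range.1 hi) j)
      (measurable_sum_comp hf K fun j => L.measurable_markFuture le_rfl j)
    have hfm : ∀ j ∈ K, Measurable fun ω => f (L.mark n j ω) :=
      fun j _ => hf.comp (L.mark_measurable n j)
    rw [e, ih, pow_succ, lintegral_finsetSum _ hfm]
    congr 1
    refine Finset.sum_congr rfl fun j _ => ?_
    rw [← L.mark_law n j, lintegral_map hf (L.mark_measurable n j)]

/-- The type of a jump depends on its arrival time, hence on N. Bounding `f` of the jump by the sum
`ξ` of `f` over all candidate marks with type in `K` removes this dependence. Given N(t) = k the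
mean is then κ^k, which is summable against a Poisson law. -/
lemma lintegral_prod_jumps_lt_top {f : ℝ → ℝ≥0∞} (hf : Measurable f) {K : Finset (Fin L.l)}
    (hK : L.Charges K) (hfin : ∀ j ∈ K, ∫⁻ z, f z ∂(L.F j) < ∞) {t : ℝ} (ht : 0 ≤ t) :
    ∫⁻ ω, ∏ n ∈ Finset.range (L.N t ω), f (L.jump n ω) ∂P < ∞ := by
  set ξ : ℕ → Ω → ℝ≥0∞ := fun i ω => ∑ j ∈ K, f (L.mark i j ω)
  have hξ : ∀ i, Measurable (ξ i) := fun i =>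
    Finset.measurable_sum _ fun j _ => hf.comp (L.mark_measurable i j)
  set κ := ∑ j ∈ K, ∫⁻ z, f z ∂(L.F j)
  have hκ : κ ≠ ∞ := (ENNReal.sum_lt_top.2 hfin).ne
  have hle : ∫⁻ ω, ∏ n ∈ Finset.range (L.N t ω), f (L.jump n ω) ∂P
      ≤ ∫⁻ ω, ∏ n ∈ Finset.range (L.N t ω), ξ n ω ∂P := by
    refine lintegral_mono_ae ?_
    filter_upwards [hK] with ω hω
    refine Finset.prod_le_prod' fun n hn => ?_
    obtain ⟨j, hj, hjump⟩ := hω n t ht (Finset.mem_range.1 hn)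
    rw [hjump]
    exact Finset.single_le_sum (f := fun j => f (L.mark n j ω)) (fun _ _ => zero_le) hj
  refine lt_of_le_of_lt hle ?_
  have hN := L.poisson.measurable t ht
  have hsum : ∀ ω, ∏ n ∈ Finset.range (L.N t ω), ξ n ω
      = ∑' k, (L.N t ⁻¹' {k}).indicator 1 ω * ∏ n ∈ Finset.range k, ξ n ω := by
    intro ω
    rw [tsum_eq_single (L.N t ω)]
    · simp
    · intro k hk
      rw [Set.indicator_of_notMem (by simpa using hk.symm), zero_mul]
  simp only [hsum]
  have hmeas : ∀ k, AEMeasurable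
      (fun ω => (L.N t ⁻¹' {k}).indicator 1 ω * ∏ n ∈ Finset.range k, ξ n ω) P := fun k =>
    ((measurable_one.indicator (hN (measurableSet_singleton k))).mul
      (Finset.measurable_prod _ fun n _ => hξ n)).aemeasurable
  rw [lintegral_tsum hmeas]
  have hk : ∀ k, ∫⁻ ω, (L.N t ⁻¹' {k}).indicator 1 ω * ∏ n ∈ Finset.range k, ξ n ω ∂P
      = κ ^ k * poissonMeasure (L.Λ 0 t) {k} := by
    intro k
    have hA : MeasurableSet[⨆ t : ℝ≥0, MeasurableSpace.comap (L.N (t : ℝ)) inferInstance]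
        (L.N t ⁻¹' {k}) :=
      (le_iSup (fun t : ℝ≥0 => MeasurableSpace.comap (L.N (t : ℝ)) inferInstance) ⟨t, ht⟩) _
        ⟨{k}, measurableSet_singleton k, rfl⟩
    have e := lintegral_mul_eq_lintegral_mul_lintegral_of_independent_measurableSpace
      (iSup_le fun t : ℝ≥0 => (L.poisson.measurable t t.2).comap_le)
      (iSup_le fun x : ℕ × Fin L.l => (L.mark_measurable x.1 x.2).comap_le) L.mark_indep_N.symm
      (f := (L.N t ⁻¹' {k}).indicator 1) (g := fun ω => ∏ n ∈ Finset.range k, ξ n ω)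
      (measurable_indicator_one hA)
      (Finset.measurable_prod _ fun i _ => Finset.measurable_sum _ fun j _ =>
        hf.comp (measurable_iff_comap_le.2 (le_iSup (fun x : ℕ × Fin L.l =>
          MeasurableSpace.comap (L.mark x.1 x.2) inferInstance) (i, j))))
    rw [e, L.lintegral_prod_marks hf, lintegral_indicator_one (hN (measurableSet_singleton k)),
      mul_comm, ← L.measure_count_eq le_rfl ht]
    simp only [L.poisson.zero, Nat.sub_zero]
    rfl
  simp only [hk]
  rw [← lintegral_countable']
  exact lintegral_pow_poissonMeasure_lt_top _ hκ

/-- The cell types with positive intensity. -/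
noncomputable def positiveTypes : Finset (Fin L.l) := by
  classical
  exact Finset.univ.filter fun j => ∃ k, L.cellType (k + 1) = j ∧
    0 < L.Λ (L.part k) (L.part (k + 1))

lemma mem_positiveTypes {j : Fin L.l} : j ∈ L.positiveTypes ↔
    ∃ k, L.cellType (k + 1) = j ∧ 0 < L.Λ (L.part k) (L.part (k + 1)) := by
  classical
  simp [positiveTypes]

/-- A cell of zero intensity almost surely contains no jump. Excluding arrivals at the partition
points lets the count over (t_k, t_{k+1}] speak for the cell [t_k, t_{k+1}). -/
lemma charges_positiveTypes : L.Charges L.positiveTypes := by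
  have h1 : ∀ᵐ ω ∂P, ∀ k, L.Λ (L.part k) (L.part (k + 1)) = 0 →
      L.N (L.part (k + 1)) ω - L.N (L.part k) ω = 0 := by
    rw [ae_all_iff]
    intro k
    by_cases hk : L.Λ (L.part k) (L.part (k + 1)) = 0
    · have hle : L.part k ≤ L.part (k + 1) := (L.part_strictMono k.lt_succ_self).le
      have h := L.measure_count_eq (L.part_nonneg k) hle 0
      rw [hk, poissonMeasure_singleton] at h
      have h' : ∀ᵐ ω ∂P, ω ∈ (fun ω => L.N (L.part (k + 1)) ω - L.N (L.part k) ω) ⁻¹' {0} := by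
        refine (mem_ae_iff_prob_eq_one₀
          ((L.measurable_count (L.part_nonneg k) (L.part_nonneg (k + 1)))
            (measurableSet_singleton 0)).nullMeasurableSet).2 ?_
        rw [h]; simp
      filter_upwards [h'] with ω hω _ using hω
    · exact Eventually.of_forall fun ω h => absurd h hk
  have h2 : ∀ᵐ ω ∂P, ∀ k, 0 < L.part k → ∀ n T, 0 ≤ T → n < L.N T ω →
      L.arrival n ω ≠ L.part k := by
    rw [ae_all_iff]
    intro k
    by_cases hk : 0 < L.part k
    · filter_upwards [L.ae_arrival_ne hk] with ω hω _ using hω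
    · exact Eventually.of_forall fun ω h => absurd h hk
  filter_upwards [h1, h2] with ω h1 h2 n t ht hn
  have hc := L.isCountingPath ω
  have ha := hc.arr_spec ht hn
  refine ⟨_, ?_, L.exists_jump_eq_mark ht hn⟩
  rw [mem_positiveTypes]
  set k := L.cellIdx (L.arrival n ω)
  refine ⟨k, rfl, pos_iff_ne_zero.2 fun h0 => ?_⟩
  have hmem : L.arrival n ω ∈ Set.Ico (L.part k) (L.part (k + 1)) := L.mem_cellIdx ha.1
  have hlt : L.part k < L.arrival n ω := by
    refine lt_of_le_of_ne hmem.1 fun heq => ?_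
    have hpos : 0 < L.arrival n ω := hc.arr_pos ht hn
    exact h2 k (by rw [heq]; exact hpos) n t ht hn heq.symm
  have h3 := (hc.lt_arr_iff (L.part_nonneg k) ht hn).1 hlt
  have h4 := (hc.arr_le_iff (L.part_nonneg (k + 1)) ht hn).1 hmem.2.le
  have := h1 k h0
  omega

/-- A cell of positive intensity holds exactly one jump with positive probability. The corresponding
term of the mixture is E Z⁴ times that probability, and it is at most the fourth moment of the
increment of X. For a type that never occurs, the moments of S give no such information. -/
lemma lintegral_pow_four_lt_top (h4 : ∀ s, 0 ≤ s → Integrable (fun ω => L.S s ω ^ 4) P)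
    {j : Fin L.l} (hj : j ∈ L.positiveTypes) : ∫⁻ z, ENNReal.ofReal (z ^ 4) ∂(L.F j) < ∞ := by
  obtain ⟨k, rfl, hk⟩ := L.mem_positiveTypes.1 hj
  set s := L.part k
  set t := L.part (k + 1)
  have hs : 0 ≤ s := L.part_nonneg k
  have hst : s ≤ t := (L.part_strictMono k.lt_succ_self).le
  have ht := hs.trans hst
  set δ := L.drift t - L.drift s
  have hint : Integrable (fun ω => (L.X t ω - L.X s ω) ^ 4) P := by
    -- The constants come from using (a − b)⁴ ≤ 8(a⁴ + b⁴) twice, once to split off the drift and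
    -- once to separate S_t from S_s.
    refine (((h4 t ht).const_mul 64).add (((h4 s hs).const_mul 64).add
      (integrable_const (8 * δ ^ 4)))).mono'
      ((L.measurable_X_sub hs ht).pow_const 4).aestronglyMeasurable
      (Eventually.of_forall fun ω => ?_)
    have e : L.X t ω - L.X s ω = (L.S t ω - L.S s ω) - δ := by rw [S_sub_S]; ring
    have key : ∀ a b : ℝ, (a - b) ^ 4 ≤ 8 * (a ^ 4 + b ^ 4) := fun a b => by
      nlinarith [sq_nonneg (a + b), sq_nonneg (a - b), sq_nonneg (a ^ 2 - b ^ 2),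
        sq_nonneg ((a + b) ^ 2), mul_nonneg (sq_nonneg (a + b)) (sq_nonneg (a - b)),
        sq_nonneg ((a + b) ^ 2 - (a - b) ^ 2), sq_nonneg (a + b)]
    rw [Real.norm_of_nonneg (by positivity), e]
    have k1 := key (L.S t ω - L.S s ω) δ
    have k2 := key (L.S t ω) (L.S s ω)
    simp only [Pi.add_apply]
    linarith
  have hfin : ∫⁻ ω, ENNReal.ofReal ((L.X t ω - L.X s ω) ^ 4) ∂P < ∞ := by
    have := hint.2
    rw [hasFiniteIntegral_iff_ofReal (Eventually.of_forall fun ω => by positivity)] at this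
    exact this
  rw [L.lintegral_X_sub_cell le_rfl hst le_rfl (g := fun x => ENNReal.ofReal (x ^ 4))
    (by fun_prop)] at hfin
  have hone := (ENNReal.le_tsum 1).trans_lt hfin
  have hp : poissonMeasure (L.Λ s t) {1} ≠ 0 := by
    rw [poissonMeasure_singleton]
    have : 0 < (L.Λ s t : ℝ) := hk
    simp only [ne_eq, ENNReal.ofReal_eq_zero, not_le]
    positivity
  have hfin1 := (ENNReal.lt_top_of_mul_ne_top_left hone.ne hp)
  refine lt_of_eq_of_lt ?_ hfin1
  simp only [markSum, Finset.sum_range_one, Nat.add_zero]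
  rw [← L.mark_law 0, lintegral_map (by fun_prop) (L.mark_measurable _ _)]

end SimpleSemiLevy

/-! ### Boundedness of càdlàg paths -/

section Regulated

variable {E : Type*} [NormedAddCommGroup E]

lemma Tendsto.exists_norm_le {l : Filter ℝ} {y : ℝ → E} {v : E} (h : Tendsto y l (𝓝 v)) :
    ∃ K, ∀ᶠ r in l, ‖y r‖ ≤ K :=
  ⟨‖v‖ + 1, h.norm.eventually (Iic_mem_nhds (by linarith))⟩

/-- A path that is right continuous with left limits is bounded on compact intervals. -/
lemma exists_bound_of_cadlag {y : ℝ → E} {s t : ℝ}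
    (hr : ∀ u, s ≤ u → ContinuousWithinAt y (Set.Ici u) u)
    (hl : ∀ u, s < u → ∃ v, Tendsto y (𝓝[<] u) (𝓝 v)) : ∃ K, ∀ u ∈ Set.Icc s t, ‖y u‖ ≤ K := by
  refine isCompact_Icc.induction_on (p := fun S => ∃ K, ∀ u ∈ S, ‖y u‖ ≤ K) ⟨0, by simp⟩
    (fun A B hAB ⟨K, hK⟩ => ⟨K, fun u hu => hK u (hAB hu)⟩) ?_ fun x hx => ?_
  · rintro A B ⟨K, hK⟩ ⟨K', hK'⟩
    refine ⟨max K K', fun u hu => ?_⟩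
    rcases hu with hu | hu
    · exact (hK u hu).trans (le_max_left _ _)
    · exact (hK' u hu).trans (le_max_right _ _)
  · obtain ⟨K, hK⟩ := Tendsto.exists_norm_le (hr x hx.1).tendsto
    rcases hx.1.eq_or_lt with rfl | hsx
    · exact ⟨{r | ‖y r‖ ≤ K}, nhdsWithin_mono _ Set.Icc_subset_Ici_self hK, K, fun u hu => hu⟩
    · obtain ⟨v, hv⟩ := hl x hsx
      obtain ⟨K', hK'⟩ := Tendsto.exists_norm_le hv
      refine ⟨{r | ‖y r‖ ≤ max K K'}, mem_nhdsWithin_of_mem_nhds ?_, _, fun u hu => hu⟩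
      rw [← nhdsLT_sup_nhdsGE]
      refine mem_sup.2 ⟨?_, ?_⟩
      · filter_upwards [hK'] with r hr using hr.trans (le_max_right _ _)
      · filter_upwards [hK] with r hr using hr.trans (le_max_left _ _)

end Regulated

/-! ### Derivative of the matrix exponential -/

section MatrixExp

variable {q : ℕ}

open scoped Matrix.Norms.Operator in
lemma hasDerivAt_exp_mulVec (B : Matrix (Fin q) (Fin q) ℝ) (τ u : ℝ) (w : Fin q → ℝ) :
    HasDerivAt (fun u : ℝ => NormedSpace.exp ((u - τ) • B) *ᵥ w)
      (B *ᵥ (NormedSpace.exp ((u - τ) • B) *ᵥ w)) u := by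
  have h1 := hasDerivAt_exp_smul_const' (𝕂 := ℝ) B (u - τ)
  have h2 : HasDerivAt (fun u : ℝ => NormedSpace.exp ((u - τ) • B))
      (B * NormedSpace.exp ((u - τ) • B)) u := by
    exact h1.comp_sub_const u τ
  let φ : Matrix (Fin q) (Fin q) ℝ →ₗ[ℝ] (Fin q → ℝ) :=
    { toFun := fun M => M *ᵥ w
      map_add' := fun M M' => Matrix.add_mulVec M M' w
      map_smul' := fun r M => Matrix.smul_mulVec r M w }
  have h3 := (LinearMap.toContinuousLinearMap φ).hasFDerivAt.comp_hasDerivAt u h2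
  have e : B *ᵥ (NormedSpace.exp ((u - τ) • B) *ᵥ w)
      = LinearMap.toContinuousLinearMap φ (B * NormedSpace.exp ((u - τ) • B)) := by
    simp [φ, Matrix.mulVec_mulVec]
  rw [e]
  exact h3

end MatrixExp

/-! ### The random matrix J as a flow of the homogeneous state equation -/

namespace Params

variable {p q : ℕ} (C : Params p q)

/-- The drift matrix as a continuous linear map. -/
noncomputable def Bc : (Fin q → ℝ) →L[ℝ] (Fin q → ℝ) :=
  LinearMap.toContinuousLinearMap C.B.mulVecLin

/-- The linear functional `y ↦ a' y`. -/
noncomputable def al : (Fin q → ℝ) →L[ℝ] ℝ :=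
  ∑ k, C.a k • ContinuousLinearMap.proj k

@[simp] lemma Bc_apply (v : Fin q → ℝ) : C.Bc v = C.B *ᵥ v := rfl

@[simp] lemma al_apply (v : Fin q → ℝ) : C.al v = C.a ⬝ᵥ v := by
  simp [al, dotProduct]

variable {Ω : Type*} [mΩ : MeasurableSpace Ω] {P : Measure Ω} (L : SimpleSemiLevy P)

section Flow

variable {s : ℝ} (ω : Ω) (v : Fin q → ℝ)

/-- The state after `k` jumps, transported to time `u` without further jumps. -/
noncomputable def flowPiece (s : ℝ) (k : ℕ) (u : ℝ) : Fin q → ℝ :=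
  NormedSpace.exp ((u - jumpTime L s ω k) • C.B) *ᵥ (C.jumpFlow L s ω k *ᵥ v)

lemma J_mulVec (u : ℝ) :
    C.J L s u ω *ᵥ v = C.flowPiece L ω v s (L.N u ω - L.N s ω) u := by
  simp [J, flowPiece, Matrix.mulVec_mulVec]

lemma hasDerivAt_flowPiece (k : ℕ) (u : ℝ) :
    HasDerivAt (C.flowPiece L ω v s k) (C.B *ᵥ C.flowPiece L ω v s k u) u :=
  hasDerivAt_exp_mulVec _ _ _ _

/-- A new piece starts at the jump time with exponential equal to 1, so the transition is
multiplication by I + Z² e a'. -/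
lemma flowPiece_succ (k : ℕ) :
    C.flowPiece L ω v s (k + 1) (L.arrival (L.N s ω + k) ω)
      = C.flowPiece L ω v s k (L.arrival (L.N s ω + k) ω)
        + (L.jump (L.N s ω + k) ω ^ 2 *
          (C.a ⬝ᵥ C.flowPiece L ω v s k (L.arrival (L.N s ω + k) ω))) • C.e := by
  have h1 : jumpTime L s ω (k + 1) = L.arrival (L.N s ω + k) ω := rfl
  simp only [flowPiece, h1, sub_self, zero_smul, NormedSpace.exp_zero, Matrix.one_mulVec, jumpFlow]
  rw [← Matrix.mulVec_mulVec, ← Matrix.mulVec_mulVec, Matrix.add_mulVec, Matrix.one_mulVec,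
    Matrix.smul_mulVec, Matrix.vecMulVec_mulVec]
  congr 1
  rw [mul_smul]
  simp

variable (hs : 0 ≤ s)
include hs

lemma J_right {u : ℝ} (hu : s ≤ u) : ∃ r, u < r ∧ ∀ x ∈ Set.Ico u r, L.N x ω = L.N u ω ∧
    C.J L s x ω *ᵥ v = C.flowPiece L ω v s (L.N u ω - L.N s ω) x := by
  obtain ⟨r, hr, h⟩ := (L.isCountingPath ω).exists_right_const (hs.trans hu)
  refine ⟨r, hr, fun x hx => ?_⟩
  have := h x hx.1 hx.2
  exact ⟨this, by rw [J_mulVec, this]⟩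

lemma J_left {u : ℝ} (hu : s < u) : ∃ r, s ≤ r ∧ r < u ∧ (∀ x ∈ Set.Ico r u, L.N x ω = L.N r ω ∧
      C.J L s x ω *ᵥ v = C.flowPiece L ω v s (L.N r ω - L.N s ω) x) ∧
    ((L.N u ω = L.N r ω ∧ C.J L s u ω *ᵥ v = C.flowPiece L ω v s (L.N r ω - L.N s ω) u) ∨
      (L.N u ω = L.N r ω + 1 ∧ L.arrival (L.N r ω) ω = u ∧
        C.J L s u ω *ᵥ v = C.flowPiece L ω v s (L.N r ω - L.N s ω) u
        + (L.jump (L.N r ω) ω ^ 2 *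
          (C.a ⬝ᵥ C.flowPiece L ω v s (L.N r ω - L.N s ω) u)) • C.e)) := by
  have hc := L.isCountingPath ω
  obtain ⟨r, hr0, hru, hconst, hle⟩ := hc.exists_left_const (hs.trans_lt hu)
  set r' := max r s
  have hr'u : r' < u := max_lt hru hu
  have hr' : L.N r' ω = L.N r ω := hconst _ (le_max_left _ _) hr'u
  have hNs : L.N s ω ≤ L.N r' ω := L.poisson.mono ω s r' hs (le_max_right _ _)
  have hNu : L.N r' ω ≤ L.N u ω :=
    L.poisson.mono ω r' u (hs.trans (le_max_right _ _)) hr'u.le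
  have hconst' : ∀ x ∈ Set.Ico r' u, L.N x ω = L.N r' ω := fun x hx => by
    rw [hr']; exact hconst x ((le_max_left _ _).trans hx.1) hx.2
  refine ⟨r', le_max_right _ _, hr'u, fun x hx => ⟨hconst' x hx, ?_⟩, ?_⟩
  · rw [J_mulVec, hconst' x hx]
  · rcases hNu.eq_or_lt with h | h
    · left
      exact ⟨h.symm, by rw [J_mulVec, h]⟩
    · right
      have hN : L.N u ω = L.N r' ω + 1 := by
        have : L.N u ω ≤ L.N r ω + 1 := hle
        omega
      have harr : L.arrival (L.N r' ω) ω = u :=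
        hc.exists_arr_of_lt (hs.trans (le_max_right _ _)) hr'u
          (fun x h1 h2 => hconst' x ⟨h1, h2⟩) h
      refine ⟨hN, harr, ?_⟩
      have hk : L.N u ω - L.N s ω = (L.N r' ω - L.N s ω) + 1 := by omega
      have hk2 : L.N s ω + (L.N r' ω - L.N s ω) = L.N r' ω := by omega
      have := C.flowPiece_succ L (s := s) ω v (L.N r' ω - L.N s ω)
      rw [hk2, harr] at this
      rw [J_mulVec, hk, this]

lemma J_right_cont {u : ℝ} (hu : s ≤ u) :
    ContinuousWithinAt (fun x => C.J L s x ω *ᵥ v) (Set.Ici u) u := by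
  obtain ⟨r, hr, h⟩ := C.J_right L ω v hs hu
  refine ((C.hasDerivAt_flowPiece L ω v _ u).continuousAt.continuousWithinAt).congr_of_eventuallyEq
    ?_ (h u ⟨le_rfl, hr⟩).2
  filter_upwards [Ico_mem_nhdsGE hr] with x hx using (h x hx).2

lemma J_left_lim {u : ℝ} {r : ℝ} (hr : r < u) {k : ℕ}
    (h : ∀ x ∈ Set.Ico r u, C.J L s x ω *ᵥ v = C.flowPiece L ω v s k x) :
    Tendsto (fun x => C.J L s x ω *ᵥ v) (𝓝[<] u) (𝓝 (C.flowPiece L ω v s k u)) := by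
  refine ((C.hasDerivAt_flowPiece L ω v k u).continuousAt.tendsto.mono_left
    nhdsWithin_le_nhds).congr' ?_
  filter_upwards [Ico_mem_nhdsLT hr] with x hx using (h x hx).symm

/-- The columns of `J` solve the homogeneous state equation. -/
lemma isSolution_J {t : ℝ} (hst : s ≤ t) :
    IsSolution C.Bc C.al C.e 0 (fun u => L.N u ω) (fun n => L.jump n ω) s t
      (fun u => C.J L s u ω *ᵥ v) (Function.leftLim fun u => C.J L s u ω *ᵥ v) := by
  set y : ℝ → Fin q → ℝ := fun u => C.J L s u ω *ᵥ v with hy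
  have hc := L.isCountingPath ω
  have hlim : ∀ u, s < u → ∃ ℓ, Tendsto y (𝓝[<] u) (𝓝 ℓ) := fun u hu => by
    obtain ⟨r, _, hr, h, _⟩ := C.J_left L ω v hs hu
    exact ⟨_, C.J_left_lim L ω v hs hr fun x hx => (h x hx).2⟩
  have hleft : ∀ u, s < u → Tendsto y (𝓝[<] u) (𝓝 (Function.leftLim y u)) := fun u hu => by
    obtain ⟨ℓ, hℓ⟩ := hlim u hu
    rwa [leftLim_eq_of_tendsto hℓ]
  obtain ⟨K, hK⟩ := exists_bound_of_cadlag (t := t) (fun u hu => C.J_right_cont L ω v hs hu) hlim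
  have hl : ∀ u ∈ Set.Ioc s t, Tendsto y (𝓝[<] u) (𝓝 (Function.leftLim y u)) :=
    fun u hu => hleft u hu.1
  refine ⟨hl, ⟨K, hK⟩, fun u hu => ?_⟩
  -- `y` agrees with its left limits up to finitely many points
  have hae : ∀ᵐ r, r ∈ Set.uIoc s u → C.Bc (Function.leftLim y r) = C.Bc (y r) := by
    have hfin : ((fun n => L.arrival n ω) '' (Finset.range (L.N u ω) : Set ℕ)).Finite :=
      (Finset.finite_toSet _).image _
    filter_upwards [compl_mem_ae_iff.2 (hfin.measure_zero volume)] with r hr hrm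
    rw [Set.uIoc_of_le hu.1] at hrm
    obtain ⟨r', _, hr', h, h'⟩ := C.J_left L ω v hs hrm.1
    have e := leftLim_eq_of_tendsto (C.J_left_lim L ω v hs hr' fun x hx => (h x hx).2)
    rcases h' with h' | ⟨h1, h2, -⟩
    · rw [e, hy]; simp only; rw [h'.2]
    · refine absurd ⟨L.N r' ω, ?_, h2⟩ hr
      have : L.N r ω ≤ L.N u ω := L.poisson.mono ω r u (hs.trans hrm.1.le) hrm.2
      simp only [Finset.coe_range, Set.mem_Iio]; omega
  have hint : IntervalIntegrable (Function.leftLim y) volume s u :=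
    (intervalIntegrable_leftLim hst hl hK).mono_set (by
      rw [Set.uIcc_of_le hu.1, Set.uIcc_of_le hst]; exact Set.Icc_subset_Icc le_rfl hu.2)
  have hintB : IntervalIntegrable (fun r => C.Bc (y r)) volume s u := by
    have h1 : IntervalIntegrable (fun r => C.Bc (Function.leftLim y r)) volume s u :=
      ⟨C.Bc.integrable_comp hint.1, C.Bc.integrable_comp hint.2⟩
    exact h1.congr_ae ((ae_restrict_iff' measurableSet_uIoc).2 hae)
  -- Subtracting the accumulated jumps leaves a continuous path with right derivative B y at every
  -- point, to which the fundamental theorem of calculus with one-sided derivatives applies.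
  set Js : ℝ → ℝ := fun r => ∑ n ∈ Finset.Ico (L.N s ω) (L.N r ω),
    L.jump n ω ^ 2 * (0 + C.al (Function.leftLim y (L.arrival n ω))) with hJs
  have hder : ∀ x, s ≤ x →
      HasDerivWithinAt (fun r => y r - Js r • C.e) (C.Bc (y x)) (Set.Ici x) x := by
    intro x hx
    obtain ⟨r, hr, h⟩ := C.J_right L ω v hs hx
    have hd := ((C.hasDerivAt_flowPiece L (s := s) ω v (L.N x ω - L.N s ω) x).sub_const
      (Js x • C.e)).hasDerivWithinAt (s := Set.Ici x)
    have e := (h x ⟨le_rfl, hr⟩).2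
    have e' : y x = C.flowPiece L ω v s (L.N x ω - L.N s ω) x := e
    rw [Bc_apply, e']
    refine hd.congr_of_eventuallyEq ?_ (by rw [← e'])
    filter_upwards [Ico_mem_nhdsGE hr] with z hz
    have h1 := (h z hz).2
    have h2 : Js z = Js x := by simp only [hJs, (h z hz).1]
    rw [h2]
    exact congrArg (· - Js x • C.e) h1
  have hcont : ContinuousOn (fun r => y r - Js r • C.e) (Set.uIcc s u) := by
    intro x hx
    rw [Set.uIcc_of_le hu.1] at hx
    have hright := (hder x hx.1).continuousWithinAt
    rcases hx.1.eq_or_lt with rfl | hsx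
    · exact hright.mono (by rw [Set.uIcc_of_le hu.1]; exact Set.Icc_subset_Ici_self)
    refine ContinuousAt.continuousWithinAt (continuousAt_iff_continuous_left'_right'.2
      ⟨?_, hright.mono Set.Ioi_subset_Ici_self⟩)
    obtain ⟨r, hsr, hr, h, h'⟩ := C.J_left L ω v hs hsx
    have hlimx := C.J_left_lim L ω v hs hr fun x hx => (h x hx).2
    have hlx := leftLim_eq_of_tendsto hlimx
    have hval : y x - Js x • C.e = C.flowPiece L ω v s (L.N r ω - L.N s ω) x - Js r • C.e := by
      rcases h' with h' | ⟨h1, h2, h3⟩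
      · have e1 : y x = C.flowPiece L ω v s (L.N r ω - L.N s ω) x := h'.2
        have e2 : Js x = Js r := by simp only [hJs, h'.1]
        rw [e1, e2]
      · have e1 : y x = _ := h3
        have e2 : Js x = Js r + L.jump (L.N r ω) ω ^ 2 *
            (C.a ⬝ᵥ C.flowPiece L ω v s (L.N r ω - L.N s ω) x) := by
          simp only [hJs, h1]
          rw [Finset.sum_Ico_succ_top (L.poisson.mono ω s r hs hsr), h2, zero_add, C.al_apply, hlx]
        rw [e1, e2, add_smul]; abel
    unfold ContinuousWithinAt
    simp only [hval]
    refine (hlimx.sub_const (Js r • C.e)).congr' ?_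
    filter_upwards [Ico_mem_nhdsLT hr] with z hz
    have : Js z = Js r := by simp only [hJs, (h z hz).1]
    rw [this]
  have hftc := intervalIntegral.integral_eq_sub_of_hasDeriv_right hcont
    (fun x hx => (hder x (by rw [min_eq_left hu.1] at hx; exact hx.1.le)).mono
      Set.Ioi_subset_Ici_self) hintB
  rw [intervalIntegral.integral_congr_ae hae, hftc]
  have h0 : Js s = 0 := by simp [hJs]
  have hgoal : y u = y s + ((y u - Js u • C.e) - (y s - Js s • C.e)) + Js u • C.e := by
    rw [h0]; simp
  exact hgoal

end Flow

end Params

lemma intervalIntegrable_smul_leftLim {E : Type*} [NormedAddCommGroup E] [NormedSpace ℝ E]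
    {s t K : ℝ} {y yl : ℝ → E} (hst : s < t)
    (hl : ∀ u ∈ Set.Ioc s t, Tendsto y (𝓝[<] u) (𝓝 (yl u)))
    (hK : ∀ u ∈ Set.Icc s t, ‖y u‖ ≤ K) {d : ℝ → ℝ} (hd : IntervalIntegrable d volume s t) :
    IntervalIntegrable (fun u => d u • yl u) volume s t := by
  rw [intervalIntegrable_iff] at hd ⊢
  refine Integrable.smul_bdd hd K (aestronglyMeasurable_leftLim hst.le hl) ?_
  refine (ae_restrict_iff' measurableSet_uIoc).2 (ae_of_all _ fun u hu => ?_)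
  rw [Set.uIoc_of_le hst.le] at hu
  exact norm_leftLim_le hst hl hK hu

/-- Telescoping bound for the sum of jumps weighted by a stochastic exponential. -/
lemma prod_mul_sum_abs_le {ρ : ℝ} (hρ : 0 < ρ) (z : ℕ → ℝ) {a b : ℕ} (hab : a ≤ b) :
    (∏ n ∈ Finset.range a, (1 + ρ * |z n|)) * ∑ n ∈ Finset.Ico a b, |z n|
      ≤ ρ⁻¹ * ((∏ n ∈ Finset.range b, (1 + ρ * |z n|)) - ∏ n ∈ Finset.range a, (1 + ρ * |z n|)) := by
  induction b, hab using Nat.le_induction with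
  | base => simp
  | succ b hab ih =>
    have h1 : ∏ n ∈ Finset.range a, (1 + ρ * |z n|) ≤ ∏ n ∈ Finset.range b, (1 + ρ * |z n|) :=
      Finset.prod_le_prod_of_subset_of_one_le (Finset.range_mono hab)
        (fun i _ => by positivity) fun i _ _ => le_add_of_nonneg_right (by positivity)
    rw [Finset.sum_Ico_succ_top hab, mul_add, Finset.prod_range_succ]
    have h2 := mul_le_mul_of_nonneg_right h1 (abs_nonneg (z b))
    have h3 : ρ⁻¹ * (ρ * |z b|) = |z b| := by field_simp
    calc _ ≤ ρ⁻¹ * ((∏ n ∈ Finset.range b, (1 + ρ * |z n|)) -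
          ∏ n ∈ Finset.range a, (1 + ρ * |z n|)) + (∏ n ∈ Finset.range b, (1 + ρ * |z n|)) * |z b| :=
          add_le_add ih h2
      _ = _ := by
        linear_combination (-(∏ n ∈ Finset.range b, (1 + ρ * |z n|))) * h3

/-! ### Pathwise domination of the state, the volatility and the Riemann sums of G -/

namespace Params

variable {p q : ℕ} (C : Params p q)
variable {Ω : Type*} [mΩ : MeasurableSpace Ω] {P : Measure Ω} (L : SimpleSemiLevy P)

/-- A path of the state process: it is càdlàg and solves the state equation on every interval. -/
structure IsStatePath (y : ℝ → Fin q → ℝ) (ω : Ω) : Prop where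
  right_cont : ∀ t, 0 ≤ t → ContinuousWithinAt y (Set.Ici t) t
  left_lim : ∀ t, 0 < t → Tendsto y (𝓝[<] t) (𝓝 (Function.leftLim y t))
  sol : ∀ s t, 0 ≤ s → s ≤ t → IsSolution C.Bc C.al C.e C.α₀ (fun u => L.N u ω)
    (fun n => L.jump n ω) s t y (Function.leftLim y)
  nonneg : ∀ t, 0 < t → 0 ≤ C.α₀ + C.al (Function.leftLim y t)

variable {C L}

lemma IsState.ae_isStatePath {Y : ℝ → Ω → Fin q → ℝ} (hY : C.IsState L Y)
    (hV : ∀ᵐ ω ∂P, ∀ t, 0 ≤ t → 0 ≤ C.V Y t ω) :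
    ∀ᵐ ω ∂P, C.IsStatePath L (fun u => Y u ω) ω := by
  filter_upwards [hY.right_cont, hY.left_lim, hY.sde, hV] with ω hr hl hsde hV
  have hl' : ∀ t, 0 < t → Tendsto (fun u => Y u ω) (𝓝[<] t)
      (𝓝 (Function.leftLim (fun u => Y u ω) t)) := fun t ht => by
    obtain ⟨v, hv⟩ := hl t ht
    rwa [leftLim_eq_of_tendsto hv]
  have h0 : ∀ t, 0 ≤ t → IsSolution C.Bc C.al C.e C.α₀ (fun u => L.N u ω)
      (fun n => L.jump n ω) 0 t (fun u => Y u ω) (Function.leftLim fun u => Y u ω) := by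
    intro t ht
    obtain ⟨K, hK⟩ := exists_bound_of_cadlag (s := 0) (t := t) hr fun u hu => hl u hu
    refine ⟨fun u hu => hl' u hu.1, ⟨K, hK⟩, fun u hu => ?_⟩
    have hint : IntervalIntegrable (Function.leftLim fun u => Y u ω) volume 0 u :=
      intervalIntegrable_leftLim hu.1 (fun x hx => hl' x hx.1)
        (fun x hx => hK x ⟨hx.1, hx.2.trans hu.2⟩)
    have hintB : IntervalIntegrable (fun r => C.Bc (Function.leftLim (fun u => Y u ω) r))
        volume 0 u := ⟨C.Bc.integrable_comp hint.1, C.Bc.integrable_comp hint.2⟩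
    funext k
    have h1 := (ContinuousLinearMap.proj (R := ℝ) (φ := fun _ : Fin q => ℝ)
      k).intervalIntegral_comp_comm hintB
    simp only [ContinuousLinearMap.proj_apply, Bc_apply] at h1
    rw [hsde u hu.1 k, h1]
    have hN0 : L.N 0 ω = 0 := L.poisson.zero ω
    simp only [Pi.add_apply, Pi.smul_apply, smul_eq_mul, hN0, Nat.Ico_zero_eq_range, al_apply,
      SimpleSemiLevy.integralQV, Bc_apply]
    rw [mul_comm (C.e k)]
    congr 2
    refine Finset.sum_congr rfl fun n _ => ?_
    rw [mul_comm]
    rfl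
  refine ⟨hr, hl', fun s t hs hst => (h0 t (hs.trans hst)).mono (L.isCountingPath ω) le_rfl hs hst
    le_rfl, fun t ht => ?_⟩
  have := hV t ht.le
  rwa [V, if_pos ht, ← al_apply] at this

variable (C)

/-- The volatility obtained from the right continuous version of the state. -/
noncomputable def vol (y : Fin q → ℝ) : ℝ := C.α₀ + C.al y

lemma continuous_vol : Continuous C.vol := by unfold vol; fun_prop

lemma V_eq {Y : ℝ → Ω → Fin q → ℝ} {u : ℝ} (hu : 0 < u) (ω : Ω) :
    C.V Y u ω = C.vol (Function.leftLim (fun u => Y u ω) u) := by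
  rw [V, if_pos hu, vol, al_apply]

/-- A constant that bounds the growth of the state at a jump. -/
noncomputable def ρ : ℝ := Real.sqrt ((|C.α₀| + ‖C.al‖) * ‖C.e‖) + 1

lemma ρ_pos : 0 < C.ρ := by unfold ρ; positivity

/-- The square root lets one product serve twice: R controls √V and the increments of G, which react
to |Z|, while R² controls Y, V and J, which react to Z². -/
lemma le_ρ_sq : (|C.α₀| + ‖C.al‖) * ‖C.e‖ ≤ C.ρ ^ 2 := by
  have h := Real.sq_sqrt (show 0 ≤ (|C.α₀| + ‖C.al‖) * ‖C.e‖ by positivity)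
  have h' := Real.sqrt_nonneg ((|C.α₀| + ‖C.al‖) * ‖C.e‖)
  unfold ρ
  nlinarith

variable (L)

/-- A stochastic exponential that controls the paths of the state and of `G`. -/
noncomputable def R (t : ℝ) (ω : Ω) : ℝ :=
  ∏ n ∈ Finset.range (L.N t ω), (1 + C.ρ * |L.jump n ω|)

lemma one_le_R (t : ℝ) (ω : Ω) : 1 ≤ C.R L t ω :=
  Finset.one_le_prod fun n _ => le_add_of_nonneg_right (by have := C.ρ_pos; positivity)

lemma R_mono {s t : ℝ} (hs : 0 ≤ s) (hst : s ≤ t) (ω : Ω) : C.R L s ω ≤ C.R L t ω := by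
  have := C.ρ_pos
  exact Finset.prod_le_prod_of_subset_of_one_le
    (Finset.range_mono (L.poisson.mono ω s t hs hst))
    (fun i _ => by positivity) fun i _ _ => le_add_of_nonneg_right (by positivity)

/-- Factor by factor, 1 + κ z² ≤ (1 + ρ|z|)²; the jumps with index below a only add factors that are
at least 1. -/
lemma prod_Ico_le_R_sq {κ : ℝ} (hκ0 : 0 ≤ κ) (hκ : κ ≤ C.ρ ^ 2) (a : ℕ) (t : ℝ) (ω : Ω) :
    ∏ n ∈ Finset.Ico a (L.N t ω), (1 + κ * L.jump n ω ^ 2) ≤ C.R L t ω ^ 2 := by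
  have hρ := C.ρ_pos
  rw [R, ← Finset.prod_pow, Finset.range_eq_Ico]
  refine (Finset.prod_le_prod_of_subset_of_one_le (Finset.Ico_subset_Ico_left (Nat.zero_le a))
    (fun i _ => by positivity) fun i _ _ => le_add_of_nonneg_right (by positivity)).trans
    (Finset.prod_le_prod (fun i _ => by positivity) fun i _ => ?_)
  have h1 := mul_le_mul_of_nonneg_right hκ (sq_nonneg (L.jump i ω))
  have h2 : 0 ≤ C.ρ * |L.jump i ω| := by positivity
  have h3 := sq_abs (L.jump i ω)
  nlinarith

lemma norm_J_mulVec_le {s u t : ℝ} (hs : 0 ≤ s) (hsu : s ≤ u) (hut : u ≤ t) (ω : Ω)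
    (v : Fin q → ℝ) :
    ‖C.J L s u ω *ᵥ v‖ ≤ (‖C.J L s s ω *ᵥ v‖ + 1) * Real.exp (‖C.Bc‖ * (t - s))
      * C.R L t ω ^ 2 := by
  have h := (C.isSolution_J L ω v hs hsu).norm_add_one_le (L.isCountingPath ω)
    (X := fun u => L.X u ω) (fun _ _ => rfl) hs hsu
  have hκ : (|(0 : ℝ)| + ‖C.al‖) * ‖C.e‖ ≤ C.ρ ^ 2 :=
    le_trans (by rw [abs_zero]; gcongr; exact abs_nonneg _) C.le_ρ_sq
  have h1 := C.prod_Ico_le_R_sq L (by positivity) hκ (L.N s ω) u ω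
  have h2 := C.R_mono L (hs.trans hsu) hut ω
  have h3 := C.one_le_R L u ω
  calc ‖C.J L s u ω *ᵥ v‖ ≤ ‖C.J L s u ω *ᵥ v‖ + 1 := by linarith
    _ ≤ _ := h
    _ ≤ (‖C.J L s s ω *ᵥ v‖ + 1) * (Real.exp (‖C.Bc‖ * (t - s)) * C.R L t ω ^ 2) := by
        gcongr
        exact h1.trans (by gcongr)
    _ = _ := by ring

lemma J_self (s : ℝ) (ω : Ω) : C.J L s s ω = 1 := by
  simp [J, jumpTime, jumpFlow, NormedSpace.exp_zero]

/-- The entries of `J` are dominated. -/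
lemma abs_J_mulVec_single_le {s u t : ℝ} (hs : 0 ≤ s) (hsu : s ≤ u) (hut : u ≤ t) (ω : Ω)
    (i k : Fin q) :
    |C.J L s u ω i k| ≤ 2 * Real.exp (‖C.Bc‖ * (t - s)) * C.R L t ω ^ 2 := by
  have h := C.norm_J_mulVec_le L hs hsu hut ω (Pi.single k 1)
  have h1 : (C.J L s u ω *ᵥ Pi.single k 1) i = C.J L s u ω i k := by simp
  rw [J_self, Matrix.one_mulVec] at h
  have h2 : ‖(Pi.single k 1 : Fin q → ℝ)‖ = 1 := by rw [Pi.norm_single]; simp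
  rw [h2] at h
  have h3 := (norm_le_pi_norm (C.J L s u ω *ᵥ Pi.single k 1) i).trans h
  rw [h1, Real.norm_eq_abs] at h3
  linarith

/-- The dominating random variable. -/
noncomputable def dom (Y : ℝ → Ω → Fin q → ℝ) (t : ℝ) (ω : Ω) : ℝ :=
  (‖Y 0 ω‖ + 1) * C.R L t ω ^ 2

lemma one_le_dom (Y : ℝ → Ω → Fin q → ℝ) (t : ℝ) (ω : Ω) : 1 ≤ C.dom L Y t ω := by
  have h1 := C.one_le_R L t ω
  have h2 := norm_nonneg (Y 0 ω)
  unfold dom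
  nlinarith [sq_nonneg (C.R L t ω), one_le_pow₀ h1 (n := 2)]

lemma dom_mono (Y : ℝ → Ω → Fin q → ℝ) {s t : ℝ} (hs : 0 ≤ s) (hst : s ≤ t) (ω : Ω) :
    C.dom L Y s ω ≤ C.dom L Y t ω := by
  have h1 := C.one_le_R L s ω
  have h2 := C.R_mono L hs hst ω
  unfold dom
  gcongr

variable {L} {Y : ℝ → Ω → Fin q → ℝ} {ω : Ω} (hω : C.IsStatePath L (fun u => Y u ω) ω)
include hω

variable {C}

lemma IsStatePath.norm_le {u t : ℝ} (hu : 0 ≤ u) (hut : u ≤ t) :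
    ‖Y u ω‖ + 1 ≤ Real.exp (‖C.Bc‖ * t) * C.dom L Y u ω := by
  have h := (hω.sol 0 u le_rfl hu).norm_add_one_le (L.isCountingPath ω)
    (X := fun u => L.X u ω) (fun _ _ => rfl) le_rfl hu
  have h1 := C.prod_Ico_le_R_sq L (by positivity) C.le_ρ_sq (L.N 0 ω) u ω
  refine h.trans ?_
  rw [dom]
  calc _ ≤ (‖Y 0 ω‖ + 1) * (Real.exp (‖C.Bc‖ * t) * C.R L u ω ^ 2) := by
        gcongr
        linarith
    _ = _ := by ring

/-- For positive times the sign hypothesis concerns left limits only. A negative value at u would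
persist, up to a factor 1/2, on an interval to the right of u, and hence in the left limit at its
midpoint. The sign at grid points is what makes the squared root return the volatility. -/
lemma IsStatePath.vol_nonneg {u : ℝ} (hu : 0 ≤ u) : 0 ≤ C.vol (Y u ω) := by
  by_contra! hneg
  have h1 : ∀ᶠ x in 𝓝[≥] u, C.vol (Y x ω) < C.vol (Y u ω) / 2 :=
    ((C.continuous_vol.tendsto _).comp (hω.right_cont u hu)).eventually
      (Iio_mem_nhds (by linarith))
  obtain ⟨r, hr, h⟩ := mem_nhdsGE_iff_exists_Ico_subset.1 h1
  have hr' : u < r := hr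
  have hx : u < (u + r) / 2 := by linarith
  have h2 := (C.continuous_vol.tendsto _).comp (hω.left_lim ((u + r) / 2) (by linarith))
  have h3 : C.vol (Function.leftLim (fun u => Y u ω) ((u + r) / 2)) ≤ C.vol (Y u ω) / 2 := by
    refine le_of_tendsto h2 ?_
    filter_upwards [Ico_mem_nhdsLT hx] with z hz
    have hz' : z ∈ Set.Ico u r := ⟨hz.1, by linarith [hz.2]⟩
    exact (show C.vol (Y z ω) < C.vol (Y u ω) / 2 from h hz').le
  have h4 := hω.nonneg ((u + r) / 2) (by linarith)
  rw [vol] at h3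
  linarith

lemma IsStatePath.abs_vol_le {u t : ℝ} (hu : 0 ≤ u) (hut : u ≤ t) :
    |C.vol (Y u ω)| ≤ (|C.α₀| + ‖C.al‖) * Real.exp (‖C.Bc‖ * t) * C.dom L Y u ω := by
  have h1 := hω.norm_le hu hut
  have h2 := C.al.le_opNorm (Y u ω)
  rw [Real.norm_eq_abs] at h2
  have h3 := norm_nonneg (Y u ω)
  calc |C.vol (Y u ω)| ≤ |C.α₀| + |C.al (Y u ω)| := abs_add_le _ _
    _ ≤ (|C.α₀| + ‖C.al‖) * (‖Y u ω‖ + 1) := by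
      nlinarith [abs_nonneg C.α₀, norm_nonneg C.al]
    _ ≤ (|C.α₀| + ‖C.al‖) * (Real.exp (‖C.Bc‖ * t) * C.dom L Y u ω) := by gcongr
    _ = _ := by ring

omit hω in
variable (C) in
/-- The constant in the bound for the square root of the volatility. -/
noncomputable def volBound (t : ℝ) : ℝ :=
  Real.sqrt ((|C.α₀| + ‖C.al‖) * Real.exp (‖C.Bc‖ * t))

lemma IsStatePath.sqrt_vol_le {u t : ℝ} (hu : 0 ≤ u) (hut : u ≤ t) :
    Real.sqrt (C.vol (Y u ω)) ≤ C.volBound t * Real.sqrt (‖Y 0 ω‖ + 1) * C.R L u ω := by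
  have h0 := C.one_le_R L u ω
  have h := (le_abs_self _).trans (hω.abs_vol_le hu hut)
  refine (Real.sqrt_le_sqrt h).trans (le_of_eq ?_)
  rw [dom, Real.sqrt_mul (show 0 ≤ (|C.α₀| + ‖C.al‖) * Real.exp (‖C.Bc‖ * t) by positivity),
    Real.sqrt_mul (show 0 ≤ ‖Y 0 ω‖ + 1 by positivity), Real.sqrt_sq (by linarith), volBound]
  ring

omit hω in
variable (C L Y) in
/-- Riemann sums for the increment of `G`. -/
noncomputable def riemann (s t : ℝ) (m k : ℕ) (ω : Ω) : ℝ :=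
  ∑ i ∈ Finset.range k, Real.sqrt (C.vol (Y (grid s t m i) ω)) *
    (L.S (grid s t m (i + 1)) ω - L.S (grid s t m i) ω)

omit hω in
variable (C L) in
/-- The constant in the bound for the increments of `G`. -/
noncomputable def gBound (s t : ℝ) : ℝ :=
  C.volBound t * ((∫ u in s..t, |L.driftDensity u|) + C.ρ⁻¹)

omit hω in
lemma driftDensity_intervalIntegrable {s t : ℝ} (hs : 0 ≤ s) (ht : 0 ≤ t) :
    IntervalIntegrable L.driftDensity volume s t :=
  (L.driftDensity_integrable s hs).symm.trans (L.driftDensity_integrable t ht)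

omit hω in
lemma drift_sub {s t : ℝ} (hs : 0 ≤ s) (ht : 0 ≤ t) :
    L.drift t - L.drift s = ∫ u in s..t, L.driftDensity u :=
  intervalIntegral.integral_interval_sub_left (L.driftDensity_integrable t ht)
    (L.driftDensity_integrable s hs)

/-- The bound is uniform in m. In each grid interval R at the left end times the sum of the |Z_n| is
at most ρ⁻¹ times the increment of R, by `prod_mul_sum_abs_le`, and this telescopes. Only the first
power of R remains, so that squared increments of G need no more than second moments of the jumps.
-/
lemma IsStatePath.abs_riemann_le [IsProbabilityMeasure P] {s t : ℝ} (hs : 0 ≤ s) (hst : s ≤ t) (m : ℕ) {k : ℕ}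
    (hk : k ≤ m + 1) :
    |C.riemann L Y s t m k ω| ≤ C.gBound L s t * (Real.sqrt (‖Y 0 ω‖ + 1) * C.R L t ω) := by
  set g := grid s t m
  have hg := grid_monotone hst m
  have hg0 : ∀ i, 0 ≤ g i := fun i => hs.trans (le_grid hst m i)
  have hρ := C.ρ_pos
  set A := C.volBound t * Real.sqrt (‖Y 0 ω‖ + 1) with hA
  have hA0 : 0 ≤ A := by rw [hA, volBound]; positivity
  have hd : ∀ x y, 0 ≤ x → 0 ≤ y → IntervalIntegrable (fun u => |L.driftDensity u|) volume x y :=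
    fun x y hx hy => (driftDensity_intervalIntegrable hx hy).abs
  have hterm : ∀ i ∈ Finset.range k, |Real.sqrt (C.vol (Y (g i) ω)) *
      (L.S (g (i + 1)) ω - L.S (g i) ω)| ≤ A * (C.R L t ω * (∫ u in g i..g (i + 1),
        |L.driftDensity u|) + C.ρ⁻¹ * (C.R L (g (i + 1)) ω - C.R L (g i) ω)) := by
    intro i hi
    have hi' : i + 1 ≤ m + 1 := by have := Finset.mem_range.1 hi; omega
    have hgi : g i ≤ t := grid_le hst (by omega)
    have hle : g i ≤ g (i + 1) := hg (Nat.le_succ i)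
    rw [abs_mul, abs_of_nonneg (Real.sqrt_nonneg _)]
    have h1 := hω.sqrt_vol_le (hg0 i) hgi
    have h2 : |L.S (g (i + 1)) ω - L.S (g i) ω| ≤ (∫ u in g i..g (i + 1), |L.driftDensity u|)
        + ∑ n ∈ Finset.Ico (L.N (g i) ω) (L.N (g (i + 1)) ω), |L.jump n ω| := by
      rw [L.S_sub_S, drift_sub (hg0 _) (hg0 _), L.X_sub_X (hg0 _) hle]
      exact (abs_add_le _ _).trans (add_le_add
        (intervalIntegral.abs_integral_le_integral_abs hle) (Finset.abs_sum_le_sum_abs _ _))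
    have h3 := prod_mul_sum_abs_le hρ (fun n => L.jump n ω)
      (L.poisson.mono ω (g i) (g (i + 1)) (hg0 i) hle)
    have h4 := C.R_mono L (hg0 i) hgi ω
    have h5 : 0 ≤ ∫ u in g i..g (i + 1), |L.driftDensity u| :=
      intervalIntegral.integral_nonneg hle fun u _ => abs_nonneg _
    have h6 := C.one_le_R L (g i) ω
    calc _ ≤ (A * C.R L (g i) ω) * ((∫ u in g i..g (i + 1), |L.driftDensity u|)
        + ∑ n ∈ Finset.Ico (L.N (g i) ω) (L.N (g (i + 1)) ω), |L.jump n ω|) := by gcongr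
      _ = A * (C.R L (g i) ω * (∫ u in g i..g (i + 1), |L.driftDensity u|) + C.R L (g i) ω *
          ∑ n ∈ Finset.Ico (L.N (g i) ω) (L.N (g (i + 1)) ω), |L.jump n ω|) := by ring
      _ ≤ _ := by
        refine mul_le_mul_of_nonneg_left (add_le_add ?_ h3) hA0
        exact mul_le_mul_of_nonneg_right h4 h5
  have hmono : C.R L (g k) ω ≤ C.R L t ω := C.R_mono L (hg0 k) (grid_le hst hk) ω
  have hR0 := C.one_le_R L (g 0) ω
  have hRt := C.one_le_R L t ω
  have hint : ∫ u in g 0..g k, |L.driftDensity u| ≤ ∫ u in s..t, |L.driftDensity u| := by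
    have e0 : g 0 = s := grid_zero s t m
    rw [e0]
    refine intervalIntegral.integral_mono_interval le_rfl (le_grid hst m k) (grid_le hst hk)
      (ae_of_all _ fun u => abs_nonneg _) (hd _ _ hs (hs.trans hst))
  calc |C.riemann L Y s t m k ω|
      ≤ ∑ i ∈ Finset.range k, A * (C.R L t ω * (∫ u in g i..g (i + 1), |L.driftDensity u|)
        + C.ρ⁻¹ * (C.R L (g (i + 1)) ω - C.R L (g i) ω)) :=
        (Finset.abs_sum_le_sum_abs _ _).trans (Finset.sum_le_sum hterm)
    _ = A * (C.R L t ω * (∫ u in g 0..g k, |L.driftDensity u|)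
        + C.ρ⁻¹ * (C.R L (g k) ω - C.R L (g 0) ω)) := by
        rw [← Finset.mul_sum, Finset.sum_add_distrib, ← Finset.mul_sum, ← Finset.mul_sum,
          Finset.sum_range_sub (fun i => C.R L (g i) ω),
          intervalIntegral.sum_integral_adjacent_intervals (a := g)
            (fun i _ => hd _ _ (hg0 i) (hg0 (i + 1)))]
    _ ≤ A * (C.R L t ω * (∫ u in s..t, |L.driftDensity u|) + C.ρ⁻¹ * C.R L t ω) := by
        gcongr; linarith
    _ = _ := by rw [gBound, hA]; ring

lemma IsStatePath.tendsto_sqrt_vol {u : ℝ} (hu : 0 < u) :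
    Tendsto (fun x => Real.sqrt (C.vol (Y x ω))) (𝓝[<] u) (𝓝 (Real.sqrt (C.V Y u ω))) := by
  rw [C.V_eq hu]
  exact ((Real.continuous_sqrt.comp C.continuous_vol).tendsto _).comp (hω.left_lim u hu)

lemma IsStatePath.G_sub {s t : ℝ} (hs : 0 ≤ s) (hst : s < t) :
    C.G L Y t ω - C.G L Y s ω = (∫ u in s..t, L.driftDensity u • Real.sqrt (C.V Y u ω))
      + ∑ n ∈ Finset.Ico (L.N s ω) (L.N t ω),
        Real.sqrt (C.V Y (L.arrival n ω) ω) * L.jump n ω := by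
  have hI : ∀ r, 0 ≤ r → IntervalIntegrable (fun u => Real.sqrt (C.V Y u ω) * L.driftDensity u)
      volume 0 r := by
    intro r hr
    rcases hr.eq_or_lt with rfl | hr
    · exact IntervalIntegrable.refl
    have hb : ∀ u ∈ Set.Icc 0 r, ‖Real.sqrt (C.vol (Y u ω))‖
        ≤ C.volBound r * Real.sqrt (‖Y 0 ω‖ + 1) * C.R L r ω := fun u hu => by
      rw [Real.norm_of_nonneg (Real.sqrt_nonneg _)]
      refine (hω.sqrt_vol_le hu.1 hu.2).trans ?_
      have := C.R_mono L hu.1 hu.2 ω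
      have : 0 ≤ C.volBound r := Real.sqrt_nonneg _
      gcongr
    have := intervalIntegrable_smul_leftLim hr (fun u hu => hω.tendsto_sqrt_vol hu.1) hb
      (driftDensity_intervalIntegrable le_rfl hr.le (L := L))
    simpa only [smul_eq_mul, mul_comm] using this
  have h1 := intervalIntegral.integral_interval_sub_left (hI t (hs.trans hst.le)) (hI s hs)
  rw [G, G, SimpleSemiLevy.integralS, SimpleSemiLevy.integralS, add_sub_add_comm, h1,
    Finset.sum_Ico_eq_sub _ (L.poisson.mono ω s t hs hst.le)]
  simp only [smul_eq_mul, mul_comm]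

/-- Evaluating √V along `gridFloor` gives its left limits in the limit, which is the integrand of G.
The drift part converges by dominated convergence, the jump part as a finite sum. -/
lemma IsStatePath.tendsto_riemann [IsProbabilityMeasure P] {s t : ℝ} (hs : 0 ≤ s) (hst : s < t) :
    Tendsto (fun m => C.riemann L Y s t m (m + 1) ω) atTop
      (𝓝 (C.G L Y t ω - C.G L Y s ω)) := by
  have hc := L.isCountingPath ω
  have hl : ∀ u ∈ Set.Ioc s t, Tendsto (fun x => Real.sqrt (C.vol (Y x ω))) (𝓝[<] u)
      (𝓝 (Real.sqrt (C.V Y u ω))) := fun u hu => hω.tendsto_sqrt_vol (hs.trans_lt hu.1)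
  have hb : ∀ u ∈ Set.Icc s t, ‖Real.sqrt (C.vol (Y u ω))‖
      ≤ C.volBound t * Real.sqrt (‖Y 0 ω‖ + 1) * C.R L t ω := fun u hu => by
    rw [Real.norm_of_nonneg (Real.sqrt_nonneg _)]
    refine (hω.sqrt_vol_le (hs.trans hu.1) hu.2).trans ?_
    have := C.R_mono L (hs.trans hu.1) hu.2 ω
    have : 0 ≤ C.volBound t := Real.sqrt_nonneg _
    gcongr
  have hd := driftDensity_intervalIntegrable hs (hs.trans hst.le) (L := L)
  have e : ∀ m, C.riemann L Y s t m (m + 1) ω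
      = (∫ u in s..t, L.driftDensity u • Real.sqrt (C.vol (Y (gridFloor s t m u) ω)))
        + ∑ n ∈ Finset.Ico (L.N s ω) (L.N t ω),
          Real.sqrt (C.vol (Y (gridFloor s t m (L.arrival n ω)) ω)) * L.jump n ω := by
    intro m
    have hg0 : ∀ i, 0 ≤ grid s t m i := fun i => hs.trans (le_grid hst.le m i)
    have hi : ∀ i < m + 1, IntervalIntegrable (fun u => L.driftDensity u •
        Real.sqrt (C.vol (Y (grid s t m i) ω))) volume (grid s t m i) (grid s t m (i + 1)) :=
      fun i _ => (driftDensity_intervalIntegrable (hg0 _) (hg0 _)).mul_const _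
    have h1 := sum_grid_integral hst
      (fun x u => L.driftDensity u • Real.sqrt (C.vol (Y x ω))) m hi
    have h2 := hc.sum_grid hs hst
      (fun x n => Real.sqrt (C.vol (Y x ω)) * L.jump n ω) m
    refine Eq.trans ?_ (congrArg₂ (· + ·) h1 h2)
    rw [riemann, ← Finset.sum_add_distrib]
    refine Finset.sum_congr rfl fun i _ => ?_
    rw [L.S_sub_S, drift_sub (hg0 _) (hg0 _),
      L.X_sub_X (hg0 _) (grid_monotone hst.le m (Nat.le_succ i)), mul_add, Finset.mul_sum]
    congr 1
    rw [intervalIntegral.integral_smul_const, smul_eq_mul, mul_comm]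
  simp only [e]
  rw [hω.G_sub hs hst]
  refine (tendsto_integral_gridFloor hst hl hb hd).add (tendsto_finsetSum _ fun n hn => ?_)
  exact (tendsto_comp_gridFloor hst hl
    (hc.mem_Ioc_of_mem_Ico hs (hs.trans hst.le) hn)).mul_const _

lemma IsStatePath.abs_G_sub_le [IsProbabilityMeasure P] {s t : ℝ} (hs : 0 ≤ s) (hst : s < t) :
    |C.G L Y t ω - C.G L Y s ω| ≤ C.gBound L s t * (Real.sqrt (‖Y 0 ω‖ + 1) * C.R L t ω) :=
  le_of_tendsto (hω.tendsto_riemann hs hst).abs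
    (Eventually.of_forall fun m => hω.abs_riemann_le hs hst.le m le_rfl)

omit hω in
lemma sqrt_mul_R_sq (t : ℝ) :
    (Real.sqrt (‖Y 0 ω‖ + 1) * C.R L t ω) ^ 2 = C.dom L Y t ω := by
  rw [mul_pow, Real.sq_sqrt (by positivity), dom]

end Params

/-! ### Limits and independence for sub-σ-algebras -/

section SubAlgebra

variable {Ω : Type*} {mΩ : MeasurableSpace Ω} {P : Measure Ω}

/-- The sub-σ-algebra need not contain the null sets. Choosing m-measurable versions first and
taking `limUnder` of them gives an m-measurable function equal to the limit almost surely. -/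
lemma aestronglyMeasurable_of_tendsto_ae_sub {m : MeasurableSpace Ω} {E : Type*}
    [NormedAddCommGroup E] [CompleteSpace E] {f : ℕ → Ω → E} {g : Ω → E}
    (hf : ∀ n, AEStronglyMeasurable[m] (f n) P)
    (h : ∀ᵐ ω ∂P, Tendsto (fun n => f n ω) atTop (𝓝 (g ω))) : AEStronglyMeasurable[m] g P := by
  choose f' hf' heq using hf
  have : Nonempty E := ⟨0⟩
  refine ⟨fun ω => limUnder atTop fun n => f' n ω, StronglyMeasurable.limUnder hf', ?_⟩
  filter_upwards [h, ae_all_iff.2 heq] with ω hω hω'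
  refine (Tendsto.limUnder_eq ?_).symm
  simpa only [hω'] using hω

lemma indepFun_of_indep_sub {m₁ m₂ : MeasurableSpace Ω} {E F : Type*} [NormedAddCommGroup E]
    [MeasurableSpace E] [BorelSpace E] [NormedAddCommGroup F]
    [MeasurableSpace F] [BorelSpace F] (h : Indep m₁ m₂ P) {f : Ω → E} {g : Ω → F}
    (hf : AEStronglyMeasurable[m₁] f P) (hg : AEStronglyMeasurable[m₂] g P) :
    IndepFun f g P := by
  obtain ⟨f', hf', hff⟩ := hf
  obtain ⟨g', hg', hgg⟩ := hg
  refine IndepFun.congr ?_ hff.symm hgg.symm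
  rw [IndepFun_iff_Indep]
  exact indep_of_indep_of_le_left (indep_of_indep_of_le_right h
    (comap_le_of_measurable hg'.measurable)) (comap_le_of_measurable hf'.measurable)

lemma measurable_prod_range {m : MeasurableSpace Ω} {f : ℕ → Ω → ℝ} (k : ℕ)
    {φ : ℝ → ℝ} (hφ : Measurable φ) (hf : ∀ i, Measurable (f i)) :
    Measurable fun ω => ∏ i ∈ Finset.range k, φ (f i ω) :=
  Finset.measurable_fun_prod _ fun i _ => hφ.comp (hf i)

end SubAlgebra

/-- Finite moments of even order pass to the weights `1 + ρ |z|`. -/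
lemma lintegral_one_add_pow_lt_top {μ : Measure ℝ} [IsProbabilityMeasure μ] {ρ : ℝ} (hρ : 0 ≤ ρ)
    {k : ℕ} (hk : Even k) (h : ∫⁻ z, ENNReal.ofReal (z ^ k) ∂μ < ∞) :
    ∫⁻ z, ENNReal.ofReal ((1 + ρ * |z|) ^ k) ∂μ < ∞ := by
  have hb : ∀ z : ℝ, ENNReal.ofReal ((1 + ρ * |z|) ^ k)
      ≤ ENNReal.ofReal (2 ^ (k - 1)) * (1 + ENNReal.ofReal (ρ ^ k) * ENNReal.ofReal (z ^ k)) := by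
    intro z
    rw [← ENNReal.ofReal_mul (by positivity), ← ENNReal.ofReal_one, ← ENNReal.ofReal_add
      zero_le_one (mul_nonneg (by positivity) (hk.pow_nonneg z)), ← ENNReal.ofReal_mul
      (by positivity)]
    refine ENNReal.ofReal_le_ofReal ?_
    have h1 := add_pow_le zero_le_one (show 0 ≤ ρ * |z| by positivity) k
    rwa [one_pow, mul_pow, hk.pow_abs] at h1
  refine (lintegral_mono hb).trans_lt ?_
  rw [lintegral_const_mul _ (by fun_prop), lintegral_add_left measurable_const,
    lintegral_const_mul _ (by fun_prop)]
  simp only [lintegral_const, measure_univ, mul_one]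
  exact ENNReal.mul_lt_top ENNReal.ofReal_lt_top
    (ENNReal.add_lt_top.2 ⟨ENNReal.one_lt_top, ENNReal.mul_lt_top ENNReal.ofReal_lt_top h⟩)

/-! ### Past and future of the state, and integrability of the dominating variables -/

namespace Params

variable {p q : ℕ} (C : Params p q)
variable {Ω : Type*} [mΩ : MeasurableSpace Ω] {P : Measure Ω} [IsProbabilityMeasure P]
  (L : SimpleSemiLevy P) (Y : ℝ → Ω → Fin q → ℝ)

/-- The σ-algebra generated by the initial state and the jump process up to a time. -/
@[reducible] noncomputable def past (s : ℝ) : MeasurableSpace Ω :=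
  (⨆ r : Set.Icc (0 : ℝ) s, MeasurableSpace.comap (L.X r) inferInstance) ⊔
    MeasurableSpace.comap (Y 0) inferInstance

variable {L Y}

lemma measurable_past_X {r s : ℝ} (hr : 0 ≤ r) (hrs : r ≤ s) :
    Measurable[past L Y s] (L.X r) :=
  (comap_measurable (L.X r)).mono
    ((le_iSup (fun r : Set.Icc (0 : ℝ) s => MeasurableSpace.comap (L.X r) inferInstance)
      ⟨r, hr, hrs⟩).trans le_sup_left) le_rfl

lemma measurable_past_zero (s : ℝ) : Measurable[past L Y s] (Y 0) :=
  (comap_measurable (Y 0)).mono le_sup_right le_rfl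

lemma past_mono {s t : ℝ} (hst : s ≤ t) : past L Y s ≤ past L Y t :=
  sup_le (iSup_le fun r => comap_le_of_measurable (measurable_past_X r.2.1 (r.2.2.trans hst)))
    (comap_le_of_measurable (measurable_past_zero t))

variable {C}
variable (hY : C.IsState L Y)
include hY

lemma IsState.past_le (s : ℝ) : past L Y s ≤ mΩ :=
  sup_le (iSup_le fun r => comap_le_of_measurable (L.measurable_X r.2.1))
    (comap_le_of_measurable hY.measurable_zero)

/-- The values X_r with r ≤ s belong to the history and are independent of the future. The initial
state is independent of the whole of S, hence jointly of the past and the future of X, and it can be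
joined to the past. -/
lemma IsState.indep_past_future {s : ℝ} (hs : 0 ≤ s) : Indep (past L Y s) (L.future s) P := by
  have hXS : ∀ t, 0 ≤ t → Measurable[⨆ t : ℝ≥0,
      MeasurableSpace.comap (L.S (t : ℝ)) inferInstance] (L.X t) := by
    intro t ht
    have h1 : Measurable[⨆ t : ℝ≥0, MeasurableSpace.comap (L.S (t : ℝ)) inferInstance]
        (L.S t) := (comap_measurable (L.S t)).mono
      (le_iSup (fun t : ℝ≥0 => MeasurableSpace.comap (L.S (t : ℝ)) inferInstance) ⟨t, ht⟩) le_rfl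
    have e : L.X t = fun ω => L.S t ω - L.drift t := by
      funext ω; rw [L.S_eq]; ring
    rw [e]
    exact h1.sub_const _
  refine (indep_sup_right_of_indep (L.future_le hs)
    (iSup_le fun r => comap_le_of_measurable (L.measurable_X r.2.1))
    (comap_le_of_measurable hY.measurable_zero) ?_ ?_).symm
  · exact indep_of_indep_of_le_right (L.indep_history_future hs).symm
      (iSup_le fun r => comap_le_of_measurable (L.measurable_X_history r.2.1 r.2.2))
  · refine indep_of_indep_of_le_left hY.indep_zero.symm (sup_le (iSup_le fun u => ?_)
      (iSup_le fun r => comap_le_of_measurable (hXS r r.2.1)))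
    exact comap_sub_le (hXS u (hs.trans u.2)) (hXS s hs)

variable (hpath : ∀ᵐ ω ∂P, C.IsStatePath L (fun u => Y u ω) ω)
include hpath

omit hY in
/-- The state is adapted. -/
lemma aestronglyMeasurable_state {u s : ℝ} (hu : 0 ≤ u) (hus : u ≤ s) :
    AEStronglyMeasurable[past L Y s] (Y u) P := by
  rcases hu.eq_or_lt with rfl | hu
  · exact (measurable_past_zero s).stronglyMeasurable.aestronglyMeasurable
  refine aestronglyMeasurable_of_tendsto_ae_sub (f := fun m ω =>
    eulerEnd C.Bc C.al C.e C.α₀ 0 u (fun r => L.X r ω) (Y 0 ω) m) (fun m => ?_) ?_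
  · refine (Measurable.stronglyMeasurable ?_).aestronglyMeasurable
    refine measurable_euler (measurable_past_zero s) fun i hi => ?_
    exact (measurable_past_X (le_grid hu.le m _) ((grid_le hu.le (show i + 1 ≤ m + 1 by omega)).trans hus)).sub
      (measurable_past_X (le_grid hu.le m _)
        ((grid_le hu.le (show i ≤ m + 1 by omega)).trans hus))
  · filter_upwards [hpath] with ω hω
    exact (hω.sol 0 u le_rfl hu.le).tendsto_eulerEnd (L.isCountingPath ω) (fun _ _ => rfl) le_rfl hu

omit hY hpath in
lemma measurable_future_eulerEnd {α s u : ℝ} (hsu : s ≤ u) (v : Fin q → ℝ) (m : ℕ) :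
    Measurable[L.future s] fun ω =>
      eulerEnd C.Bc C.al C.e α s u (fun r => L.X r ω) v m :=
  measurable_euler measurable_const fun _ _ =>
    L.measurable_future (le_grid hsu m _) (le_grid hsu m _)

-- The Euler schemes with α = 0 start from the fixed vector v and use only increments of X after s;
-- they converge to J v.
omit hY hpath in
lemma aestronglyMeasurable_J {s u : ℝ} (hs : 0 ≤ s) (hsu : s ≤ u) (v : Fin q → ℝ) :
    AEStronglyMeasurable[L.future s] (fun ω => C.J L s u ω *ᵥ v) P := by
  rcases hsu.eq_or_lt with rfl | hsu
  · simp only [J_self, Matrix.one_mulVec]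
    exact stronglyMeasurable_const.aestronglyMeasurable
  refine aestronglyMeasurable_of_tendsto_ae_sub (fun m =>
    (measurable_future_eulerEnd (C := C) (α := 0) hsu.le v m).stronglyMeasurable.aestronglyMeasurable)
    (ae_of_all _ fun ω => ?_)
  have h := (C.isSolution_J L ω v hs hsu.le).tendsto_eulerEnd (L.isCountingPath ω)
    (X := fun r => L.X r ω) (fun _ _ => rfl) hs hsu
  simpa only [J_self, Matrix.one_mulVec] using h

omit hY in
/-- The part of the state at time `u` that does not depend on the state at time `s`. -/
lemma aestronglyMeasurable_K {s u : ℝ} (hs : 0 ≤ s) (hsu : s ≤ u) :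
    AEStronglyMeasurable[L.future s] (fun ω => Y u ω - C.J L s u ω *ᵥ Y s ω) P := by
  rcases hsu.eq_or_lt with rfl | hsu
  · simp only [J_self, Matrix.one_mulVec, sub_self]
    exact stronglyMeasurable_const.aestronglyMeasurable
  refine aestronglyMeasurable_of_tendsto_ae_sub (fun m =>
    (measurable_future_eulerEnd (C := C) (α := C.α₀) hsu.le 0
      m).stronglyMeasurable.aestronglyMeasurable) ?_
  filter_upwards [hpath] with ω hω
  have h := (C.isSolution_J L ω (Y s ω) hs hsu.le).tendsto_eulerEnd (L.isCountingPath ω)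
    (X := fun r => L.X r ω) (fun _ _ => rfl) hs hsu
  simp only [J_self, Matrix.one_mulVec] at h
  have h' := (hω.sol s u hs hsu.le).tendsto_eulerEnd (L.isCountingPath ω)
    (X := fun r => L.X r ω) (fun _ _ => rfl) hs hsu
  refine (h'.sub h).congr fun m => ?_
  -- The schemes for Y and for J Y_s start from the same vector, so their difference is the scheme
  -- started from 0, in which Y_s no longer appears.
  have := euler_eq_add (B := C.Bc) (al := C.al) (e := C.e) (α := C.α₀) (mesh s u m)
    (fun i => L.X (grid s u m (i + 1)) ω - L.X (grid s u m i) ω) (Y s ω) (m + 1)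
  simp only [eulerEnd]
  rw [this]
  abel

-- The definition of R involves N and the individual jumps, but its value is eventually attained by
-- grid products that see only increments of X. This is what makes R independent of the initial
-- state.
omit hY hpath in
lemma aestronglyMeasurable_R {t : ℝ} (ht : 0 ≤ t) :
    AEStronglyMeasurable[L.future 0] (C.R L t) P := by
  rcases ht.eq_or_lt with rfl | ht
  · have : C.R L 0 = fun _ => 1 := by
      funext ω; simp [R, L.poisson.zero ω]
    rw [this]
    exact stronglyMeasurable_const.aestronglyMeasurable
  refine aestronglyMeasurable_of_tendsto_ae_sub (f := fun m ω => ∏ i ∈ Finset.range (m + 1),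
    (1 + C.ρ * |L.X (grid 0 t m (i + 1)) ω - L.X (grid 0 t m i) ω|)) (fun m => ?_)
    (ae_of_all _ fun ω => ?_)
  · refine (Measurable.stronglyMeasurable ?_).aestronglyMeasurable
    exact measurable_prod_range (m + 1) (φ := fun x => 1 + C.ρ * |x|) (by fun_prop) fun i =>
      L.measurable_future (le_grid ht.le m i) (le_grid ht.le m (i + 1))
  · have h := (L.isCountingPath ω).eventually_prod_grid (X := fun r => L.X r ω)
      (fun _ _ => rfl) le_rfl ht (fun x => 1 + C.ρ * |x|) (by simp)
    refine tendsto_const_nhds.congr' ?_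
    filter_upwards [h] with m hm
    rw [hm, R, L.poisson.zero ω, Finset.range_eq_Ico]

omit hY hpath in
lemma integrable_R_pow {t : ℝ} (ht : 0 ≤ t) {k : ℕ} (hk : Even k) {K : Finset (Fin L.l)}
    (hK : L.Charges K) (hfin : ∀ j ∈ K, ∫⁻ z, ENNReal.ofReal (z ^ k) ∂(L.F j) < ∞) :
    Integrable (fun ω => C.R L t ω ^ k) P := by
  refine ⟨((aestronglyMeasurable_R ht).mono (L.future_le le_rfl)).pow k, ?_⟩
  have h := L.lintegral_prod_jumps_lt_top (f := fun z => ENNReal.ofReal ((1 + C.ρ * |z|) ^ k))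
    (by fun_prop) hK (fun j hj => by
      have := L.F_prob j
      exact lintegral_one_add_pow_lt_top C.ρ_pos.le hk (hfin j hj)) ht
  rw [hasFiniteIntegral_iff_norm]
  refine lt_of_le_of_lt (lintegral_mono fun ω => ?_) h
  have hρ := C.ρ_pos
  rw [Real.norm_of_nonneg (by have := C.one_le_R L t ω; positivity), R, ← Finset.prod_pow,
    ENNReal.ofReal_prod_of_nonneg fun _ _ => by positivity]

omit hpath in
lemma IsState.indepFun_dom {t : ℝ} (ht : 0 ≤ t) (k : ℕ) :
    IndepFun (fun ω => (‖Y 0 ω‖ + 1) ^ k) (fun ω => (C.R L t ω ^ 2) ^ k) P := by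
  have h := indepFun_of_indep_sub (hY.indep_past_future le_rfl)
    ((measurable_past_zero (L := L) (Y := Y) 0).stronglyMeasurable.aestronglyMeasurable)
    (aestronglyMeasurable_R (C := C) (L := L) ht)
  exact h.comp (φ := fun y => (‖y‖ + 1) ^ k) (ψ := fun x => (x ^ 2) ^ k) (by fun_prop)
    (by fun_prop)

omit hpath in
lemma IsState.integrable_dom (hY₁ : Integrable (Y 0) P) {t : ℝ} (ht : 0 ≤ t) :
    Integrable (C.dom L Y t) P := by
  have hR : Integrable (fun ω => C.R L t ω ^ 2) P :=
    integrable_R_pow ht (by decide) L.charges_univ fun j _ => by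
      have := L.F_sq j
      exact this.lintegral_lt_top
  have h := (hY.indepFun_dom ht 1)
  simp only [pow_one] at h
  exact h.integrable_mul (hY₁.norm.add (integrable_const 1)) hR

-- Independence of the initial state and R separates the two factors. Fourth moments of the marks
-- are known only for the types that occur, and `charges_positiveTypes` shows that these are enough.
omit hpath in
lemma IsState.integrable_dom_sq (h4 : ∀ s, 0 ≤ s → Integrable (fun ω => L.S s ω ^ 4) P)
    (hY₂ : MemLp (Y 0) 2 P) {t : ℝ} (ht : 0 ≤ t) :
    Integrable (fun ω => C.dom L Y t ω ^ 2) P := by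
  have hR : Integrable (fun ω => (C.R L t ω ^ 2) ^ 2) P := by
    simp only [← pow_mul]
    exact integrable_R_pow ht (by decide) L.charges_positiveTypes fun j hj =>
      L.lintegral_pow_four_lt_top h4 hj
  have hY0 : Integrable (fun ω => (‖Y 0 ω‖ + 1) ^ 2) P :=
    (hY₂.norm.add (memLp_const 1)).integrable_sq
  refine ((hY.indepFun_dom ht 2).integrable_mul hY0 hR).congr (ae_of_all _ fun ω => ?_)
  simp [dom, mul_pow]

end Params

lemma integrable_mul_of_abs_le {Ω : Type*} {mΩ : MeasurableSpace Ω} {P : Measure Ω}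
    {X f D : Ω → ℝ} {c : ℝ} (hX : AEStronglyMeasurable X P) (hf : AEStronglyMeasurable f P)
    (hD : ∀ ω, 0 ≤ D ω) (hle : ∀ᵐ ω ∂P, |f ω| ≤ c * D ω)
    (hXD : Integrable (fun ω => X ω * D ω) P) : Integrable (fun ω => X ω * f ω) P := by
  refine (hXD.norm.const_mul c).mono' (hX.mul hf) ?_
  filter_upwards [hle] with ω hω
  rw [norm_mul, norm_mul, Real.norm_eq_abs, Real.norm_eq_abs, Real.norm_of_nonneg (hD ω)]
  nlinarith [abs_nonneg (X ω)]

lemma tendsto_integral_mul_of_abs_le {Ω ι : Type*} {mΩ : MeasurableSpace Ω} {P : Measure Ω}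
    {l : Filter ι} [l.IsCountablyGenerated] {X f D : Ω → ℝ} {F : ι → Ω → ℝ} {c : ℝ}
    (hX : AEStronglyMeasurable X P) (hF : ∀ᶠ i in l, AEStronglyMeasurable (F i) P)
    (hD : ∀ ω, 0 ≤ D ω) (hle : ∀ᶠ i in l, ∀ᵐ ω ∂P, |F i ω| ≤ c * D ω)
    (hXD : Integrable (fun ω => X ω * D ω) P)
    (hlim : ∀ᵐ ω ∂P, Tendsto (fun i => F i ω) l (𝓝 (f ω))) :
    Tendsto (fun i => ∫ ω, X ω * F i ω ∂P) l (𝓝 (∫ ω, X ω * f ω ∂P)) := by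
  refine tendsto_integral_filter_of_dominated_convergence (fun ω => c * ‖X ω * D ω‖)
    (hF.mono fun i hi => hX.mul hi) (hle.mono fun i hi => ?_) (hXD.norm.const_mul c) ?_
  · filter_upwards [hi] with ω hω
    rw [norm_mul, norm_mul, Real.norm_eq_abs, Real.norm_eq_abs, Real.norm_of_nonneg (hD ω)]
    nlinarith [abs_nonneg (X ω)]
  · filter_upwards [hlim] with ω hω using hω.const_mul _

/-! ### Orthogonality and isometry for increments of G, weighted by the past -/

namespace Params

variable {p q : ℕ} (C : Params p q)
variable {Ω : Type*} [mΩ : MeasurableSpace Ω] {P : Measure Ω} [IsProbabilityMeasure P]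
  (L : SimpleSemiLevy P) (Y : ℝ → Ω → Fin q → ℝ)

/-- The square root of the dominating random variable. -/
noncomputable def sqrtDom (t : ℝ) (ω : Ω) : ℝ := Real.sqrt (‖Y 0 ω‖ + 1) * C.R L t ω

lemma sqrtDom_nonneg (t : ℝ) (ω : Ω) : 0 ≤ C.sqrtDom L Y t ω :=
  mul_nonneg (Real.sqrt_nonneg _) (zero_le_one.trans (C.one_le_R L t ω))

lemma dom_nonneg (t : ℝ) (ω : Ω) : 0 ≤ C.dom L Y t ω := zero_le_one.trans (C.one_le_dom L Y t ω)

lemma gBound_nonneg {s t : ℝ} (hst : s ≤ t) : 0 ≤ C.gBound L s t := by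
  have h := C.ρ_pos
  have h' : 0 ≤ ∫ u in s..t, |L.driftDensity u| :=
    intervalIntegral.integral_nonneg hst fun u _ => abs_nonneg _
  unfold gBound volBound
  positivity

variable {C L Y} (hY : C.IsState L Y)
  (hpath : ∀ᵐ ω ∂P, C.IsStatePath L (fun u => Y u ω) ω)

include hpath

lemma aestronglyMeasurable_vol {u s : ℝ} (hu : 0 ≤ u) (hus : u ≤ s) :
    AEStronglyMeasurable[past L Y s] (fun ω => C.vol (Y u ω)) P :=
  C.continuous_vol.comp_aestronglyMeasurable (aestronglyMeasurable_state hpath hu hus)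

omit hpath in
lemma aestronglyMeasurable_S_sub {s t : ℝ} (hst : s ≤ t) :
    AEStronglyMeasurable[L.future s] (fun ω => L.S t ω - L.S s ω) P := by
  have h := L.measurable_future (s := s) (u := s) (v := t) le_rfl hst
  have e : (fun ω => L.S t ω - L.S s ω)
      = fun ω => (L.drift t - L.drift s) + (L.X t ω - L.X s ω) := funext fun ω => L.S_sub_S s t ω
  rw [e]
  exact (h.const_add _).stronglyMeasurable.aestronglyMeasurable

include hY

lemma aestronglyMeasurable_riemann {s t : ℝ} (hs : 0 ≤ s) (hst : s ≤ t) (m k : ℕ) :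
    AEStronglyMeasurable (C.riemann L Y s t m k) P := by
  have h : ∀ i, AEStronglyMeasurable (fun ω => Real.sqrt (C.vol (Y (grid s t m i) ω)) *
      (L.S (grid s t m (i + 1)) ω - L.S (grid s t m i) ω)) P := fun i =>
    (Real.continuous_sqrt.comp_aestronglyMeasurable ((aestronglyMeasurable_vol hpath
      (hs.trans (le_grid hst m i)) le_rfl).mono (hY.past_le _))).mul
      ((L.measurable_S (hs.trans (le_grid hst m _))).sub
        (L.measurable_S (hs.trans (le_grid hst m _)))).aestronglyMeasurable
  exact Finset.aestronglyMeasurable_fun_sum _ fun i _ => h i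

lemma aestronglyMeasurable_G_sub {s t : ℝ} (hs : 0 ≤ s) (hst : s < t) :
    AEStronglyMeasurable (fun ω => C.G L Y t ω - C.G L Y s ω) P := by
  refine aestronglyMeasurable_of_tendsto_ae atTop
    (fun m => aestronglyMeasurable_riemann hY hpath hs hst.le m (m + 1)) ?_
  filter_upwards [hpath] with ω hω using hω.tendsto_riemann hs hst

omit hY in
/-- The Riemann sums are adapted. -/
lemma aestronglyMeasurable_past_riemann {s t : ℝ} (hs : 0 ≤ s) (hst : s ≤ t) (m : ℕ) :
    ∀ k, AEStronglyMeasurable[past L Y (grid s t m k)] (C.riemann L Y s t m k) P := by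
  intro k
  induction k with
  | zero =>
    have : C.riemann L Y s t m 0 = fun _ => 0 := by funext ω; simp [riemann]
    rw [this]
    exact stronglyMeasurable_const.aestronglyMeasurable
  | succ k ih =>
    have e : C.riemann L Y s t m (k + 1) = fun ω => C.riemann L Y s t m k ω
        + Real.sqrt (C.vol (Y (grid s t m k) ω)) *
          (L.S (grid s t m (k + 1)) ω - L.S (grid s t m k) ω) := by
      funext ω; rw [riemann, Finset.sum_range_succ]; rfl
    have hg : grid s t m k ≤ grid s t m (k + 1) := grid_monotone hst m (Nat.le_succ k)
    have hg0 : ∀ i, 0 ≤ grid s t m i := fun i => hs.trans (le_grid hst m i)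
    have hS : AEStronglyMeasurable[past L Y (grid s t m (k + 1))]
        (fun ω => L.S (grid s t m (k + 1)) ω - L.S (grid s t m k) ω) P := by
      have e' : (fun ω => L.S (grid s t m (k + 1)) ω - L.S (grid s t m k) ω)
          = fun ω => (L.drift (grid s t m (k + 1)) - L.drift (grid s t m k))
            + (L.X (grid s t m (k + 1)) ω - L.X (grid s t m k) ω) :=
        funext fun ω => L.S_sub_S _ _ ω
      rw [e']
      exact (((measurable_past_X (hg0 _) le_rfl).sub
        (measurable_past_X (hg0 _) hg)).const_add _).stronglyMeasurable.aestronglyMeasurable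
    rw [e]
    exact (ih.mono (past_mono hg)).add ((Real.continuous_sqrt.comp_aestronglyMeasurable
      (aestronglyMeasurable_vol hpath (hg0 k) hg)).mul hS)

omit hY in
/-- The increments of `G` are adapted. -/
lemma aestronglyMeasurable_past_G_sub {s t : ℝ} (hs : 0 ≤ s) (hst : s < t) :
    AEStronglyMeasurable[past L Y t] (fun ω => C.G L Y t ω - C.G L Y s ω) P := by
  refine aestronglyMeasurable_of_tendsto_ae_sub
    (f := fun m => C.riemann L Y s t m (m + 1)) (fun m => ?_) ?_
  · have h := aestronglyMeasurable_past_riemann (C := C) (L := L) (Y := Y) hpath hs hst.le m (m + 1)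
    rwa [grid_last] at h
  · filter_upwards [hpath] with ω hω using hω.tendsto_riemann hs hst

section Weighted

variable (hmean : ∀ t, 0 ≤ t → ∫ ω, L.S t ω ∂P = 0) {s t : ℝ} (hs : 0 ≤ s) (hst : s < t)
  {X : Ω → ℝ} (hX : AEStronglyMeasurable[past L Y s] X P)
include hs hst hX

lemma integrable_mul_riemann
    (hXd : Integrable (fun ω => X ω * C.sqrtDom L Y t ω) P) (m : ℕ) {k : ℕ} (hk : k ≤ m + 1) :
    Integrable (fun ω => X ω * C.riemann L Y s t m k ω) P := by
  refine integrable_mul_of_abs_le (hX.mono (hY.past_le s))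
    (aestronglyMeasurable_riemann hY hpath hs hst.le m k) (C.sqrtDom_nonneg L Y t)
    (c := C.gBound L s t) ?_ hXd
  filter_upwards [hpath] with ω hω using hω.abs_riemann_le hs hst.le m hk

-- Each summand is a variable of the past at the grid point times a later increment of S, which is
-- centred and independent of it.
include hmean in
lemma integral_mul_riemann
    (hXd : Integrable (fun ω => X ω * C.sqrtDom L Y t ω) P) (m : ℕ) :
    ∀ k ≤ m + 1, ∫ ω, X ω * C.riemann L Y s t m k ω ∂P = 0 := by
  intro k hk
  induction k with
  | zero => simp [riemann]
  | succ k ih =>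
    have hg : grid s t m k ≤ grid s t m (k + 1) := grid_monotone hst.le m (Nat.le_succ k)
    have hsg := le_grid hst.le m k
    set D : Ω → ℝ := fun ω => L.S (grid s t m (k + 1)) ω - L.S (grid s t m k) ω with hD
    have e : ∀ ω, X ω * C.riemann L Y s t m (k + 1) ω - X ω * C.riemann L Y s t m k ω
        = (X ω * Real.sqrt (C.vol (Y (grid s t m k) ω))) * D ω := by
      intro ω; rw [riemann, Finset.sum_range_succ, ← riemann]; ring
    have h1 := integrable_mul_riemann hY hpath hs hst hX hXd m (k := k) (by omega)
    have h2 := integrable_mul_riemann hY hpath hs hst hX hXd m hk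
    have hm : AEStronglyMeasurable[past L Y (grid s t m k)]
        (fun ω => X ω * Real.sqrt (C.vol (Y (grid s t m k) ω))) P :=
      (hX.mono (past_mono hsg)).mul (Real.continuous_sqrt.comp_aestronglyMeasurable
        (aestronglyMeasurable_vol hpath (hs.trans hsg) le_rfl))
    have hDm := aestronglyMeasurable_S_sub (L := L) hg
    have hind := indepFun_of_indep_sub (hY.indep_past_future (hs.trans hsg)) hm hDm
    have h3 := hind.integral_mul_eq_mul_integral (hm.mono (hY.past_le _))
      (hDm.mono (L.future_le (hs.trans hsg)))
    rw [L.integral_S_sub hmean (hs.trans hsg) hg, mul_zero] at h3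
    have h4 := integral_sub h2 h1
    simp only [e] at h4
    rw [ih (by omega), sub_zero] at h4
    rw [← h4]
    exact h3

include hmean in
/-- The increments of `G` are orthogonal to the past. -/
lemma integral_mul_G_sub (hXd : Integrable (fun ω => X ω * C.sqrtDom L Y t ω) P) :
    ∫ ω, X ω * (C.G L Y t ω - C.G L Y s ω) ∂P = 0 := by
  have h := tendsto_integral_mul_of_abs_le (l := atTop)
    (F := fun m => C.riemann L Y s t m (m + 1)) (c := C.gBound L s t)
    (f := fun ω => C.G L Y t ω - C.G L Y s ω) (hX.mono (hY.past_le s))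
    (Eventually.of_forall fun m => aestronglyMeasurable_riemann hY hpath hs hst.le m (m + 1))
    (C.sqrtDom_nonneg L Y t) (Eventually.of_forall fun m => by
      filter_upwards [hpath] with ω hω using hω.abs_riemann_le hs hst.le m le_rfl) hXd
    (by filter_upwards [hpath] with ω hω using hω.tendsto_riemann hs hst)
  refine tendsto_nhds_unique h ?_
  simp only [integral_mul_riemann hY hpath hmean hs hst hX hXd _ _ le_rfl]
  exact tendsto_const_nhds

variable (hXd : Integrable (fun ω => X ω * C.dom L Y t ω) P)
include hXd

omit hst in
lemma integrable_mul_vol {u : ℝ} (hu : 0 ≤ u) (hut : u ≤ t) :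
    Integrable (fun ω => X ω * C.vol (Y u ω)) P := by
  refine integrable_mul_of_abs_le (hX.mono (hY.past_le s))
    ((aestronglyMeasurable_vol hpath hu le_rfl).mono (hY.past_le _)) (C.dom_nonneg L Y t)
    (c := (|C.α₀| + ‖C.al‖) * Real.exp (‖C.Bc‖ * t)) ?_ hXd
  filter_upwards [hpath] with ω hω
  refine (hω.abs_vol_le hu hut).trans ?_
  have := C.dom_mono L Y hu hut ω
  gcongr

omit hst in
lemma abs_integral_mul_vol_le {u : ℝ} (hu : 0 ≤ u) (hut : u ≤ t) :
    ‖∫ ω, X ω * C.vol (Y u ω) ∂P‖ ≤ ∫ ω, (|C.α₀| + ‖C.al‖) * Real.exp (‖C.Bc‖ * t) *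
      ‖X ω * C.dom L Y t ω‖ ∂P := by
  refine (norm_integral_le_integral_norm _).trans (integral_mono_ae
    (integrable_mul_vol hY hpath hs hX hXd hu hut).norm (hXd.norm.const_mul _) ?_)
  filter_upwards [hpath] with ω hω
  have h1 := hω.abs_vol_le hu hut
  have h2 := C.dom_mono L Y hu hut ω
  rw [norm_mul, norm_mul, Real.norm_eq_abs, Real.norm_eq_abs,
    Real.norm_of_nonneg (C.dom_nonneg L Y t ω)]
  calc |X ω| * |C.vol (Y u ω)|
      ≤ |X ω| * ((|C.α₀| + ‖C.al‖) * Real.exp (‖C.Bc‖ * t) * C.dom L Y t ω) := by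
        gcongr
        exact h1.trans (by gcongr)
    _ = _ := by ring

-- The function u ↦ E[X vol(Y_u)] has E[X V_u] as its left limit. It can therefore be handled by the
-- same step-function lemmas as a path, and no joint measurability in (u, ω) is needed.
omit hst in
lemma tendsto_integral_mul_vol {u : ℝ} (hu : 0 < u) (hut : u ≤ t) :
    Tendsto (fun r => ∫ ω, X ω * C.vol (Y r ω) ∂P) (𝓝[<] u)
      (𝓝 (∫ ω, X ω * C.V Y u ω ∂P)) := by
  have hev : ∀ᶠ r in 𝓝[<] u, r ∈ Set.Ico 0 u := Ico_mem_nhdsLT hu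
  refine tendsto_integral_mul_of_abs_le (hX.mono (hY.past_le s))
    (c := (|C.α₀| + ‖C.al‖) * Real.exp (‖C.Bc‖ * t))
    (hev.mono fun r hr => (aestronglyMeasurable_vol hpath hr.1 le_rfl).mono (hY.past_le _))
    (C.dom_nonneg L Y t) (hev.mono fun r hr => ?_) hXd ?_
  · filter_upwards [hpath] with ω hω
    refine (hω.abs_vol_le hr.1 (hr.2.le.trans hut)).trans ?_
    have := C.dom_mono L Y hr.1 (hr.2.le.trans hut) ω
    gcongr
  · filter_upwards [hpath] with ω hω
    rw [C.V_eq hu]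
    exact (C.continuous_vol.tendsto _).comp (hω.left_lim u hu)

lemma intervalIntegrable_integral_mul_V {d : ℝ → ℝ} (hd : IntervalIntegrable d volume s t) :
    IntervalIntegrable (fun u => d u • ∫ ω, X ω * C.V Y u ω ∂P) volume s t :=
  intervalIntegrable_smul_leftLim hst
    (fun _ hu => tendsto_integral_mul_vol hY hpath hs hX hXd (hs.trans_lt hu.1) hu.2)
    (fun _ hu => abs_integral_mul_vol_le hY hpath hs hX hXd (hs.trans hu.1) hu.2) hd

lemma integrable_mul_riemann_mul (m : ℕ) {j k : ℕ} (hj : j ≤ m + 1) (hk : k ≤ m + 1) :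
    Integrable (fun ω => X ω * (C.riemann L Y s t m j ω * C.riemann L Y s t m k ω)) P := by
  refine integrable_mul_of_abs_le (hX.mono (hY.past_le s))
    ((aestronglyMeasurable_riemann hY hpath hs hst.le m j).mul
      (aestronglyMeasurable_riemann hY hpath hs hst.le m k)) (C.dom_nonneg L Y t)
    (c := C.gBound L s t ^ 2) ?_ hXd
  filter_upwards [hpath] with ω hω
  have h1 := hω.abs_riemann_le hs hst.le m hj
  have h2 := hω.abs_riemann_le hs hst.le m hk
  have h3 := C.gBound_nonneg L hst.le
  have h4 := C.sqrtDom_nonneg L Y t ω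
  rw [sqrtDom] at h4
  rw [abs_mul, ← sqrt_mul_R_sq, ← mul_pow, sq]
  gcongr

include hmean in
/-- The isometry for the Riemann sums. -/
lemma integral_mul_riemann_sq (m : ℕ) :
    ∀ k ≤ m + 1, ∫ ω, X ω * C.riemann L Y s t m k ω ^ 2 ∂P
      = ∑ i ∈ Finset.range k, ∫ u in grid s t m i..grid s t m (i + 1),
        (L.sqAt u * L.rate u) • ∫ ω, X ω * C.vol (Y (grid s t m i) ω) ∂P := by
  intro k hk
  induction k with
  | zero => simp [riemann]
  | succ k ih =>
    have hg : grid s t m k ≤ grid s t m (k + 1) := grid_monotone hst.le m (Nat.le_succ k)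
    have hsg := le_grid hst.le m k
    have hg0 := hs.trans hsg
    have hgt : grid s t m k ≤ t := grid_le hst.le (by omega)
    set D : Ω → ℝ := fun ω => L.S (grid s t m (k + 1)) ω - L.S (grid s t m k) ω with hD
    set φ : Ω → ℝ := fun ω => Real.sqrt (C.vol (Y (grid s t m k) ω)) with hφ
    have e : ∀ ω, C.riemann L Y s t m (k + 1) ω = C.riemann L Y s t m k ω + φ ω * D ω := by
      intro ω; rw [riemann, Finset.sum_range_succ, ← riemann]
    have hφm : AEStronglyMeasurable[past L Y (grid s t m k)] φ P :=
      Real.continuous_sqrt.comp_aestronglyMeasurable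
        (aestronglyMeasurable_vol hpath hg0 le_rfl)
    have hXm := hX.mono (past_mono hsg)
    have hDm := aestronglyMeasurable_S_sub (L := L) hg
    have hrm := aestronglyMeasurable_past_riemann (C := C) (L := L) (Y := Y) hpath hs hst.le m k
    have hvm := aestronglyMeasurable_vol (C := C) (L := L) (Y := Y) hpath hg0 (le_refl (grid s t m k))
    have hkk := integrable_mul_riemann_mul hY hpath hs hst hX hXd m
      (show k ≤ m + 1 by omega) (show k ≤ m + 1 by omega)
    have hks := integrable_mul_riemann_mul hY hpath hs hst hX hXd m
      (show k ≤ m + 1 by omega) hk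
    have hss := integrable_mul_riemann_mul hY hpath hs hst hX hXd m hk hk
    -- Since φ D is the difference of two consecutive Riemann sums, the cross term and the square
    -- are combinations of products of Riemann sums, whose integrability is known.
    have hcross : Integrable (fun ω => (X ω * (C.riemann L Y s t m k ω * φ ω)) * D ω) P :=
      (hks.sub hkk).congr (ae_of_all _ fun ω => by simp only [Pi.sub_apply, e]; ring)
    have hsq : Integrable (fun ω => (X ω * φ ω ^ 2) * D ω ^ 2) P :=
      ((hss.sub (hks.const_mul 2)).add hkk).congr
        (ae_of_all _ fun ω => by simp only [Pi.sub_apply, Pi.add_apply, e]; ring)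
    have hcm : AEStronglyMeasurable[past L Y (grid s t m k)]
        (fun ω => X ω * (C.riemann L Y s t m k ω * φ ω)) P := hXm.mul (hrm.mul hφm)
    have hcross0 : ∫ ω, (X ω * (C.riemann L Y s t m k ω * φ ω)) * D ω ∂P = 0 := by
      have h := (indepFun_of_indep_sub (hY.indep_past_future hg0) hcm
        hDm).integral_mul_eq_mul_integral (hcm.mono (hY.past_le _)) (hDm.mono (L.future_le hg0))
      rw [L.integral_S_sub hmean hg0 hg, mul_zero] at h
      exact h
    have hXv : AEStronglyMeasurable[past L Y (grid s t m k)]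
        (fun ω => X ω * C.vol (Y (grid s t m k) ω)) P := hXm.mul hvm
    -- `Real.sqrt` is 0 at negative arguments, so non-negativity at the grid point is essential
    -- here.
    have hφv : ∀ᵐ ω ∂P, φ ω ^ 2 = C.vol (Y (grid s t m k) ω) := by
      filter_upwards [hpath] with ω hω using Real.sq_sqrt (hω.vol_nonneg hg0)
    have hsq1 : ∫ ω, (X ω * φ ω ^ 2) * D ω ^ 2 ∂P
        = (∫ ω, X ω * C.vol (Y (grid s t m k) ω) ∂P) *
          ∫ u in grid s t m k..grid s t m (k + 1), L.sqAt u * L.rate u := by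
      rw [← L.integral_S_sub_sq hmean hg0 hg]
      have h := ((indepFun_of_indep_sub (hY.indep_past_future hg0) hXv hDm).comp
        (φ := id) (ψ := fun x => x ^ 2) measurable_id
        (by fun_prop)).integral_mul_eq_mul_integral (hXv.mono (hY.past_le _))
        ((continuous_pow 2).comp_aestronglyMeasurable (hDm.mono (L.future_le hg0)))
      refine Eq.trans (integral_congr_ae ?_) h
      filter_upwards [hφv] with ω hω
      simp only [Pi.mul_apply, Function.comp_apply, id]
      rw [hω]
    rw [Finset.sum_range_succ, ← ih (by omega), intervalIntegral.integral_smul_const, smul_eq_mul,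
      mul_comm (∫ u in grid s t m k..grid s t m (k + 1), L.sqAt u * L.rate u), ← hsq1]
    have e2 : ∀ ω, X ω * C.riemann L Y s t m (k + 1) ω ^ 2
        = X ω * C.riemann L Y s t m k ω ^ 2 + (2 * ((X ω * (C.riemann L Y s t m k ω * φ ω)) * D ω)
          + (X ω * φ ω ^ 2) * D ω ^ 2) := by
      intro ω; rw [e]; ring
    have hkk' : Integrable (fun ω => X ω * C.riemann L Y s t m k ω ^ 2) P :=
      hkk.congr (ae_of_all _ fun ω => by simp only; ring)
    simp only [e2]
    have hsum : Integrable (fun ω => 2 * ((X ω * (C.riemann L Y s t m k ω * φ ω)) * D ω)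
        + (X ω * φ ω ^ 2) * D ω ^ 2) P := (hcross.const_mul 2).add hsq
    rw [integral_add hkk' hsum, integral_add (hcross.const_mul 2) hsq, integral_const_mul, hcross0]
    ring

include hmean in
/-- The conditional isometry for the increments of `G`. -/
lemma integral_mul_G_sub_sq :
    ∫ ω, X ω * (C.G L Y t ω - C.G L Y s ω) ^ 2 ∂P
      = ∫ u in s..t, (L.sqAt u * L.rate u) • ∫ ω, X ω * C.V Y u ω ∂P := by
  have h := tendsto_integral_mul_of_abs_le (l := atTop) (D := C.dom L Y t)
    (F := fun m ω => C.riemann L Y s t m (m + 1) ω ^ 2) (c := C.gBound L s t ^ 2)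
    (f := fun ω => (C.G L Y t ω - C.G L Y s ω) ^ 2) (hX.mono (hY.past_le s))
    (Eventually.of_forall fun m =>
      (aestronglyMeasurable_riemann hY hpath hs hst.le m (m + 1)).pow 2)
    (C.dom_nonneg L Y t) (Eventually.of_forall fun m => by
      filter_upwards [hpath] with ω hω
      rw [← sqrt_mul_R_sq, ← mul_pow, abs_pow]
      exact pow_le_pow_left₀ (abs_nonneg _) (hω.abs_riemann_le hs hst.le m le_rfl) 2) hXd
    (by filter_upwards [hpath] with ω hω using (hω.tendsto_riemann hs hst).pow 2)
  refine tendsto_nhds_unique h ?_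
  have hd := L.sqAt_rate_intervalIntegrable hs hst.le
  -- The discrete isometry is the integral of a deterministic step function along `gridFloor`, so it
  -- converges to the integral of the left limits.
  have e : ∀ m, ∫ ω, X ω * C.riemann L Y s t m (m + 1) ω ^ 2 ∂P
      = ∫ u in s..t, (L.sqAt u * L.rate u) •
        ∫ ω, X ω * C.vol (Y (gridFloor s t m u) ω) ∂P := by
    intro m
    rw [integral_mul_riemann_sq hY hpath hmean hs hst hX hXd m _ le_rfl]
    refine sum_grid_integral hst
      (fun x u => (L.sqAt u * L.rate u) • ∫ ω, X ω * C.vol (Y x ω) ∂P) m fun i _ => ?_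
    exact (L.sqAt_rate_intervalIntegrable (hs.trans (le_grid hst.le m i))
      (grid_monotone hst.le m (Nat.le_succ i))).mul_const _
  simp only [e]
  exact tendsto_integral_gridFloor hst
    (y := fun r => ∫ ω, X ω * C.vol (Y r ω) ∂P)
    (fun _ hu => tendsto_integral_mul_vol hY hpath hs hX hXd (hs.trans_lt hu.1) hu.2)
    (fun _ hu => abs_integral_mul_vol_le hY hpath hs hX hXd (hs.trans hu.1) hu.2) hd

end Weighted

end Params

/-! ### The mean of J and the propagation of covariances -/

namespace Params

variable {p q : ℕ} (C : Params p q)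
variable {Ω : Type*} [mΩ : MeasurableSpace Ω] {P : Measure Ω}
  (L : SimpleSemiLevy P) (Y : ℝ → Ω → Fin q → ℝ)

lemma J_mulVec_single (s u : ℝ) (ω : Ω) (i k : Fin q) :
    (C.J L s u ω *ᵥ Pi.single k 1) i = C.J L s u ω i k := by simp

lemma tendsto_J {s u : ℝ} (hs : 0 ≤ s) (hsu : s < u) (ω : Ω) (i k : Fin q) :
    Tendsto (fun x => C.J L s x ω i k) (𝓝[<] u) (𝓝 (C.Jminus L s u ω i k)) := by
  have h : ∀ i k, Tendsto (fun x => C.J L s x ω i k) (𝓝[<] u)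
      (𝓝 (Function.leftLim (fun x => C.J L s x ω *ᵥ Pi.single k 1) u i)) := fun i k => by
    have := (C.isSolution_J L ω (Pi.single k 1) hs hsu.le).left_lim u ⟨hsu, le_rfl⟩
    simpa only [J_mulVec_single] using (tendsto_pi_nhds.1 this) i
  have hM : Tendsto (fun x => C.J L s x ω) (𝓝[<] u) (𝓝 (Matrix.of fun i k =>
      Function.leftLim (fun x => C.J L s x ω *ᵥ Pi.single k 1) u i)) :=
    tendsto_pi_nhds.2 fun i => tendsto_pi_nhds.2 fun k => h i k
  rw [Jminus, leftLim_eq_of_tendsto hM]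
  exact h i k

/-- The matrix of the means of the entries of `J`. -/
noncomputable def meanFlow (s u : ℝ) : Matrix (Fin q) (Fin q) ℝ :=
  fun i k => ∫ ω, C.J L s u ω i k ∂P

variable [IsProbabilityMeasure P]
variable {C L Y} (hY : C.IsState L Y)

lemma aestronglyMeasurable_J_apply {s u : ℝ} (hs : 0 ≤ s) (hsu : s ≤ u) (i k : Fin q) :
    AEStronglyMeasurable[L.future s] (fun ω => C.J L s u ω i k) P := by
  have h := (continuous_apply i).comp_aestronglyMeasurable
    (aestronglyMeasurable_J (C := C) (L := L) hs hsu (Pi.single k 1))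
  simpa only [J_mulVec_single] using h

lemma integrable_R_sq {t : ℝ} (ht : 0 ≤ t) : Integrable (fun ω => C.R L t ω ^ 2) P :=
  integrable_R_pow ht (by decide) L.charges_univ fun j _ => (L.F_sq j).lintegral_lt_top

lemma integrable_J_apply {s u : ℝ} (hs : 0 ≤ s) (hsu : s ≤ u) (i k : Fin q) :
    Integrable (fun ω => C.J L s u ω i k) P :=
  ((integrable_R_sq (hs.trans hsu)).const_mul (2 * Real.exp (‖C.Bc‖ * (u - s)))).mono'
    ((aestronglyMeasurable_J_apply hs hsu i k).mono (L.future_le hs))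
    (ae_of_all _ fun ω => C.abs_J_mulVec_single_le L hs hsu le_rfl ω i k)

lemma abs_meanFlow_le {s u t : ℝ} (hs : 0 ≤ s) (hsu : s ≤ u) (hut : u ≤ t) (i k : Fin q) :
    |C.meanFlow L s u i k| ≤
      ∫ ω, 2 * Real.exp (‖C.Bc‖ * (t - s)) * C.R L t ω ^ 2 ∂P := by
  refine (norm_integral_le_integral_norm _).trans (integral_mono
    (integrable_J_apply hs hsu i k).norm
    ((integrable_R_sq (hs.trans (hsu.trans hut))).const_mul _) fun ω => ?_)
  exact C.abs_J_mulVec_single_le L hs hsu hut ω i k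

lemma tendsto_meanFlow {s u : ℝ} (hs : 0 ≤ s) (hsu : s < u) (i k : Fin q) :
    Tendsto (fun x => C.meanFlow L s x i k) (𝓝[<] u) (𝓝 (C.meanJ L s u i k)) := by
  have hev : ∀ᶠ x in 𝓝[<] u, x ∈ Set.Ico s u := Ico_mem_nhdsLT hsu
  exact tendsto_integral_filter_of_dominated_convergence
    (fun ω => 2 * Real.exp (‖C.Bc‖ * (u - s)) * C.R L u ω ^ 2)
    (hev.mono fun x hx => (aestronglyMeasurable_J_apply hs hx.1 i k).mono (L.future_le hs))
    (hev.mono fun x hx => ae_of_all _ fun ω =>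
      C.abs_J_mulVec_single_le L hs hx.1 hx.2.le ω i k)
    ((integrable_R_sq (hs.trans hsu.le)).const_mul _)
    (ae_of_all _ fun ω => C.tendsto_J L hs hsu ω i k)

lemma integrable_Jminus {s u : ℝ} (hs : 0 ≤ s) (hsu : s < u) (i k : Fin q) :
    Integrable (fun ω => C.Jminus L s u ω i k) P := by
  have hev : ∀ᶠ x in 𝓝[<] u, x ∈ Set.Ico s u := Ico_mem_nhdsLT hsu
  refine ((integrable_R_sq (C := C) (L := L) (hs.trans hsu.le)).const_mul
    (2 * Real.exp (‖C.Bc‖ * (u - s)))).mono' ?_ (ae_of_all _ fun ω => ?_)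
  · refine aestronglyMeasurable_of_tendsto_ae atTop
      (f := fun m ω => C.J L s (gridFloor s u m u) ω i k) (fun m => ?_) (ae_of_all _ fun ω =>
        (C.tendsto_J L hs hsu ω i k).comp (tendsto_gridFloor hsu u))
    exact (aestronglyMeasurable_J_apply hs (gridFloor_mem hsu ⟨hsu, le_rfl⟩ m).1 i k).mono
      (L.future_le hs)
  · refine le_of_tendsto (C.tendsto_J L hs hsu ω i k).norm (hev.mono fun x hx => ?_)
    exact C.abs_J_mulVec_single_le L hs hx.1 hx.2.le ω i k

lemma tendsto_meanFlow_mulVec {s u : ℝ} (hs : 0 ≤ s) (hsu : s < u) (c : Fin q → ℝ) (i : Fin q) :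
    Tendsto (fun x => (C.meanFlow L s x *ᵥ c) i) (𝓝[<] u) (𝓝 ((C.meanJ L s u *ᵥ c) i)) := by
  simp only [Matrix.mulVec, dotProduct]
  exact tendsto_finsetSum _ fun k _ => (tendsto_meanFlow hs hsu i k).mul_const _

lemma tendsto_dot_meanFlow {s u : ℝ} (hs : 0 ≤ s) (hsu : s < u) (c : Fin q → ℝ) :
    Tendsto (fun x => C.a ⬝ᵥ (C.meanFlow L s x *ᵥ c)) (𝓝[<] u)
      (𝓝 (C.a ⬝ᵥ (C.meanJ L s u *ᵥ c))) :=
  tendsto_finsetSum _ fun i _ => (tendsto_meanFlow_mulVec hs hsu c i).const_mul _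

lemma intervalIntegrable_meanJ {s a b : ℝ} (hs : 0 ≤ s) (hsa : s ≤ a) (hab : a < b)
    (c : Fin q → ℝ) (i : Fin q) {d : ℝ → ℝ} (hd : IntervalIntegrable d volume a b) :
    IntervalIntegrable (fun u => d u • (C.meanJ L s u *ᵥ c) i) volume a b := by
  refine intervalIntegrable_smul_leftLim (y := fun u => (C.meanFlow L s u *ᵥ c) i) hab
    (K := ∑ k, (∫ ω, 2 * Real.exp (‖C.Bc‖ * (b - s)) * C.R L b ω ^ 2 ∂P) * |c k|)
    (fun u hu => tendsto_meanFlow_mulVec hs (hsa.trans_lt hu.1) c i) (fun u hu => ?_) hd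
  simp only [Matrix.mulVec, dotProduct, Real.norm_eq_abs]
  refine (Finset.abs_sum_le_sum_abs _ _).trans (Finset.sum_le_sum fun k _ => ?_)
  rw [abs_mul]
  exact mul_le_mul_of_nonneg_right (abs_meanFlow_le hs (hsa.trans hu.1) hu.2 i k) (abs_nonneg _)

variable (hpath : ∀ᵐ ω ∂P, C.IsStatePath L (fun u => Y u ω) ω)
include hpath hY

section

variable {s : ℝ} (hs : 0 ≤ s) {X : Ω → ℝ} (hX : AEStronglyMeasurable[past L Y s] X P)
  (hXd : ∀ u, 0 ≤ u → Integrable (fun ω => X ω * C.dom L Y u ω) P)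
include hs hX hXd

lemma integrable_mul_state (k : Fin q) : Integrable (fun ω => X ω * Y s ω k) P := by
  refine integrable_mul_of_abs_le (hX.mono (hY.past_le s))
    ((continuous_apply k).comp_aestronglyMeasurable
      ((aestronglyMeasurable_state hpath hs le_rfl).mono (hY.past_le s)))
    (C.dom_nonneg L Y s) (c := Real.exp (‖C.Bc‖ * s)) ?_ (hXd s hs)
  filter_upwards [hpath] with ω hω
  have h1 := hω.norm_le hs le_rfl
  have h2 := norm_le_pi_norm (Y s ω) k
  rw [Real.norm_eq_abs] at h2
  show |Y s ω k| ≤ _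
  linarith

end

lemma integrable_one_mul_dom (hY₁ : Integrable (Y 0) P) {u : ℝ} (hu : 0 ≤ u) :
    Integrable (fun ω => (1 : ℝ) * C.dom L Y u ω) P := by
  simpa only [one_mul] using hY.integrable_dom hY₁ hu

section

variable (hY₁ : Integrable (Y 0) P) {s : ℝ} (hs : 0 ≤ s) {X : Ω → ℝ}
  (hX : AEStronglyMeasurable[past L Y s] X P)
  (hXd : ∀ u, 0 ≤ u → Integrable (fun ω => X ω * C.dom L Y u ω) P)
include hY₁ hs

/-- The part of the volatility at time `u` that does not depend on the state at time `s`. -/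
lemma aestronglyMeasurable_vol_remainder {u : ℝ} (hsu : s ≤ u) :
    AEStronglyMeasurable[L.future s]
      (fun ω => C.vol (Y u ω) - C.a ⬝ᵥ (C.J L s u ω *ᵥ Y s ω)) P := by
  have h := C.continuous_vol.comp_aestronglyMeasurable
    (aestronglyMeasurable_K (C := C) (L := L) (Y := Y) hpath hs hsu)
  have e : (fun ω => C.vol (Y u ω) - C.a ⬝ᵥ (C.J L s u ω *ᵥ Y s ω))
      = fun ω => C.vol (Y u ω - C.J L s u ω *ᵥ Y s ω) := by
    funext ω
    rw [vol, vol, map_sub, al_apply C (C.J L s u ω *ᵥ Y s ω)]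
    ring
  rw [e]
  exact h

-- X Y_s belongs to the past at s and J_{s,u} to the future, so the expectation factors entry by
-- entry and no joint moment of J and Y_s is needed.
omit hY₁ in
include hX hXd in
lemma integrable_mul_flow {u : ℝ} (hsu : s ≤ u) (i k : Fin q) :
    Integrable (fun ω => X ω * (C.J L s u ω i k * Y s ω k)) P ∧
      ∫ ω, X ω * (C.J L s u ω i k * Y s ω k) ∂P
        = C.meanFlow L s u i k * ∫ ω, X ω * Y s ω k ∂P := by
  have hm : AEStronglyMeasurable[past L Y s] (fun ω => X ω * Y s ω k) P :=
    hX.mul ((continuous_apply k).comp_aestronglyMeasurable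
      (aestronglyMeasurable_state hpath hs le_rfl))
  have hJ := aestronglyMeasurable_J_apply (C := C) (L := L) hs hsu i k
  have hind := indepFun_of_indep_sub (hY.indep_past_future hs) hm hJ
  have e : (fun ω => X ω * (C.J L s u ω i k * Y s ω k))
      = (fun ω => X ω * Y s ω k) * fun ω => C.J L s u ω i k := by
    funext ω; simp only [Pi.mul_apply]; ring
  rw [e]
  refine ⟨hind.integrable_mul (integrable_mul_state hY hpath hs hX hXd k)
    (integrable_J_apply hs hsu i k), ?_⟩
  rw [hind.integral_mul_eq_mul_integral (hm.mono (hY.past_le s)) (hJ.mono (L.future_le hs)),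
    mul_comm]
  rfl

omit hY₁ in
include hX hXd in
lemma integrable_mul_dot_flow {u : ℝ} (hsu : s ≤ u) :
    Integrable (fun ω => X ω * (C.a ⬝ᵥ (C.J L s u ω *ᵥ Y s ω))) P ∧
      ∫ ω, X ω * (C.a ⬝ᵥ (C.J L s u ω *ᵥ Y s ω)) ∂P
        = C.a ⬝ᵥ (C.meanFlow L s u *ᵥ fun k => ∫ ω, X ω * Y s ω k ∂P) := by
  have e : ∀ ω, X ω * (C.a ⬝ᵥ (C.J L s u ω *ᵥ Y s ω))
      = ∑ i, ∑ k, C.a i * (X ω * (C.J L s u ω i k * Y s ω k)) := by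
    intro ω
    simp only [dotProduct, Matrix.mulVec, Finset.mul_sum]
    exact Finset.sum_congr rfl fun i _ => Finset.sum_congr rfl fun k _ => by ring
  have hi := fun i k => (integrable_mul_flow hY hpath hs hX hXd hsu i k).1.const_mul (C.a i)
  simp only [e]
  refine ⟨integrable_finsetSum _ fun i _ => integrable_finsetSum _ fun k _ => hi i k, ?_⟩
  rw [integral_finsetSum _ fun i _ => integrable_finsetSum _ fun k _ => hi i k]
  simp only [dotProduct, Matrix.mulVec, Finset.mul_sum]
  refine Finset.sum_congr rfl fun i _ => ?_
  rw [integral_finsetSum _ fun k _ => hi i k]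
  refine Finset.sum_congr rfl fun k _ => ?_
  rw [integral_const_mul, (integrable_mul_flow hY hpath hs hX hXd hsu i k).2]

lemma integrable_vol_remainder {u : ℝ} (hsu : s ≤ u) :
    Integrable (fun ω => C.vol (Y u ω) - C.a ⬝ᵥ (C.J L s u ω *ᵥ Y s ω)) P := by
  have h1 := (integrable_mul_vol hY hpath hs (X := fun _ => 1)
    stronglyMeasurable_const.aestronglyMeasurable
    (integrable_one_mul_dom hY hpath hY₁ (hs.trans hsu)) (hs.trans hsu) le_rfl).sub
    (integrable_mul_dot_flow hY hpath hs (X := fun _ => 1)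
      stronglyMeasurable_const.aestronglyMeasurable
      (fun v hv => integrable_one_mul_dom hY hpath hY₁ hv) hsu).1
  exact h1.congr (ae_of_all _ fun ω => by simp)

-- The volatility at u is a' J_{s,u} Y_s plus a remainder that belongs to the future of s. The first
-- part factors through the mean of J, and the second is independent of X.
include hX hXd in
lemma integral_mul_vol_eq (hXi : Integrable X P) {u : ℝ} (hsu : s ≤ u) :
    ∫ ω, X ω * C.vol (Y u ω) ∂P
      = C.a ⬝ᵥ (C.meanFlow L s u *ᵥ fun k => ∫ ω, X ω * Y s ω k ∂P)
        + (∫ ω, X ω ∂P) * ∫ ω, (C.vol (Y u ω) - C.a ⬝ᵥ (C.J L s u ω *ᵥ Y s ω)) ∂P := by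
  have hr := aestronglyMeasurable_vol_remainder hY hpath hY₁ hs hsu
  have hind := indepFun_of_indep_sub (hY.indep_past_future hs) hX hr
  have h1 := hind.integral_mul_eq_mul_integral (hX.mono (hY.past_le s))
    (hr.mono (L.future_le hs))
  have h2 := hind.integrable_mul hXi (integrable_vol_remainder hY hpath hY₁ hs hsu)
  obtain ⟨h3, h4⟩ := integrable_mul_dot_flow hY hpath hs hX hXd hsu
  rw [← h1, ← h4, ← integral_add h3 h2]
  refine integral_congr_ae (ae_of_all _ fun ω => ?_)
  simp only [Pi.mul_apply]
  ring

include hX hXd in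
/-- The covariance of the volatility with a random variable of the past is propagated by the mean
of `J`. -/
lemma integral_mul_V_sub (hXi : Integrable X P) {u : ℝ} (hsu : s < u) :
    (∫ ω, X ω * C.V Y u ω ∂P) - (∫ ω, X ω ∂P) * ∫ ω, (1 : ℝ) * C.V Y u ω ∂P
      = C.a ⬝ᵥ (C.meanJ L s u *ᵥ fun k =>
        (∫ ω, X ω * Y s ω k ∂P) - (∫ ω, X ω ∂P) * ∫ ω, (1 : ℝ) * Y s ω k ∂P) := by
  have hu := hs.trans_lt hsu
  have h1m : AEStronglyMeasurable[past L Y s] (fun _ : Ω => (1 : ℝ)) P :=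
    stronglyMeasurable_const.aestronglyMeasurable
  have h1d := fun v (hv : 0 ≤ v) => integrable_one_mul_dom hY hpath hY₁ hv
  have l1 := tendsto_integral_mul_vol hY hpath hs hX (hXd u hu.le) hu le_rfl
  have l2 := tendsto_integral_mul_vol hY hpath hs h1m (h1d u hu.le) hu le_rfl
  have l3 := tendsto_dot_meanFlow (C := C) (L := L) hs hsu fun k =>
    (∫ ω, X ω * Y s ω k ∂P) - (∫ ω, X ω ∂P) * ∫ ω, (1 : ℝ) * Y s ω k ∂P
  refine tendsto_nhds_unique (l1.sub (l2.const_mul (∫ ω, X ω ∂P))) (l3.congr' ?_)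
  -- Before u, the weights X and 1 meet the same mean remainder, which enters with the factors E X
  -- and 1 and so cancels in the covariance. Left limits then give the statement at u.
  filter_upwards [Ico_mem_nhdsLT hsu] with x hx
  rw [integral_mul_vol_eq hY hpath hY₁ hs hX hXd hXi hx.1,
    integral_mul_vol_eq hY hpath hY₁ hs h1m h1d (integrable_const 1) hx.1]
  have e : (fun k => (∫ ω, X ω * Y s ω k ∂P) - (∫ ω, X ω ∂P) * ∫ ω, (1 : ℝ) * Y s ω k ∂P)
      = (fun k => ∫ ω, X ω * Y s ω k ∂P) - (∫ ω, X ω ∂P) • fun k => ∫ ω, (1 : ℝ) * Y s ω k ∂P :=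
    rfl
  rw [e, Matrix.mulVec_sub, Matrix.mulVec_smul, dotProduct_sub, dotProduct_smul, smul_eq_mul]
  simp only [integral_const, probReal_univ, smul_eq_mul]
  ring

end

end Params

/-! ### Splitting integrals along the cells -/

namespace SimpleSemiLevy

variable {Ω : Type*} [mΩ : MeasurableSpace Ω] {P : Measure Ω} (L : SimpleSemiLevy P)

lemma jumpSq_mul_add (m : ℕ) {r : ℕ} (hr : 1 ≤ r) : L.jumpSq (m * L.l + r) = L.jumpSq r := by
  have : L.cellType (m * L.l + r) = L.cellType r := by
    apply Fin.ext
    show (m * L.l + r - 1) % L.l = (r - 1) % L.l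
    rw [Nat.add_sub_assoc hr, Nat.mul_comm, Nat.mul_add_mod]
  rw [jumpSq, jumpSq, this]

lemma integral_sqAt_mul {f : ℝ → ℝ} {k : ℕ} {x y : ℝ} (hx : L.part k ≤ x) (hxy : x ≤ y)
    (hy : y ≤ L.part (k + 1)) :
    ∫ u in x..y, L.sqAt u * f u = L.jumpSq (k + 1) * ∫ u in x..y, f u := by
  rw [← intervalIntegral.integral_const_mul]
  refine intervalIntegral.integral_congr_uIoo fun u hu => ?_
  rw [Set.uIoo_of_le hxy] at hu
  simp only [sqAt, L.cellIdx_eq ⟨hx.trans hu.1.le, hu.2.trans_le hy⟩]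

lemma integral_sqAt_mul_of_lt {f : ℝ → ℝ} {J J' : ℕ} {x y : ℝ}
    (hx : x ∈ Set.Ico (L.part J) (L.part (J + 1)))
    (hy : y ∈ Set.Ico (L.part J') (L.part (J' + 1))) (hJ : J < J')
    (hf : IntervalIntegrable (fun u => L.sqAt u * f u) volume x y) :
    ∫ u in x..y, L.sqAt u * f u = L.jumpSq (J + 1) * (∫ u in x..L.part (J + 1), f u)
      + L.jumpSq (J' + 1) * (∫ u in L.part J'..y, f u)
      + ∑ k ∈ Finset.Ico (J + 1) J',
        L.jumpSq (k + 1) * ∫ u in L.part k..L.part (k + 1), f u := by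
  have hmono := L.part_strictMono.monotone
  have h1 : L.part (J + 1) ≤ L.part J' := hmono hJ
  have hxy : x ≤ y := hx.2.le.trans (h1.trans hy.1)
  have hsub : ∀ c d, x ≤ c → c ≤ d → d ≤ y →
      IntervalIntegrable (fun u => L.sqAt u * f u) volume c d := fun c d hc hcd hd =>
    hf.mono_set (by
      rw [Set.uIcc_of_le hcd, Set.uIcc_of_le hxy]; exact Set.Icc_subset_Icc hc hd)
  have hcells : ∀ k ∈ Set.Ico (J + 1) J',
      IntervalIntegrable (fun u => L.sqAt u * f u) volume (L.part k) (L.part (k + 1)) :=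
    fun k hk => hsub _ _ (hx.2.le.trans (hmono hk.1)) (hmono (Nat.le_succ k))
      ((hmono hk.2).trans hy.1)
  have hmid := intervalIntegral.sum_integral_adjacent_intervals_Ico (show J + 1 ≤ J' from hJ) hcells
  rw [← intervalIntegral.integral_add_adjacent_intervals
      (hsub x (L.part (J + 1)) le_rfl hx.2.le (h1.trans hy.1))
      (hsub (L.part (J + 1)) y hx.2.le (h1.trans hy.1) le_rfl),
    ← intervalIntegral.integral_add_adjacent_intervals
      (hsub (L.part (J + 1)) (L.part J') hx.2.le h1 hy.1)
      (hsub (L.part J') y (hx.2.le.trans h1) hy.1 le_rfl), ← hmid,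
    L.integral_sqAt_mul hx.1 hx.2.le le_rfl, L.integral_sqAt_mul le_rfl hy.1 hy.2.le,
    Finset.sum_congr rfl fun k _ => L.integral_sqAt_mul le_rfl (hmono (Nat.le_succ k)) le_rfl]
  ring

/-- The integral of a function weighted by the second moments of the jumps, cell by cell. -/
lemma integral_sqAt_mul_eq {f : ℝ → ℝ} {I : ℝ → ℝ → ℝ} {m m' i i' : ℕ} {x y : ℝ} (hxy : x ≤ y)
    (hi : 1 ≤ i) (hi' : 1 ≤ i') (hx : x ∈ L.cell (m * L.l + i))
    (hy : y ∈ L.cell ((m + m') * L.l + i'))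
    (hf : IntervalIntegrable (fun u => L.sqAt u * f u) volume x y)
    (hI : ∀ c d, x ≤ c → c ≤ d → ∫ u in c..d, f u = I c d) :
    (m * L.l + i = (m + m') * L.l + i' →
      ∫ u in x..y, L.sqAt u * f u = L.jumpSq i * I x y) ∧
    (m * L.l + i ≠ (m + m') * L.l + i' →
      ∫ u in x..y, L.sqAt u * f u = L.jumpSq i * I x (L.part (m * L.l + i))
        + L.jumpSq i' * I (L.part ((m + m') * L.l + i' - 1)) y
        + ∑ r ∈ Finset.Ico i (m' * L.l + i' - 1),
          L.jumpSq (r + 1) * I (L.part (m * L.l + r)) (L.part (m * L.l + r + 1))) := by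
  have hmono := L.part_strictMono.monotone
  -- Cells are numbered from 1 and partition points from 0: the cell J + 1 starts at `part J`.
  obtain ⟨J, hJ⟩ : ∃ J, m * L.l + i = J + 1 := ⟨m * L.l + i - 1, by omega⟩
  obtain ⟨J', hJ'⟩ : ∃ J', (m + m') * L.l + i' = J' + 1 :=
    ⟨(m + m') * L.l + i' - 1, by omega⟩
  have hx' : x ∈ Set.Ico (L.part J) (L.part (J + 1)) := by
    rw [cell, hJ] at hx; exact hx
  have hy' : y ∈ Set.Ico (L.part J') (L.part (J' + 1)) := by
    rw [cell, hJ'] at hy; exact hy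
  have hji : L.jumpSq (J + 1) = L.jumpSq i := by rw [← hJ, L.jumpSq_mul_add m hi]
  have hji' : L.jumpSq (J' + 1) = L.jumpSq i' := by rw [← hJ', L.jumpSq_mul_add _ hi']
  have hle : J ≤ J' := L.idx_le_of_lt hx'.1 hxy hy'.2
  refine ⟨fun h => ?_, fun h => ?_⟩
  · have hJJ : J = J' := by omega
    subst hJJ
    rw [L.integral_sqAt_mul hx'.1 hxy hy'.2.le, hji, hI x y le_rfl hxy]
  · have hlt : J < J' := by omega
    have h1 : x ≤ L.part J' := hx'.2.le.trans (hmono hlt)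
    rw [L.integral_sqAt_mul_of_lt hx' hy' hlt hf, hji, hji', hJ, hJ', Nat.add_sub_cancel,
      hI _ _ le_rfl hx'.2.le, hI _ _ h1 hy'.1]
    congr 1
    -- The cells strictly between the first and the last are reindexed by k = m l + r; periodicity
    -- then drops m l from the second moment.
    have hend : m * L.l + (m' * L.l + i' - 1) = J' := by
      have : (m + m') * L.l = m * L.l + m' * L.l := add_mul _ _ _
      omega
    rw [← hJ, ← hend, add_comm (m * L.l) i, add_comm (m * L.l) (m' * L.l + i' - 1),
      ← Finset.sum_Ico_add]
    refine Finset.sum_congr rfl fun r hr => ?_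
    have hir := (Finset.mem_Ico.1 hr).1
    rw [hI _ _ (hx'.2.le.trans (hmono (by omega))) (hmono (Nat.le_succ _)), add_assoc,
      L.jumpSq_mul_add m (Nat.le_add_left 1 r)]
    rfl

/-- The cells of two points. -/
lemma exists_cells {x y : ℝ} (hx : 0 ≤ x) (hxy : x ≤ y) :
    L.cellIdx x / L.l ≤ L.cellIdx y / L.l ∧
    x ∈ L.cell (L.cellIdx x / L.l * L.l + (L.cellIdx x % L.l + 1)) := by
  have h1 := L.mem_cellIdx hx
  have h2 := L.mem_cellIdx (hx.trans hxy)
  refine ⟨Nat.div_le_div_right (L.idx_le_of_lt h1.1 hxy h2.2), ?_⟩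
  rw [← add_assoc, Nat.div_add_mod', cell, Nat.add_sub_cancel]
  exact h1

end SimpleSemiLevy

/-! ### Moments and covariances of the increments of G -/

namespace Params

variable {p q : ℕ} {C : Params p q}
variable {Ω : Type*} [mΩ : MeasurableSpace Ω] {P : Measure Ω} [IsProbabilityMeasure P]
  {L : SimpleSemiLevy P} {Y : ℝ → Ω → Fin q → ℝ} (hY : C.IsState L Y)
  (hpath : ∀ᵐ ω ∂P, C.IsStatePath L (fun u => Y u ω) ω)

lemma dom_eq_sqrtDom_sq (t : ℝ) (ω : Ω) : C.dom L Y t ω = C.sqrtDom L Y t ω ^ 2 :=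
  (sqrt_mul_R_sq t).symm

include hY

lemma aestronglyMeasurable_dom {t : ℝ} (ht : 0 ≤ t) : AEStronglyMeasurable (C.dom L Y t) P :=
  (hY.measurable_zero.norm.add_const 1).aestronglyMeasurable.mul
    (((aestronglyMeasurable_R ht).mono (L.future_le le_rfl)).pow 2)

lemma aestronglyMeasurable_sqrtDom {t : ℝ} (ht : 0 ≤ t) :
    AEStronglyMeasurable (C.sqrtDom L Y t) P :=
  (hY.measurable_zero.norm.add_const 1).sqrt.aestronglyMeasurable.mul
    ((aestronglyMeasurable_R ht).mono (L.future_le le_rfl))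

lemma integrable_sqrtDom (hY₁ : Integrable (Y 0) P) {t : ℝ} (ht : 0 ≤ t) :
    Integrable (C.sqrtDom L Y t) P := by
  refine (hY.integrable_dom hY₁ ht).mono' (aestronglyMeasurable_sqrtDom hY ht)
    (ae_of_all _ fun ω => ?_)
  have h1 := C.one_le_dom L Y t ω
  have h2 := C.sqrtDom_nonneg L Y t ω
  rw [dom_eq_sqrtDom_sq] at h1 ⊢
  rw [Real.norm_of_nonneg h2]
  nlinarith

include hpath

lemma integrable_V (hY₁ : Integrable (Y 0) P) {s : ℝ} (hs : 0 ≤ s) :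
    Integrable (C.V Y s) P := by
  have hv := fun u (hu : 0 ≤ u) => (aestronglyMeasurable_vol (C := C) hpath hu le_rfl).mono
    (hY.past_le u)
  rcases hs.eq_or_lt with rfl | hs
  · have h := integrable_mul_vol hY hpath le_rfl (X := fun _ => 1)
      stronglyMeasurable_const.aestronglyMeasurable
      (integrable_one_mul_dom hY hpath hY₁ le_rfl) le_rfl le_rfl
    exact h.congr (ae_of_all _ fun ω => by simp [V, vol])
  · refine ((hY.integrable_dom hY₁ hs.le).const_mul
      ((|C.α₀| + ‖C.al‖) * Real.exp (‖C.Bc‖ * s))).mono' ?_ ?_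
    · refine aestronglyMeasurable_of_tendsto_ae atTop
        (f := fun m ω => C.vol (Y (gridFloor 0 s m s) ω))
        (fun m => hv _ (gridFloor_mem hs ⟨hs, le_rfl⟩ m).1) ?_
      filter_upwards [hpath] with ω hω
      rw [C.V_eq hs]
      exact ((C.continuous_vol.tendsto _).comp (hω.left_lim s hs)).comp (tendsto_gridFloor hs s)
    · filter_upwards [hpath] with ω hω
      rw [C.V_eq hs]
      refine le_of_tendsto ((C.continuous_vol.tendsto _).comp (hω.left_lim s hs)).norm ?_
      filter_upwards [Ico_mem_nhdsLT hs] with x hx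
      refine (hω.abs_vol_le hx.1 hx.2.le).trans ?_
      have := C.dom_mono L Y hx.1 hx.2.le ω
      gcongr

section

variable {s t : ℝ} (hs : 0 ≤ s) (hst : s < t)
include hs hst

omit hY in
lemma ae_G_sub_pow_le (k : ℕ) : ∀ᵐ ω ∂P, |(C.G L Y t ω - C.G L Y s ω) ^ (2 * k)|
    ≤ C.gBound L s t ^ (2 * k) * C.dom L Y t ω ^ k := by
  filter_upwards [hpath] with ω hω
  rw [dom_eq_sqrtDom_sq, ← pow_mul, ← mul_pow, abs_pow]
  exact pow_le_pow_left₀ (abs_nonneg _) (hω.abs_G_sub_le hs hst) _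

lemma memLp_G_sub_two (hY₁ : Integrable (Y 0) P) :
    MemLp (fun ω => C.G L Y t ω - C.G L Y s ω) 2 P := by
  have hm := aestronglyMeasurable_G_sub hY hpath hs hst
  rw [memLp_two_iff_integrable_sq hm]
  refine ((hY.integrable_dom hY₁ (hs.trans hst.le)).const_mul (C.gBound L s t ^ 2)).mono'
    (hm.pow 2) ?_
  filter_upwards [ae_G_sub_pow_le hpath hs hst 1] with ω hω
  simpa using hω

variable (hD : Integrable (fun ω => C.dom L Y t ω ^ 2) P)
include hD

lemma memLp_G_sub_sq : MemLp (fun ω => (C.G L Y t ω - C.G L Y s ω) ^ 2) 2 P := by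
  have hm : AEStronglyMeasurable (fun ω => (C.G L Y t ω - C.G L Y s ω) ^ 2) P :=
    (aestronglyMeasurable_G_sub hY hpath hs hst).pow 2
  rw [memLp_two_iff_integrable_sq hm]
  refine (hD.const_mul (C.gBound L s t ^ 4)).mono' (hm.pow 2) ?_
  filter_upwards [ae_G_sub_pow_le hpath hs hst 2] with ω hω
  rw [Real.norm_eq_abs, ← pow_mul]
  exact hω

lemma memLp_G_sub_four : MemLp (fun ω => C.G L Y t ω - C.G L Y s ω) 4 P := by
  have hm := aestronglyMeasurable_G_sub hY hpath hs hst
  rw [← integrable_norm_rpow_iff hm (by norm_num) (by norm_num)]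
  refine (memLp_G_sub_sq hY hpath hs hst hD).integrable_sq.congr (ae_of_all _ fun ω => ?_)
  have e : (4 : ℝ≥0∞).toReal = ((4 : ℕ) : ℝ) := by norm_num
  simp only [e, Real.rpow_natCast, Real.norm_eq_abs]
  rw [← pow_mul, (by decide : Even 4).pow_abs]

end

lemma memLp_state {t : ℝ} (ht : 0 ≤ t) (hD : Integrable (fun ω => C.dom L Y t ω ^ 2) P) :
    MemLp (Y t) 2 P := by
  have hm := (aestronglyMeasurable_state hpath ht le_rfl).mono (hY.past_le t)
  refine MemLp.of_le_mul (g := C.dom L Y t) (c := Real.exp (‖C.Bc‖ * t))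
    ((memLp_two_iff_integrable_sq (aestronglyMeasurable_dom hY ht)).2 hD) hm ?_
  filter_upwards [hpath] with ω hω
  have h := hω.norm_le ht le_rfl
  rw [Real.norm_of_nonneg (C.dom_nonneg L Y t ω)]
  linarith

lemma integrable_G_sub_sq_mul_dom {s t : ℝ} (hs : 0 ≤ s) (hst : s < t)
    (hD : ∀ u, 0 ≤ u → Integrable (fun ω => C.dom L Y u ω ^ 2) P) {u : ℝ} (hu : 0 ≤ u) :
    Integrable (fun ω => (C.G L Y t ω - C.G L Y s ω) ^ 2 * C.dom L Y u ω) P :=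
  (memLp_G_sub_sq hY hpath hs hst (hD t (hs.trans hst.le))).integrable_mul
    ((memLp_two_iff_integrable_sq (aestronglyMeasurable_dom hY hu)).2 (hD u hu))

section Centred

variable (hmean : ∀ t, 0 ≤ t → ∫ ω, L.S t ω ∂P = 0) (hY₁ : Integrable (Y 0) P)
include hmean hY₁

lemma integral_G_sub {s t : ℝ} (hs : 0 ≤ s) (hst : s < t) :
    ∫ ω, (C.G L Y t ω - C.G L Y s ω) ∂P = 0 := by
  have h := integral_mul_G_sub hY hpath hmean hs hst (X := fun _ => 1)
    stronglyMeasurable_const.aestronglyMeasurable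
    (by simpa only [one_mul] using integrable_sqrtDom hY hY₁ (hs.trans hst.le))
  simpa only [one_mul] using h

/-- The earlier increment is itself an admissible weight for the orthogonality relation at time a:
it is measurable with respect to the past, and both it and `sqrtDom` are square integrable. -/
lemma covariance_G_sub {s t a b : ℝ} (hs : 0 ≤ s) (hst : s < t) (hta : t ≤ a) (hab : a < b) :
    cov[fun ω => C.G L Y t ω - C.G L Y s ω, fun ω => C.G L Y b ω - C.G L Y a ω; P] = 0 := by
  have ha := hs.trans (hst.le.trans hta)
  have hA := memLp_G_sub_two hY hpath hs hst hY₁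
  have hB := memLp_G_sub_two hY hpath ha hab hY₁
  rw [covariance_eq_sub hA hB, integral_G_sub hY hpath hmean hY₁ ha hab, mul_zero, sub_zero]
  refine integral_mul_G_sub hY hpath hmean ha hab
    ((aestronglyMeasurable_past_G_sub hpath hs hst).mono (past_mono hta)) ?_
  have hS : MemLp (C.sqrtDom L Y b) 2 P := by
    rw [memLp_two_iff_integrable_sq (aestronglyMeasurable_sqrtDom hY (ha.trans hab.le))]
    simpa only [← dom_eq_sqrtDom_sq] using hY.integrable_dom hY₁ (ha.trans hab.le)
  exact hA.integrable_mul hS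

lemma integral_G_sub_sq {s t : ℝ} (hs : 0 ≤ s) (hst : s < t) :
    ∫ ω, (C.G L Y t ω - C.G L Y s ω) ^ 2 ∂P
      = ∫ u in s..t, L.sqAt u * ((∫ ω, C.V Y u ω ∂P) * L.rate u) := by
  have h := integral_mul_G_sub_sq hY hpath hmean hs hst (X := fun _ => 1)
    stronglyMeasurable_const.aestronglyMeasurable
    (integrable_one_mul_dom hY hpath hY₁ (hs.trans hst.le))
  simp only [one_mul] at h
  rw [h]
  congr 1
  funext u
  rw [smul_eq_mul]
  ring

omit hmean in
lemma intervalIntegrable_integral_V {s t : ℝ} (hs : 0 ≤ s) (hst : s < t) {d : ℝ → ℝ}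
    (hd : IntervalIntegrable d volume s t) :
    IntervalIntegrable (fun u => d u • ∫ ω, C.V Y u ω ∂P) volume s t := by
  have h := intervalIntegrable_integral_mul_V hY hpath hs hst (X := fun _ => 1)
    stronglyMeasurable_const.aestronglyMeasurable
    (integrable_one_mul_dom hY hpath hY₁ (hs.trans hst.le)) hd
  simpa only [one_mul] using h

variable {t r : ℝ} (ht : 0 ≤ t) (hr : 0 < r)
  (hD : ∀ u, 0 ≤ u → Integrable (fun ω => C.dom L Y u ω ^ 2) P)
include ht hr hD

-- This is `integral_mul_V_sub` with the squared increment as weight, admissible because it and the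
-- dominating variable are square integrable.
omit hmean in
lemma integral_sq_mul_V_sub {u : ℝ} (hu : t + r < u) :
    (∫ ω, C.incr L Y r t ω ^ 2 * C.V Y u ω ∂P)
      - (∫ ω, C.incr L Y r t ω ^ 2 ∂P) * ∫ ω, C.V Y u ω ∂P
      = C.a ⬝ᵥ (C.meanJ L (t + r) u *ᵥ C.covGY L Y r t) := by
  have htr : t < t + r := by linarith
  have hXm : AEStronglyMeasurable[past L Y (t + r)] (fun ω => C.incr L Y r t ω ^ 2) P :=
    (continuous_pow 2).comp_aestronglyMeasurable (aestronglyMeasurable_past_G_sub hpath ht htr)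
  have hX2 : MemLp (fun ω => C.incr L Y r t ω ^ 2) 2 P :=
    memLp_G_sub_sq hY hpath ht htr (hD _ (by linarith))
  have h := integral_mul_V_sub hY hpath hY₁ (by linarith) hXm
    (fun v hv => integrable_G_sub_sq_mul_dom hY hpath ht htr hD hv)
    (hX2.integrable one_le_two) hu
  simp only [one_mul] at h
  rw [h]
  congr 2
  funext k
  rw [covGY, covariance_eq_sub hX2 ((memLp_pi_iff.1 (memLp_state hY hpath (by linarith)
    (hD (t + r) (by linarith)))) k)]
  rfl

/-- The covariance of the squared increments, before the cells are separated. -/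
lemma covariance_sq {a b : ℝ} (ha : t + r ≤ a) (hab : a < b) :
    IntervalIntegrable (fun u => L.sqAt u * (C.a ⬝ᵥ C.covIntegrand L Y r t u)) volume a b ∧
    cov[fun ω => C.incr L Y r t ω ^ 2, fun ω => (C.G L Y b ω - C.G L Y a ω) ^ 2; P]
      = ∫ u in a..b, L.sqAt u * (C.a ⬝ᵥ C.covIntegrand L Y r t u) := by
  have htr : t < t + r := by linarith
  have ha0 : 0 ≤ a := by linarith
  have hXm : AEStronglyMeasurable[past L Y a] (fun ω => C.incr L Y r t ω ^ 2) P :=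
    (continuous_pow 2).comp_aestronglyMeasurable
      ((aestronglyMeasurable_past_G_sub hpath ht htr).mono (past_mono ha))
  have hX2 : MemLp (fun ω => C.incr L Y r t ω ^ 2) 2 P :=
    memLp_G_sub_sq hY hpath ht htr (hD _ (by linarith))
  have hXd := integrable_G_sub_sq_mul_dom hY hpath ht htr hD (ha0.trans hab.le)
  have hd := L.sqAt_rate_intervalIntegrable ha0 hab.le
  have h1 := integral_mul_G_sub_sq hY hpath hmean ha0 hab hXm hXd
  have i1 := intervalIntegrable_integral_mul_V hY hpath ha0 hab hXm hXd hd
  have h2 := integral_mul_G_sub_sq hY hpath hmean ha0 hab (X := fun _ => 1)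
    stronglyMeasurable_const.aestronglyMeasurable
    (integrable_one_mul_dom hY hpath hY₁ (ha0.trans hab.le))
  have i2 := intervalIntegrable_integral_V hY hpath hY₁ ha0 hab hd
  simp only [one_mul] at h2
  have i3 := i2.const_mul (∫ ω, C.incr L Y r t ω ^ 2 ∂P)
  -- Agreement on the open interval is enough. At u = a it may be unavailable, since a = t + r is
  -- allowed and the left limit of J needs u > t + r.
  have e : Set.EqOn (fun u => (L.sqAt u * L.rate u) • (∫ ω, C.incr L Y r t ω ^ 2 * C.V Y u ω ∂P)
      - (∫ ω, C.incr L Y r t ω ^ 2 ∂P) * ((L.sqAt u * L.rate u) • ∫ ω, C.V Y u ω ∂P))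
      (fun u => L.sqAt u * (C.a ⬝ᵥ C.covIntegrand L Y r t u)) (Set.uIoo a b) := by
    intro u hu
    rw [Set.uIoo_of_le hab.le] at hu
    simp only [covIntegrand, dotProduct_smul, smul_eq_mul]
    rw [← integral_sq_mul_V_sub hY hpath hY₁ ht hr hD (ha.trans_lt hu.1)]
    ring
  refine ⟨(i1.sub i3).congr_uIoo e, ?_⟩
  rw [covariance_eq_sub hX2 (memLp_G_sub_sq hY hpath ha0 hab (hD _ (ha0.trans hab.le))),
    ← intervalIntegral.integral_congr_uIoo e, intervalIntegral.integral_sub i1 i3,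
    intervalIntegral.integral_const_mul, ← h2, ← h1]
  rfl

omit hmean hY₁ hD hpath hY in
lemma intervalIntegrable_covIntegrand {a b : ℝ} (ha : t + r ≤ a) (hab : a ≤ b) (k : Fin q) :
    IntervalIntegrable (fun u => C.covIntegrand L Y r t u k) volume a b := by
  rcases hab.eq_or_lt with rfl | hab
  · exact IntervalIntegrable.refl
  have htr : 0 ≤ t + r := by linarith
  exact intervalIntegrable_meanJ htr ha hab _ k
    (L.rate_intervalIntegrable (htr.trans ha) (htr.trans (ha.trans hab.le)))

omit hmean hY₁ hD hpath hY in
lemma integral_dot_covIntegrand {a b : ℝ} (ha : t + r ≤ a) (hab : a ≤ b) :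
    ∫ u in a..b, C.a ⬝ᵥ C.covIntegrand L Y r t u = C.a ⬝ᵥ C.covIntegral L Y r t a b := by
  simp only [dotProduct, covIntegral]
  rw [intervalIntegral.integral_finsetSum fun k _ =>
    (intervalIntegrable_covIntegrand ht hr ha hab k).const_mul _]
  simp only [intervalIntegral.integral_const_mul]

end Centred

end Params

end SSCogarch

/-! ### Choice of the cells and conclusion -/

theorem proposition4p4 {Ω : Type*} [MeasurableSpace Ω] (P : Measure Ω) [IsProbabilityMeasure P]
    (L : SSCogarch.SimpleSemiLevy P) {p₀ q₀ : ℕ} (C : SSCogarch.Params p₀ q₀)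
    (Y : ℝ → Ω → Fin q₀ → ℝ) (hY : C.IsState L Y)
    -- the driving process has mean zero
    (hmean : ∀ t, 0 ≤ t → ∫ ω, L.S t ω ∂P = 0)
    -- the volatility is non-negative
    (hV : ∀ᵐ ω ∂P, ∀ t, 0 ≤ t → 0 ≤ C.V Y t ω)
    (hY₁ : Integrable (Y 0) P)
    (t p h : ℝ) (ht : 0 ≤ t) (hp : 0 < p) (hh : p ≤ h) :
    -- (a) the increments are centred and uncorrelated
    (MemLp (C.incr L Y p t) 2 P ∧ MemLp (C.incr L Y p (t + h)) 2 P ∧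
      ∫ ω, C.incr L Y p t ω ∂P = 0 ∧
      cov[C.incr L Y p t, C.incr L Y p (t + h); P] = 0) ∧
    -- (b) the second moment of the increments
    (∀ s, 0 ≤ s → Integrable (C.V Y s) P) ∧
    IntervalIntegrable (fun s => (∫ ω, C.V Y s ω ∂P) * L.rate s) volume t (t + p) ∧
    ∃ m m' i i' : ℕ,
      i ∈ Finset.Icc 1 L.l ∧ i' ∈ Finset.Icc 1 L.l ∧
      t ∈ L.cell (m * L.l + i) ∧ t + p ∈ L.cell ((m + m') * L.l + i') ∧
      (m * L.l + i = (m + m') * L.l + i' →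
        ∫ ω, C.incr L Y p t ω ^ 2 ∂P =
          L.jumpSq i * ∫ s in t..(t + p), (∫ ω, C.V Y s ω ∂P) * L.rate s) ∧
      (m * L.l + i ≠ (m + m') * L.l + i' →
        ∫ ω, C.incr L Y p t ω ^ 2 ∂P =
          L.jumpSq i * (∫ s in t..(L.part (m * L.l + i)), (∫ ω, C.V Y s ω ∂P) * L.rate s)
          + L.jumpSq i' * (∫ s in (L.part ((m + m') * L.l + i' - 1))..(t + p),
              (∫ ω, C.V Y s ω ∂P) * L.rate s)
          + ∑ r ∈ Finset.Ico i (m' * L.l + i' - 1), L.jumpSq (r + 1) *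
              ∫ s in (L.part (m * L.l + r))..(L.part (m * L.l + r + 1)),
                (∫ ω, C.V Y s ω ∂P) * L.rate s) ∧
      -- (b) the autocovariance of the squared increments
      ∃ n n' j j' : ℕ,
        m ≤ n ∧ m + m' ≤ n + n' ∧
        j ∈ Finset.Icc 1 L.l ∧ j' ∈ Finset.Icc 1 L.l ∧
        t + h ∈ L.cell (n * L.l + j) ∧ t + h + p ∈ L.cell ((n + n') * L.l + j') ∧
        ((∀ s, 0 ≤ s → Integrable (fun ω => L.S s ω ^ 4) P) → MemLp (Y 0) 2 P →
          MemLp (C.incr L Y p t) 4 P ∧ MemLp (C.incr L Y p (t + h)) 4 P ∧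
          MemLp (Y (t + p)) 2 P ∧
          (∀ s, t + p < s → ∀ x y, Integrable (fun ω => C.Jminus L (t + p) s ω x y) P) ∧
          (∀ k, IntervalIntegrable (fun s => C.covIntegrand L Y p t s k) volume
            (t + h) (t + h + p)) ∧
          (n * L.l + j = (n + n') * L.l + j' →
            cov[fun ω => C.incr L Y p t ω ^ 2, fun ω => C.incr L Y p (t + h) ω ^ 2; P] =
              L.jumpSq j * (C.a ⬝ᵥ C.covIntegral L Y p t (t + h) (t + h + p))) ∧
          (n * L.l + j ≠ (n + n') * L.l + j' →
            cov[fun ω => C.incr L Y p t ω ^ 2, fun ω => C.incr L Y p (t + h) ω ^ 2; P] =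
              L.jumpSq j * (C.a ⬝ᵥ
                C.covIntegral L Y p t (t + h) (L.part (n * L.l + j)))
              + L.jumpSq j' * (C.a ⬝ᵥ
                C.covIntegral L Y p t (L.part ((n + n') * L.l + j' - 1)) (t + h + p))
              + ∑ r ∈ Finset.Ico j (n' * L.l + j' - 1), L.jumpSq (r + 1) * (C.a ⬝ᵥ
                C.covIntegral L Y p t (L.part (n * L.l + r)) (L.part (n * L.l + r + 1))))) := by
  have hpath := hY.ae_isStatePath hV
  have htp : t < t + p := by linarith
  have hh0 : 0 ≤ t + h := by linarith
  have hhp : t + h < t + h + p := by linarith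
  -- Here h ≥ p enters: the second increment starts no earlier than the first one ends, so the first
  -- lies in its past.
  have hph : t + p ≤ t + h := by linarith
  -- For a point with cell number k counted from 0, the witnesses are the quotient k / l and the
  -- type k % l + 1. The primed offsets are differences of quotients; these truncated subtractions
  -- are exact because quotients increase with time.
  obtain ⟨c1, c2⟩ := L.exists_cells ht htp.le
  obtain ⟨-, c3⟩ := L.exists_cells (ht.trans htp.le) (le_refl (t + p))
  obtain ⟨d1, d2⟩ := L.exists_cells hh0 hhp.le
  obtain ⟨-, d3⟩ := L.exists_cells (hh0.trans hhp.le) (le_refl (t + h + p))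
  obtain ⟨e1, -⟩ := L.exists_cells ht (show t ≤ t + h by linarith)
  obtain ⟨e2, -⟩ := L.exists_cells (ht.trans htp.le) (show t + p ≤ t + h + p by linarith)
  have hmod : ∀ x, L.cellIdx x % L.l + 1 ∈ Finset.Icc 1 L.l := fun x =>
    Finset.mem_Icc.2 ⟨Nat.le_add_left 1 _, Nat.mod_lt _ L.l_pos⟩
  have c4 : t + p ∈ L.cell ((L.cellIdx t / L.l + (L.cellIdx (t + p) / L.l - L.cellIdx t / L.l))
      * L.l + (L.cellIdx (t + p) % L.l + 1)) := by rwa [Nat.add_sub_cancel' c1]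
  have d4 : t + h + p ∈ L.cell ((L.cellIdx (t + h) / L.l +
      (L.cellIdx (t + h + p) / L.l - L.cellIdx (t + h) / L.l))
      * L.l + (L.cellIdx (t + h + p) % L.l + 1)) := by rwa [Nat.add_sub_cancel' d1]
  have hf : IntervalIntegrable (fun u => L.sqAt u * ((∫ ω, C.V Y u ω ∂P) * L.rate u)) volume
      t (t + p) := by
    have hi := SSCogarch.Params.intervalIntegrable_integral_V hY hpath hY₁ ht htp
      (L.sqAt_rate_intervalIntegrable ht htp.le)
    refine hi.congr_uIoo fun u _ => ?_
    simp only [smul_eq_mul]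
    ring
  have hsq := L.integral_sqAt_mul_eq
    (I := fun c d => ∫ s in c..d, (∫ ω, C.V Y s ω ∂P) * L.rate s) htp.le
    (Nat.le_add_left 1 _) (Nat.le_add_left 1 _) c2 c4 hf fun _ _ _ _ => rfl
  rw [← SSCogarch.Params.integral_G_sub_sq hY hpath hmean hY₁ ht htp] at hsq
  refine ⟨⟨SSCogarch.Params.memLp_G_sub_two hY hpath ht htp hY₁,
    SSCogarch.Params.memLp_G_sub_two hY hpath hh0 hhp hY₁,
    SSCogarch.Params.integral_G_sub hY hpath hmean hY₁ ht htp,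
    SSCogarch.Params.covariance_G_sub hY hpath hmean hY₁ ht htp hph hhp⟩,
    fun s hs => SSCogarch.Params.integrable_V hY hpath hY₁ hs, ?_,
    L.cellIdx t / L.l, L.cellIdx (t + p) / L.l - L.cellIdx t / L.l,
    L.cellIdx t % L.l + 1, L.cellIdx (t + p) % L.l + 1, hmod _, hmod _, c2, c4, hsq.1, hsq.2,
    L.cellIdx (t + h) / L.l, L.cellIdx (t + h + p) / L.l - L.cellIdx (t + h) / L.l,
    L.cellIdx (t + h) % L.l + 1, L.cellIdx (t + h + p) % L.l + 1, e1, ?_, hmod _, hmod _, d2, d4,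
    fun h4 hY₂ => ?_⟩
  · have hi := SSCogarch.Params.intervalIntegrable_integral_V hY hpath hY₁ ht htp
      (L.rate_intervalIntegrable ht (ht.trans htp.le))
    simpa only [smul_eq_mul, mul_comm] using hi
  · rw [Nat.add_sub_cancel' c1, Nat.add_sub_cancel' d1]
    exact e2
  have hD := fun u (hu : 0 ≤ u) => hY.integrable_dom_sq h4 hY₂ hu
  have hcov := SSCogarch.Params.covariance_sq hY hpath hmean hY₁ ht hp hD hph hhp
  have hcells := L.integral_sqAt_mul_eq (I := fun c d => C.a ⬝ᵥ C.covIntegral L Y p t c d) hhp.le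
    (Nat.le_add_left 1 _) (Nat.le_add_left 1 _) d2 d4 hcov.1 fun c d hc hcd =>
      SSCogarch.Params.integral_dot_covIntegrand ht hp (hph.trans hc) hcd
  rw [← hcov.2] at hcells
  exact ⟨SSCogarch.Params.memLp_G_sub_four hY hpath ht htp (hD _ (by linarith)),
    SSCogarch.Params.memLp_G_sub_four hY hpath hh0 hhp (hD _ (by linarith)),
    SSCogarch.Params.memLp_state hY hpath (by linarith) (hD _ (by linarith)),
    fun s hs x y => SSCogarch.Params.integrable_Jminus (by linarith) hs x y,
    fun k => SSCogarch.Params.intervalIntegrable_covIntegrand ht hp hph hhp.le k,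
    hcells.1, hcells.2⟩
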